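/- Let $M$ be a smooth 3-manifold (without boundary) with a contact form $\alpha$ such that the contact manifold $(M,\ker\alpha)$ is overtwisted, i.e. there is a smoothly embedded closed disc $\Delta\subset M$ whose characteristic foliation $T\Delta\cap\ker\alpha$ has exactly one singular point, lying in the interior of $\Delta$, and has $\partial\Delta$ as its only closed (compact) leaf. Let $\{\phi_\theta\}_{\theta\in\mathbb{R}/2\pi\mathbb{Z}}$, $\phi_0=\mathrm{id}$, be a smooth loop of contactomorphisms of $(M,\ker\alpha)$ which is positive, i.e. $\alpha(\partial_\theta\phi_\theta(p))>0$ for all $\theta$ and $p$, and suppose that it is generated by the contact Hamiltonian $H_\theta:M\to\mathbb{R}$, $\theta\in\mathbb{R}/2\pi\mathbb{Z}$; that is, $\partial_\theta\phi_\theta=X_\theta\circ\phi_\theta$, where $\alpha(X_\theta)=H_\theta$ and $\iota_{X_\theta}d\alpha=-dH_\theta+dH_\theta(R_\alpha)\,\alpha$, with $R_\alpha$ the Reeb vector field of $\alpha$. Let $\delta>0$ and suppose that $H_\theta(p)<\delta^2$ for all $\theta$ and $p$. Then $\big(M\times\mathbb{D}^2(\delta),\ker(\alpha+r^2d\theta)\big)$,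 where $\mathbb{D}^2(\delta)$ is the open disc of radius $\delta$ with polar coordinates $(r,\theta)$, contains a plastikstufe with singular set $S^1$ (a PS-structure): there is a smooth embedding $\iota:\mathbb{D}^2\times S^1\to M\times\mathbb{D}^2(\delta)$ of the solid torus, $\mathbb{D}^2$ being the closed unit disc, such that the 1-form $\beta=\iota^*(\alpha+r^2d\theta)$ has the following properties: $\beta$ vanishes exactly on the core $\{0\}\times S^1$; the boundary torus $\partial\mathbb{D}^2\times S^1$ is the unique closed leaf of the singular foliation $\ker\beta$; and the interior minus the core is foliated by an $S^1$-family of leaves which are stripes $(0,1)\times S^1$, each starting at the core $\{0\}\times S^1$ at one end and asymptotically approaching $\partial\mathbb{D}^2\times S^1$ at the other end. -/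

import Mathlib

open Set Filter Topology
open scoped Manifold ContDiff

noncomputable section

namespace ContactTopology

section Forms

variable {E : Type*} [NormedAddCommGroup E] [NormedSpace ℝ E]
  {K : Type*} [TopologicalSpace K] {I : ModelWithCorners ℝ E K}
  {M : Type*} [TopologicalSpace M] [ChartedSpace K M]
  {F : Type*} [NormedAddCommGroup F] [NormedSpace ℝ F]
  {G : Type*} [TopologicalSpace G] {J : ModelWithCorners ℝ F G}
  {N : Type*} [TopologicalSpace N] [ChartedSpace G N]

/-- The differential 1-form `α` on `M` is smooth, as a section of the cotangent bundle. -/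
def IsSmoothForm [IsManifold I ∞ M] (α : ∀ x : M, TangentSpace I x →L[ℝ] ℝ) : Prop :=
  ContMDiff I (I.prod 𝓘(ℝ, E →L[ℝ] ℝ)) ∞
    (fun x => (Bundle.TotalSpace.mk' (E →L[ℝ] ℝ) x (α x) :
      Bundle.TotalSpace (E →L[ℝ] ℝ)
        (fun x => TangentSpace I x →L[ℝ] Bundle.Trivial M ℝ x)))

/-- The pullback `f^*α` of a 1-form `α` on `M` by a map `f : N → M`. -/
def pullbackForm (α : ∀ x : M, TangentSpace I x →L[ℝ] ℝ) (f : N → M) (x : N) :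
    TangentSpace J x →L[ℝ] ℝ :=
  (α (f x)).comp (mfderiv J I f x)

/-- The 1-form `α` written in the preferred chart at `x₀`: its pullback to the model vector
space by the inverse of the chart. -/
def formInChart (α : ∀ x : M, TangentSpace I x →L[ℝ] ℝ) (x₀ : M) (y : E) : E →L[ℝ] ℝ :=
  pullbackForm (J := 𝓘(ℝ, E)) α (extChartAt I x₀).symm y

/-- The exterior derivative of a 1-form (on a manifold without boundary),
`dα (u, v) = ∂_u (α v) - ∂_v (α u)`, computed in the preferred chart at `x`; this is the chart
by which `TangentSpace I x` is identified with `E`. -/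
def extD (α : ∀ x : M, TangentSpace I x →L[ℝ] ℝ) (x : M) (u v : TangentSpace I x) : ℝ :=
  fderiv ℝ (formInChart α x) (extChartAt I x x) u v -
    fderiv ℝ (formInChart α x) (extChartAt I x x) v u

/-- `α` is a contact form: it is smooth, vanishes nowhere, and `dα` is nondegenerate on the
hyperplane distribution `ker α`. -/
structure IsContactForm [IsManifold I ∞ M] (α : ∀ x : M, TangentSpace I x →L[ℝ] ℝ) : Prop where
  smooth : IsSmoothForm α
  ne_zero : ∀ x, α x ≠ 0
  nondegenerate : ∀ (x : M) (u : TangentSpace I x), α x u = 0 → u ≠ 0 →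
    ∃ v : TangentSpace I x, α x v = 0 ∧ extD α x u v ≠ 0

/-- `R` is the value at `x` of the Reeb vector field of `α`. -/
def IsReebVector (α : ∀ x : M, TangentSpace I x →L[ℝ] ℝ) (x : M) (R : TangentSpace I x) : Prop :=
  α x R = 1 ∧ ∀ v : TangentSpace I x, extD α x R v = 0

/-- The differential `dh_x (v)` of a real function `h` on `M`. -/
def dfun (h : M → ℝ) (x : M) (v : TangentSpace I x) : ℝ :=
  mfderiv I 𝓘(ℝ, ℝ) h x v

/-- `X` is the value at `x` of the contact Hamiltonian vector field of `h` with respect to `α`: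
`α (X) = h` and `ι_X dα = -dh + dh (R) α`, with `R` the Reeb vector field. -/
def IsContactHamiltonianVector (α : ∀ x : M, TangentSpace I x →L[ℝ] ℝ) (h : M → ℝ) (x : M)
    (X : TangentSpace I x) : Prop :=
  α x X = h x ∧ ∃ R : TangentSpace I x, IsReebVector α x R ∧
    ∀ v : TangentSpace I x, extD α x X v = -dfun h x v + dfun h x R * α x v

/-- The velocity at time `t` of the trajectory of `p` under the isotopy `φ`. -/
def velocity (φ : ℝ → M ≃ₘ⟮I, I⟯ M) (t : ℝ) (p : M) : TangentSpace I (φ t p) :=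
  mfderiv 𝓘(ℝ, ℝ) I (fun s : ℝ => φ s p) t (1 : ℝ)

/-- The diffeomorphism `ψ` is a contactomorphism: it preserves `ker α`. -/
def IsContactomorphism (α : ∀ x : M, TangentSpace I x →L[ℝ] ℝ) (ψ : M ≃ₘ⟮I, I⟯ M) : Prop :=
  ∀ (x : M) (v : TangentSpace I x), α (ψ x) (mfderiv I I ψ x v) = 0 ↔ α x v = 0

/-- A smooth loop `φ_θ`, `θ ∈ ℝ / 2πℤ`, of contactomorphisms, based at the identity. -/
structure IsContactLoop (α : ∀ x : M, TangentSpace I x →L[ℝ] ℝ)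
    (φ : ℝ → M ≃ₘ⟮I, I⟯ M) : Prop where
  smooth : ContMDiff (𝓘(ℝ, ℝ).prod I) I ∞ (fun q : ℝ × M => φ q.1 q.2)
  contacto : ∀ t, IsContactomorphism α (φ t)
  zero : ∀ p, φ 0 p = p
  periodic : ∀ t p, φ (t + 2 * Real.pi) p = φ t p

/-- A positive loop: every point moves in a direction positively transverse to `ker α`. -/
structure IsPositiveLoop (α : ∀ x : M, TangentSpace I x →L[ℝ] ℝ)
    (φ : ℝ → M ≃ₘ⟮I, I⟯ M) : Prop extends IsContactLoop α φ where
  pos : ∀ t p, 0 < α (φ t p) (velocity φ t p)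

/-- The loop `φ` is generated by the contact Hamiltonian `H_θ`, `θ ∈ ℝ / 2πℤ`, with respect to
`α`: it is the flow of the contact Hamiltonian vector fields of the functions `H_θ`. -/
structure IsGeneratedBy (α : ∀ x : M, TangentSpace I x →L[ℝ] ℝ)
    (H : ℝ → M → ℝ) (φ : ℝ → M ≃ₘ⟮I, I⟯ M) : Prop where
  smooth : ContMDiff (𝓘(ℝ, ℝ).prod I) 𝓘(ℝ, ℝ) ∞ (fun q : ℝ × M => H q.1 q.2)
  periodic : ∀ t p, H (t + 2 * Real.pi) p = H t p
  flow : ∀ t p, IsContactHamiltonianVector α (H t) (φ t p) (velocity φ t p)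

/-! Leaves of the singular foliation `ker β` on a subset `D`. -/

/-- The regular points in `D` of the singular foliation `ker β`. -/
def regularSet (β : ∀ x : N, TangentSpace J x →L[ℝ] ℝ) (D : Set N) : Set N :=
  {x | x ∈ D ∧ β x ≠ 0}

/-- `x` and `y` are joined by a `C¹` path of regular points of `D` that is tangent to `ker β`. -/
def TangentJoined (β : ∀ x : N, TangentSpace J x →L[ℝ] ℝ) (D : Set N) (x y : N) : Prop :=
  ∃ γ : ℝ → N, ContMDiffOn 𝓘(ℝ, ℝ) J 1 γ (Icc 0 1) ∧ γ 0 = x ∧ γ 1 = y ∧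
    ∀ t ∈ Icc (0 : ℝ) 1, γ t ∈ regularSet β D ∧
      β (γ t) (mfderivWithin 𝓘(ℝ, ℝ) J γ (Icc 0 1) t (1 : ℝ)) = 0

/-- `L` is a (regular) leaf of `ker β` on `D`: all the points that can be reached from some
regular point by piecewise `C¹` paths tangent to `ker β`. -/
def IsLeaf (β : ∀ x : N, TangentSpace J x →L[ℝ] ℝ) (D : Set N) (L : Set N) : Prop :=
  ∃ x ∈ regularSet β D, L = {y | Relation.EqvGen (TangentJoined β D) x y}

/-- A closed leaf is a compact leaf. -/
def IsClosedLeaf (β : ∀ x : N, TangentSpace J x →L[ℝ] ℝ) (D : Set N) (L : Set N) : Prop :=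
  IsLeaf β D L ∧ IsCompact L

/-- `f`, restricted to the closed unit disc, is an overtwisted disc for `ker α`: a smoothly
embedded closed disc whose characteristic foliation has exactly one singular point, which is
interior, and has the boundary circle as its only closed leaf. -/
structure IsOvertwistedDisc (α : ∀ x : M, TangentSpace I x →L[ℝ] ℝ) (f : ℂ → M) : Prop where
  smooth : ∃ U : Set ℂ, IsOpen U ∧ Metric.closedBall 0 1 ⊆ U ∧ ContMDiffOn 𝓘(ℝ, ℂ) I ∞ f U
  injOn : InjOn f (Metric.closedBall 0 1)
  immersion : ∀ z ∈ Metric.closedBall (0 : ℂ) 1, Function.Injective (mfderiv 𝓘(ℝ, ℂ) I f z)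
  singular : ∃ z₀ ∈ Metric.ball (0 : ℂ) 1, ∀ z ∈ Metric.closedBall (0 : ℂ) 1,
    pullbackForm (J := 𝓘(ℝ, ℂ)) α f z = 0 ↔ z = z₀
  closedLeaf : ∀ L : Set ℂ,
    IsClosedLeaf (pullbackForm (J := 𝓘(ℝ, ℂ)) α f) (Metric.closedBall 0 1) L ↔
      L = Metric.sphere 0 1

/-- `ker α` is overtwisted: there is an overtwisted disc. -/
def IsOvertwisted (α : ∀ x : M, TangentSpace I x →L[ℝ] ℝ) : Prop :=
  ∃ f : ℂ → M, IsOvertwistedDisc α f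

/-- The solid torus `𝔻² × S¹`. -/
def solidTorus : Set (ℂ × Circle) := Metric.closedBall 0 1 ×ˢ univ

/-- `ι`, restricted to the solid torus `𝔻² × S¹`, is a plastikstufe (PS-structure) with singular
set `S¹` for `ker α`. -/
structure IsPlastikstufe (α : ∀ x : M, TangentSpace I x →L[ℝ] ℝ) (ι : ℂ × Circle → M) :
    Prop where
  /- `ι` is a smooth embedding of the solid torus -/
  smooth : ∃ U : Set (ℂ × Circle), IsOpen U ∧ solidTorus ⊆ U ∧
    ContMDiffOn (𝓘(ℝ, ℂ).prod (𝓡 1)) I ∞ ι U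
  injOn : InjOn ι solidTorus
  immersion : ∀ x ∈ solidTorus, Function.Injective (mfderiv (𝓘(ℝ, ℂ).prod (𝓡 1)) I ι x)
  /- the singular set of `ker ι^*α` is the core -/
  singular : ∀ x ∈ solidTorus,
    pullbackForm (J := 𝓘(ℝ, ℂ).prod (𝓡 1)) α ι x = 0 ↔ x.1 = 0
  /- the boundary torus is the unique closed leaf -/
  closedLeaf : ∀ L : Set (ℂ × Circle),
    IsClosedLeaf (pullbackForm (J := 𝓘(ℝ, ℂ).prod (𝓡 1)) α ι) solidTorus L ↔
      L = Metric.sphere 0 1 ×ˢ univ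
  /- the rest of the interior is foliated by an `S¹`-family of stripes `(0,1) × S¹`: the leaf
  with parameter `c` is the image of the smooth stripe `(t, s) ↦ Φ (c, t, s)`, which starts at
  the core and approaches the boundary torus -/
  stripes : ∃ Φ : OpenPartialHomeomorph (Circle × ℝ × Circle) (ℂ × Circle),
    Φ.source = univ ×ˢ Ioo (0 : ℝ) 1 ×ˢ univ ∧
    Φ.target = (Metric.ball 0 1 \ {0}) ×ˢ univ ∧
    ∀ c : Circle,
      ContMDiffOn (𝓘(ℝ, ℝ).prod (𝓡 1)) (𝓘(ℝ, ℂ).prod (𝓡 1)) ∞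
        (fun q : ℝ × Circle => Φ (c, q)) (Ioo (0 : ℝ) 1 ×ˢ univ) ∧
      (∀ q ∈ Ioo (0 : ℝ) 1 ×ˢ (univ : Set Circle), Function.Injective
        (mfderiv (𝓘(ℝ, ℝ).prod (𝓡 1)) (𝓘(ℝ, ℂ).prod (𝓡 1))
          (fun q : ℝ × Circle => Φ (c, q)) q)) ∧
      IsLeaf (pullbackForm (J := 𝓘(ℝ, ℂ).prod (𝓡 1)) α ι) solidTorus
        ((fun q : ℝ × Circle => Φ (c, q)) '' (Ioo (0 : ℝ) 1 ×ˢ univ)) ∧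
      (∀ s : Circle, Tendsto (fun q : ℝ × Circle => Φ (c, q)) (𝓝[>] 0 ×ˢ 𝓝 s) (𝓝 (0, s))) ∧
      Tendsto (fun q : ℝ × Circle => ‖(Φ (c, q)).1‖) (𝓝[<] 1 ×ˢ ⊤) (𝓝 1)

/-- The 1-form `r² dθ = x dy - y dx` on the plane. -/
def rSqDTheta (z : ℂ) : TangentSpace 𝓘(ℝ, ℂ) z →L[ℝ] ℝ :=
  (z.re • Complex.imCLM - z.im • Complex.reCLM : ℂ →L[ℝ] ℝ)

/-- The 1-form `α + r² dθ` on `M × ℂ`, the sum of the pullbacks by the two projections. -/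
def stabilizedForm (α : ∀ x : M, TangentSpace I x →L[ℝ] ℝ) (q : M × ℂ) :
    TangentSpace (I.prod 𝓘(ℝ, ℂ)) q →L[ℝ] ℝ :=
  pullbackForm (J := I.prod 𝓘(ℝ, ℂ)) α Prod.fst q +
    pullbackForm (J := I.prod 𝓘(ℝ, ℂ)) rSqDTheta Prod.snd q

end Forms

end ContactTopology

end

open ContactTopology

/-!
The solid torus is swept out by the overtwisted disc. At the time `θ` the loop moves the disc `f` to
`φ_θ ∘ f`, and the point `φ_θ (f z)` is placed in `M × ℂ` over the point of the plane with argument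
`-θ` and squared radius `H_θ (φ_θ (f z))`; as `0 < H < δ ^ 2`, this lies in the punctured disc of
radius `δ`. Along the loop, `α` takes the value `H_θ` on the velocity and `r ^ 2 dθ` takes the value
`-H_θ`, so that the form `β` induced on the torus vanishes in the direction of the circle
(`torusForm_apply`). Since the `φ_θ` are contactomorphisms, the kernel of `β` is that of the
pullback of `f^*α` to the product of the disc with the circle. So the leaves on the torus are the
products with the circle of the leaves of the characteristic foliation on the disc
(`IsLiftedForm.isLeaf_iff`), and everything is reduced to that foliation.

On the disc, the claim is that all leaves in the interior spiral from the singular point to the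
boundary circle and that they form a circle. After a Möbius transformation the singular point is
`0`, and a suitable rescaling of the field spanning the foliation has a flow which preserves the
disc, turns with constant angular speed near the boundary, and has no periodic orbit in the
punctured open disc, since such an orbit would be another closed leaf (`exists_isSpiralFlow`). The
contact condition gives only that the divergence of the field at `0` is not zero: the linearization
may be degenerate. Still, the equilibrium repels in forward or backward time
(`exists_isRepellingRegion`): if the determinant is positive this is linear algebra, and otherwise
one uses that the index of the field is `1`, because the field is tangent to the boundary circle
(`exists_log_div`).

The Poincaré–Bendixson theorem (`exists_periodic_mem`) then takes the orbits close to the boundary,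
where the return map to a radius has no fixed point, hence moves all points in one direction
(`IsSpiralFlow.exists_isReturnSegment`). A fundamental interval of the return map, sheared along the
flow, closes up to a circle which meets every orbit exactly once (`IsReturnSegment.exists_section`),
and the flow identifies the punctured disc with the product of this circle and the line of times
(`IsSpiralFlow.exists_homeomorph`). This product structure gives the stripes.
-/

open ContactTopology

/-! ### Flows of vector fields -/

/-- The flow `φ` integrates the vector field `X`. -/
def Flow.Integrates {E : Type*} [NormedAddCommGroup E] [NormedSpace ℝ E] (φ : Flow ℝ E)
    (X : E → E) : Prop :=
  ∀ x t, HasDerivAt (fun s => φ s x) (X (φ t x)) t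

section FlowExistence

variable {E : Type*} [NormedAddCommGroup E] [NormedSpace ℝ E] {X : E → E} {K L : NNReal}

theorem exists_integralCurve_Ioo [CompleteSpace E] (hK : LipschitzWith K X)
    (hL : ∀ x, ‖X x‖ ≤ L) (x : E) {T : ℝ} (hT : 0 < T) :
    ∃ γ : ℝ → E, γ 0 = x ∧ ∀ t ∈ Ioo (-T) T, HasDerivAt γ (X (γ t)) t := by
  have h := IsPicardLindelof.of_time_independent (f := X) (tmin := -T) (tmax := T)
    (t₀ := ⟨0, by constructor <;> linarith⟩) (x₀ := x) (a := L * T.toNNReal) (r := 0) (L := L)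
    (K := K) (fun x _ => hL x) hK.lipschitzOnWith (by simp [hT.le])
  obtain ⟨γ, h0, hγ⟩ := h.exists_eq_forall_mem_Icc_hasDerivWithinAt₀
  exact ⟨γ, h0, fun t ht =>
    (hγ t (Ioo_subset_Icc_self ht)).hasDerivAt (Icc_mem_nhds ht.1 ht.2)⟩

theorem exists_integralCurve [CompleteSpace E] (hK : LipschitzWith K X)
    (hL : ∀ x, ‖X x‖ ≤ L) (x : E) :
    ∃ γ : ℝ → E, γ 0 = x ∧ ∀ t, HasDerivAt γ (X (γ t)) t := by
  choose g hg0 hg using fun T : {T : ℝ // 0 < T} => exists_integralCurve_Ioo hK hL x T.2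
  have key : ∀ S T : {T : ℝ // 0 < T}, S ≤ T → EqOn (g S) (g T) (Ioo (-S.1) S.1) := by
    intro S T hST
    have h : S.1 ≤ T.1 := hST
    exact ODE_solution_unique_of_mem_Ioo (v := fun _ => X) (s := fun _ => univ) (t₀ := 0)
      (fun _ _ => hK.lipschitzOnWith) ⟨by linarith [S.2], S.2⟩
      (fun t ht => ⟨hg S t ht, trivial⟩)
      (fun t ht => ⟨hg T t ⟨by linarith [ht.1], by linarith [ht.2]⟩, trivial⟩)
      (by rw [hg0, hg0])
  let G : ℝ → E := fun t => g ⟨|t| + 1, by positivity⟩ t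
  have hG : ∀ (T : {T : ℝ // 0 < T}) t, t ∈ Ioo (-T.1) T.1 → G t = g T t := by
    intro T t ht
    have ht' : t ∈ Ioo (-(|t| + 1)) (|t| + 1) :=
      abs_lt.1 (by linarith : |t| < |t| + 1)
    rcases le_total (⟨|t| + 1, by positivity⟩ : {T : ℝ // 0 < T}) T with h | h
    · exact key _ _ h ht'
    · exact (key _ _ h ht).symm
  refine ⟨G, (hg0 _), fun t => ?_⟩
  have hT : (0 : ℝ) < |t| + 1 := by positivity
  have ht : t ∈ Ioo (-(|t| + 1)) (|t| + 1) := abs_lt.1 (by linarith : |t| < |t| + 1)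
  have h1 : G =ᶠ[𝓝 t] g ⟨|t| + 1, hT⟩ := by
    filter_upwards [Ioo_mem_nhds ht.1 ht.2] with s hs using hG ⟨_, hT⟩ s hs
  have := (hg ⟨|t| + 1, hT⟩ t ht).congr_of_eventuallyEq h1
  rwa [← hG ⟨_, hT⟩ t ht] at this

theorem integralCurve_unique (hK : LipschitzWith K X) {γ δ : ℝ → E}
    (hγ : ∀ t, HasDerivAt γ (X (γ t)) t) (hδ : ∀ t, HasDerivAt δ (X (δ t)) t) {t₀ : ℝ}
    (h : γ t₀ = δ t₀) : γ = δ :=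
  ODE_solution_unique_univ (v := fun _ => X) (s := fun _ => univ)
    (fun _ => hK.lipschitzOnWith) (fun t => ⟨hγ t, trivial⟩) (fun t => ⟨hδ t, trivial⟩) h

/-- A bounded Lipschitz vector field is complete. -/
theorem exists_flow_integrates [CompleteSpace E] (hK : LipschitzWith K X)
    (hL : ∀ x, ‖X x‖ ≤ L) : ∃ φ : Flow ℝ E, φ.Integrates X := by
  choose g hg0 hg using exists_integralCurve hK hL
  have hcont : Continuous fun q : ℝ × E => g q.2 q.1 := by
    have hlipt : ∀ x, LipschitzWith L (g x) := fun x =>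
      lipschitzWith_of_nnnorm_deriv_le (fun t => (hg x t).differentiableAt) fun t => by
        rw [(hg x t).deriv]; exact hL _
    have hfwd : ∀ (Y : E → E) (h : E → ℝ → E), LipschitzWith K Y → (∀ x, h x 0 = x) →
        (∀ x t, HasDerivAt (h x) (Y (h x t)) t) →
        ∀ x y t, 0 ≤ t → dist (h x t) (h y t) ≤ dist x y * Real.exp (K * t) := by
      intro Y h hY h0 hd x y t ht
      have := dist_le_of_trajectories_ODE (v := fun _ => Y) (f := h x) (g := h y) (a := 0)
        (b := t) (δ := dist x y) (K := K) (fun _ => hY)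
        (fun s _ => (hd x s).continuousAt.continuousWithinAt)
        (fun s _ => (hd x s).hasDerivWithinAt)
        (fun s _ => (hd y s).continuousAt.continuousWithinAt)
        (fun s _ => (hd y s).hasDerivWithinAt) (by rw [h0, h0]) t ⟨ht, le_rfl⟩
      simpa using this
    have hlipx : ∀ x y t, dist (g x t) (g y t) ≤ dist x y * Real.exp (K * |t|) := by
      intro x y t
      rcases le_total 0 t with ht | ht
      · rw [abs_of_nonneg ht]; exact hfwd X g hK hg0 hg x y t ht
      · rw [abs_of_nonpos ht]
        have := hfwd (-X) (fun x t => g x (-t)) hK.neg (by simpa using hg0) (fun x t => by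
          simpa [Function.comp_def] using (hg x (-t)).scomp t (hasDerivAt_neg t)) x y (-t)
          (by linarith)
        simpa using this
    rw [continuous_iff_continuousAt]
    rintro ⟨t, x⟩
    rw [ContinuousAt, tendsto_iff_dist_tendsto_zero]
    refine squeeze_zero (fun _ => dist_nonneg)
      (g := fun q : ℝ × E => dist q.2 x * Real.exp (K * |q.1|) + L * dist q.1 t) ?_ ?_
    · rintro ⟨s, y⟩
      calc dist (g y s) (g x t) ≤ dist (g y s) (g x s) + dist (g x s) (g x t) :=
            dist_triangle _ _ _
        _ ≤ _ := add_le_add (hlipx y x s) ((hlipt x).dist_le_mul s t)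
    · have : Continuous fun q : ℝ × E =>
          dist q.2 x * Real.exp (K * |q.1|) + L * dist q.1 t := by fun_prop
      simpa using this.tendsto (t, x)
  refine ⟨{ toFun := fun t x => g x t, cont' := hcont, map_zero' := hg0, map_add' := ?_ }, hg⟩
  intro t₁ t₂ x
  have := integralCurve_unique (X := X) hK (γ := fun t => g x (t + t₂)) (δ := g (g x t₂)) (t₀ := 0)
    (fun t => (hg x (t + t₂)).comp_add_const t t₂) (hg _) (by simp [hg0])
  exact congrFun this t₁

end FlowExistence

namespace Flow.Integrates

variable {E : Type*} [NormedAddCommGroup E] [NormedSpace ℝ E] {X : E → E} {φ : Flow ℝ E}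

theorem reverse (h : φ.Integrates X) : φ.reverse.Integrates (-X) := fun x t => by
  simpa [Function.comp_def] using (h x (-t)).scomp t (hasDerivAt_neg t)

theorem continuous_orbit (_h : φ.Integrates X) (x : E) : Continuous fun t => φ t x :=
  φ.continuous continuous_id continuous_const

theorem fixed_of_zero {K : NNReal} (h : φ.Integrates X) (hK : LipschitzWith K X) {x : E}
    (hx : X x = 0) (t : ℝ) : φ t x = x :=
  congrFun (integralCurve_unique hK (γ := fun t => φ t x) (δ := fun _ => x) (t₀ := 0) (h x)
    (fun t => by rw [hx]; exact hasDerivAt_const _ _) (by simp)) t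

/-- The orbits of a smooth vector field are smooth curves. -/
theorem contDiff_orbit [CompleteSpace E] (h : φ.Integrates X) (hX : ContDiff ℝ ∞ X) (x : E) :
    ContDiff ℝ ∞ fun t => φ t x := by
  have key : ∀ n : ℕ, ContDiff ℝ n fun t => φ t x := by
    intro n
    induction n with
    | zero => exact contDiff_zero.2 (h.continuous_orbit x)
    | succ n ih =>
      rw [Nat.cast_succ, contDiff_succ_iff_deriv]
      refine ⟨fun t => (h x t).differentiableAt, by simp, ?_⟩
      rw [show deriv (fun t => φ t x) = fun t => X (φ t x) from funext fun t => (h x t).deriv]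
      exact (hX.of_le (by exact_mod_cast le_top)).comp ih
  exact contDiff_infty.2 key

/-- A curve whose velocity is everywhere a multiple of `X` stays in one orbit of the flow. -/
theorem exists_eq_of_hasDerivWithinAt_smul {K : NNReal} (h : φ.Integrates X)
    (hK : LipschitzWith K X) {γ : ℝ → E} {c : ℝ → ℝ} (hc : ContinuousOn c (Icc 0 1))
    (hγ : ∀ t ∈ Icc (0 : ℝ) 1, HasDerivWithinAt γ (c t • X (γ t)) (Icc 0 1) t) :
    ∃ T, φ T (γ 0) = γ 1 := by
  let c' : ℝ → ℝ := IccExtend (zero_le_one' ℝ) ((Icc (0 : ℝ) 1).domRestrict c)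
  have hc' : Continuous c' := (continuousOn_iff_continuous_domRestrict.1 hc).Icc_extend'
  have hcc : ∀ t ∈ Icc (0 : ℝ) 1, c' t = c t := fun t ht => by
    simp only [c', IccExtend_of_mem _ _ ht]; rfl
  let τ : ℝ → ℝ := fun t => ∫ s in (0 : ℝ)..t, c' s
  have hτ : ∀ t, HasDerivAt τ (c' t) t := fun t =>
    intervalIntegral.integral_hasDerivAt_right (hc'.intervalIntegrable _ _)
      hc'.stronglyMeasurable.stronglyMeasurableAtFilter hc'.continuousAt
  obtain ⟨B, hB⟩ : ∃ B : NNReal, ∀ t ∈ Icc (0 : ℝ) 1, ‖c t‖₊ ≤ B := by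
    obtain ⟨B, hB⟩ := isCompact_Icc.exists_bound_of_continuousOn hc
    exact ⟨B.toNNReal, fun t ht => by
      rw [← NNReal.coe_le_coe, coe_nnnorm]; exact (hB t ht).trans (Real.le_coe_toNNReal B)⟩
  have key : EqOn (fun t => φ (τ t) (γ 0)) γ (Icc 0 1) := by
    refine ODE_solution_unique_of_mem_Icc_right (v := fun t x => c t • X x) (s := fun _ => univ)
      (K := B * K) (fun t ht => ?_) ?_ ?_ (fun _ _ => trivial) ?_ ?_ (fun _ _ => trivial) ?_
    · refine (LipschitzWith.of_dist_le_mul fun x y => ?_).lipschitzOnWith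
      rw [dist_eq_norm, ← smul_sub, norm_smul, NNReal.coe_mul, mul_assoc, ← dist_eq_norm]
      exact mul_le_mul (by exact_mod_cast hB t (Ico_subset_Icc_self ht)) (hK.dist_le_mul x y)
        dist_nonneg B.2
    · exact (φ.continuous (continuous_iff_continuousAt.2 fun t => (hτ t).continuousAt)
        continuous_const).continuousOn
    · intro t ht
      have := (h (γ 0) (τ t)).scomp t (hτ t)
      rw [hcc t (Ico_subset_Icc_self ht)] at this
      exact this.hasDerivWithinAt
    · exact fun t ht => (hγ t ht).continuousWithinAt
    · intro t ht
      exact (hγ t (Ico_subset_Icc_self ht)).mono_of_mem_nhdsWithin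
        (Icc_mem_nhdsGE_of_mem ht)
    · simp [τ]
  exact ⟨τ 1, key ⟨zero_le_one, le_rfl⟩⟩

end Flow.Integrates

/-! ### Winding integrals -/

theorem IsPreconnected.eq_of_exp_eq_one {α : Type*} [TopologicalSpace α] {S : Set α}
    (hS : IsPreconnected S) {f : α → ℂ} (hf : ContinuousOn f S)
    (h1 : ∀ x ∈ S, Complex.exp (f x) = 1) {x y : α} (hx : x ∈ S) (hy : y ∈ S) : f x = f y := by
  have hd : IsDiscrete (range ((↑) : ℤ → ℝ)) := by
    refine ⟨?_⟩
    exact (Int.isClosedEmbedding_coe_real.isEmbedding.toHomeomorph.symm.isEmbedding).discreteTopology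
  have hn : ∀ z ∈ S, ∃ n : ℤ, f z = n * (2 * Real.pi * Complex.I) := fun z hz =>
    Complex.exp_eq_one_iff.1 (h1 z hz)
  have hr : ∀ (n : ℤ), ((n : ℂ) * (2 * Real.pi * Complex.I)).im / (2 * Real.pi) = n := by
    intro n
    have := Real.pi_pos
    simp
  have key := hS.constant_of_mapsTo hd (f := fun z => (f z).im / (2 * Real.pi))
    ((Complex.continuous_im.comp_continuousOn hf).div_const _) (fun z hz => by
      obtain ⟨n, hn⟩ := hn z hz
      exact ⟨n, by simp only [hn, hr]⟩) hx hy
  obtain ⟨n, hn'⟩ := hn x hx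
  obtain ⟨m, hm'⟩ := hn y hy
  simp only [hn', hm', hr] at key
  rw [hn', hm', show n = m by exact_mod_cast key]

section Winding

variable {γ γ' : ℝ → ℂ} {T : ℝ}

/-- The integral of `dz / (z - a)` along a `C¹` arc depends continuously on `a` off the arc. -/
theorem continuousOn_integral_inv_sub (hT : 0 ≤ T) (hγ : Continuous γ) (hγ' : Continuous γ') :
    ContinuousOn (fun a => ∫ t in (0 : ℝ)..T, γ' t / (γ t - a)) (γ '' Icc 0 T)ᶜ := by
  rw [continuousOn_iff_continuous_domRestrict]
  have h : Continuous fun a : ((γ '' Icc 0 T)ᶜ : Set ℂ) =>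
      ∫ t in (0 : ℝ)..T, γ' (projIcc 0 T hT t) / (γ (projIcc 0 T hT t) - a) := by
    refine intervalIntegral.continuous_parametric_intervalIntegral_of_continuous' ?_ 0 T
    have hp : Continuous fun q : ((γ '' Icc 0 T)ᶜ : Set ℂ) × ℝ =>
      ((projIcc 0 T hT q.2 : Icc 0 T) : ℝ) :=
      continuous_subtype_val.comp (continuous_projIcc.comp continuous_snd)
    refine (hγ'.comp hp).div ((hγ.comp hp).sub (continuous_subtype_val.comp continuous_fst)) ?_
    rintro ⟨a, t⟩ h0
    exact a.2 ⟨_, (projIcc 0 T hT t).2, sub_eq_zero.1 h0⟩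
  refine h.congr fun a => ?_
  refine intervalIntegral.integral_congr fun t ht => ?_
  rw [uIcc_of_le hT] at ht
  simp only [projIcc_of_mem hT ht]

theorem exp_integral_inv_sub (hT : 0 ≤ T) (hγ : ∀ t, HasDerivAt γ (γ' t) t) (hγ' : Continuous γ')
    {a : ℂ} (ha : a ∉ γ '' Icc 0 T) :
    Complex.exp (∫ t in (0 : ℝ)..T, γ' t / (γ t - a)) = (γ T - a) / (γ 0 - a) := by
  have hc : Continuous γ := continuous_iff_continuousAt.2 fun t => (hγ t).continuousAt
  have hne : ∀ t ∈ Icc 0 T, γ t - a ≠ 0 := fun t ht h => ha ⟨t, ht, sub_eq_zero.1 h⟩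
  let f : ℝ → ℂ := fun t => γ' (projIcc 0 T hT t) / (γ (projIcc 0 T hT t) - a)
  have hp : Continuous fun t : ℝ => ((projIcc 0 T hT t : Icc 0 T) : ℝ) :=
    continuous_subtype_val.comp continuous_projIcc
  have hf : Continuous f := (hγ'.comp hp).div ((hc.comp hp).sub continuous_const) fun t =>
    hne _ (projIcc 0 T hT t).2
  have hF : ∀ t, HasDerivAt (fun u => ∫ s in (0 : ℝ)..u, f s) (f t) t := fun t =>
    intervalIntegral.integral_hasDerivAt_right (hf.intervalIntegrable _ _)
      hf.stronglyMeasurable.stronglyMeasurableAtFilter hf.continuousAt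
  have hconst : ∀ t ∈ Icc 0 T, (fun t => Complex.exp (-∫ s in (0 : ℝ)..t, f s) * (γ t - a)) t =
      (fun t => Complex.exp (-∫ s in (0 : ℝ)..t, f s) * (γ t - a)) 0 := by
    have hd : ∀ t ∈ Ico 0 T, HasDerivWithinAt
        (fun t => Complex.exp (-∫ s in (0 : ℝ)..t, f s) * (γ t - a)) 0 (Ici t) t := by
      intro t ht
      have ht' := Ico_subset_Icc_self ht
      refine (HasDerivAt.congr_deriv (((hF t).neg.cexp).mul ((hγ t).sub_const a))
        ?_).hasDerivWithinAt
      have hft : f t * (γ t - a) = γ' t := by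
        simp only [f, projIcc_of_mem hT ht']
        exact div_mul_cancel₀ _ (hne t ht')
      rw [← hft]
      ring
    refine constant_of_has_deriv_right_zero ?_ hd
    refine ((Complex.continuous_exp.comp (Continuous.neg ?_)).mul
      (hc.sub continuous_const)).continuousOn
    exact continuous_iff_continuousAt.2 fun t => (hF t).continuousAt
  have h1 := hconst T ⟨hT, le_rfl⟩
  have h2 : ∫ t in (0 : ℝ)..T, γ' t / (γ t - a) = ∫ s in (0 : ℝ)..T, f s := by
    refine intervalIntegral.integral_congr fun t ht => ?_
    rw [uIcc_of_le hT] at ht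
    simp only [f, projIcc_of_mem hT ht]
  simp only [intervalIntegral.integral_same, neg_zero, Complex.exp_zero, one_mul] at h1
  rw [Complex.exp_neg] at h1
  rw [h2, eq_div_iff (hne 0 ⟨le_rfl, hT⟩), ← h1]
  field_simp [Complex.exp_ne_zero]

/-- `2πi` times the winding number about `a` of the loop that runs along the arc `γ|[0,T]` and
returns to its start along the straight segment: for `a` off the segment the principal logarithm
gives the contribution of the segment. -/
noncomputable def windingIntegral (γ γ' : ℝ → ℂ) (T : ℝ) (a : ℂ) : ℂ :=
  (∫ t in (0 : ℝ)..T, γ' t / (γ t - a)) + Complex.log ((γ 0 - a) / (γ T - a))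

/-- `(p - a) / (q - a)` is a negative real or zero only for `a` on the segment from `p` to `q`. -/
theorem div_sub_mem_slitPlane {p q a : ℂ} (hq : q - a ≠ 0)
    (h : ∀ s ∈ Icc (0 : ℝ) 1, a ≠ p + s * (q - p)) : (p - a) / (q - a) ∈ Complex.slitPlane := by
  by_contra hs
  obtain ⟨c, hc, hca⟩ : ∃ c : ℝ, 0 ≤ c ∧ (p - a) / (q - a) = -c := by
    rw [Complex.mem_slitPlane_iff, not_or, not_lt, not_not] at hs
    refine ⟨-((p - a) / (q - a)).re, by linarith [hs.1], ?_⟩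
    apply Complex.ext <;> simp [hs.2]
  rw [div_eq_iff hq] at hca
  have h1 : (1 + c : ℂ) ≠ 0 := by
    have : (1 + c : ℝ) ≠ 0 := by positivity
    exact_mod_cast this
  refine h (c / (1 + c)) ⟨by positivity, by rw [div_le_one (by positivity)]; linarith⟩ ?_
  push_cast
  field_simp
  linear_combination (-1 : ℂ) * hca

theorem windingIntegral_eq_of_isPreconnected (hT : 0 ≤ T) (hγ : ∀ t, HasDerivAt γ (γ' t) t)
    (hγ' : Continuous γ') {S : Set ℂ} (hS : IsPreconnected S)
    (h1 : ∀ a ∈ S, ∀ t ∈ Icc 0 T, a ≠ γ t)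
    (h2 : ∀ a ∈ S, ∀ s ∈ Icc (0 : ℝ) 1, a ≠ γ 0 + s * (γ T - γ 0)) {a b : ℂ} (ha : a ∈ S)
    (hb : b ∈ S) : windingIntegral γ γ' T a = windingIntegral γ γ' T b := by
  have hc : Continuous γ := continuous_iff_continuousAt.2 fun t => (hγ t).continuousAt
  have hS' : S ⊆ (γ '' Icc 0 T)ᶜ := by
    rintro a ha ⟨t, ht, rfl⟩
    exact h1 _ ha t ht rfl
  have hn0 : ∀ a ∈ S, γ 0 - a ≠ 0 := fun a ha h => h1 a ha 0 ⟨le_rfl, hT⟩ (sub_eq_zero.1 h).symm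
  have hnT : ∀ a ∈ S, γ T - a ≠ 0 := fun a ha h => h1 a ha T ⟨hT, le_rfl⟩ (sub_eq_zero.1 h).symm
  refine hS.eq_of_exp_eq_one ?_ ?_ ha hb
  · refine ((continuousOn_integral_inv_sub hT hc hγ').mono hS').add
      (ContinuousOn.clog ?_ fun a ha => div_sub_mem_slitPlane (hnT a ha) (h2 a ha))
    exact (continuousOn_const.sub continuousOn_id).div (continuousOn_const.sub continuousOn_id) hnT
  · intro a ha
    rw [windingIntegral, Complex.exp_add, exp_integral_inv_sub hT hγ hγ' (hS' ha),
      Complex.exp_log (div_ne_zero (hn0 a ha) (hnT a ha))]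
    field_simp [hn0 a ha, hnT a ha]

end Winding

/-! ### Recurrence in planar flows -/

section PlanarRecurrence

variable {X : ℂ → ℂ} {φ : Flow ℝ ℂ}

/-- The signed height of `z` over the line through `y` orthogonal to `v`. -/
noncomputable def transverseHeight (y v z : ℂ) : ℝ := ((z - y) * (starRingEnd ℂ) v).re

theorem continuous_transverseHeight (y v : ℂ) : Continuous (transverseHeight y v) := by
  unfold transverseHeight; fun_prop

theorem hasDerivAt_transverseHeight (h : φ.Integrates X) (y v z : ℂ) (t : ℝ) :
    HasDerivAt (fun t => transverseHeight y v (φ t z))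
      ((X (φ t z) * (starRingEnd ℂ) v).re) t := by
  have := (((h z t).sub_const y).mul_const ((starRingEnd ℂ) v))
  exact (Complex.reCLM.hasFDerivAt.comp_hasDerivAt t this)

/-- Near a regular point `y`, orbits cross the normal line at `y` in the direction of `X y`, for a
uniform time. -/
theorem exists_transverse_time (h : φ.Integrates X) (hX : Continuous X) {y : ℂ} (hy : X y ≠ 0) :
    ∃ ρ > 0, ∃ ε > 0, ∀ z ∈ Metric.closedBall y ρ,
      StrictMonoOn (fun t => transverseHeight y (X y) (φ t z)) (Icc (-ε) ε) := by
  have hpos : 0 < (X (φ 0 y) * (starRingEnd ℂ) (X y)).re := by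
    rw [φ.map_zero_apply, Complex.mul_conj, Complex.ofReal_re]
    exact Complex.normSq_pos.2 hy
  have hc : Continuous fun q : ℝ × ℂ => (X (φ q.1 q.2) * (starRingEnd ℂ) (X y)).re := by
    have : Continuous fun q : ℝ × ℂ => X (φ q.1 q.2) :=
      hX.comp (φ.continuous continuous_fst continuous_snd)
    fun_prop
  have hev : ∀ᶠ q : ℝ × ℂ in 𝓝 (0, y), 0 < (X (φ q.1 q.2) * (starRingEnd ℂ) (X y)).re :=
    hc.continuousAt.eventually (lt_mem_nhds hpos)
  obtain ⟨r, hr, hball⟩ := Metric.eventually_nhds_iff_ball.1 hev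
  refine ⟨r / 2, by positivity, r / 2, by positivity, fun z hz => ?_⟩
  refine strictMonoOn_of_hasDerivWithinAt_pos (convex_Icc _ _)
    ((continuous_transverseHeight _ _).comp (h.continuous_orbit z)).continuousOn
    (fun t _ => (hasDerivAt_transverseHeight h y (X y) z t).hasDerivWithinAt) ?_
  intro t ht
  rw [interior_Icc] at ht
  refine hball (t, z) ?_
  rw [Metric.mem_ball, Prod.dist_eq, max_lt_iff]
  refine ⟨?_, lt_of_le_of_lt hz (by linarith)⟩
  simp only [dist_zero_right, Real.norm_eq_abs]
  exact (abs_lt.2 ⟨by linarith [ht.1], by linarith [ht.2]⟩).trans (by linarith : r / 2 < r)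

/-- Orbits that pass close to a regular point `y` cross the normal line close to `y`. -/
theorem eventually_exists_transverseHeight_eq_zero (h : φ.Integrates X) {y v : ℂ} {ρ ε : ℝ}
    (hρ : 0 < ρ) (hε : 0 < ε)
    (hmono : StrictMonoOn (fun t => transverseHeight y v (φ t y)) (Icc (-ε) ε)) :
    ∀ᶠ z in 𝓝 y, ∃ t, |t| ≤ ε ∧ transverseHeight y v (φ t z) = 0 ∧
      φ t z ∈ Metric.closedBall y ρ := by
  have hev : ∀ᶠ q : ℝ × ℂ in 𝓝 (0, y), φ q.1 q.2 ∈ Metric.closedBall y ρ := by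
    have hc : Continuous fun q : ℝ × ℂ => φ q.1 q.2 := φ.continuous continuous_fst continuous_snd
    refine hc.continuousAt.eventually ?_
    simp only [φ.map_zero_apply]
    exact Metric.closedBall_mem_nhds y hρ
  obtain ⟨r, hr, hball⟩ := Metric.eventually_nhds_iff_ball.1 hev
  set e := min ε (r / 2) with he
  have he0 : 0 < e := lt_min hε (by positivity)
  have heε : e ≤ ε := min_le_left _ _
  have h0 : transverseHeight y v (φ 0 y) = 0 := by
    rw [φ.map_zero_apply]; simp [transverseHeight]
  have hneg : transverseHeight y v (φ (-e) y) < 0 := by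
    rw [← h0]
    exact hmono ⟨by linarith, by linarith⟩ ⟨by linarith, by linarith⟩ (by linarith)
  have hposi : 0 < transverseHeight y v (φ e y) := by
    rw [← h0]
    exact hmono ⟨by linarith, by linarith⟩ ⟨by linarith, by linarith⟩ (by linarith)
  have hct : ∀ t, Continuous fun z => transverseHeight y v (φ t z) := fun t =>
    (continuous_transverseHeight y v).comp (φ.continuous continuous_const continuous_id)
  filter_upwards [(hct (-e)).continuousAt.eventually (gt_mem_nhds hneg),
    (hct e).continuousAt.eventually (lt_mem_nhds hposi), Metric.ball_mem_nhds y hr] with z h1 h2 h3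
  have hivt := intermediate_value_Icc (show -e ≤ e by linarith)
    ((continuous_transverseHeight y v).comp (h.continuous_orbit z)).continuousOn
  obtain ⟨t, ht, ht0⟩ := hivt ⟨h1.le, h2.le⟩
  refine ⟨t, (abs_le.2 ht).trans heε, ht0, hball (t, z) ?_⟩
  rw [Metric.mem_ball, Prod.dist_eq, max_lt_iff]
  refine ⟨?_, h3⟩
  simp only [dist_zero_right, Real.norm_eq_abs]
  exact lt_of_le_of_lt ((abs_le.2 ht).trans (min_le_right _ _)) (by linarith)

/-- Points of the normal line through `y` are real multiples of any one of them. -/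
theorem exists_real_mul_of_transverseHeight_eq_zero {y v z w : ℂ} (hv : v ≠ 0) (hw : w ≠ y)
    (hz0 : transverseHeight y v z = 0) (hw0 : transverseHeight y v w = 0) :
    ∃ s : ℝ, z = y + s * (w - y) := by
  have hwy : w - y ≠ 0 := sub_ne_zero.2 hw
  have hcv : (starRingEnd ℂ) v ≠ 0 := by simpa using hv
  have hP : ∀ a : ℂ, (a * (starRingEnd ℂ) v).re = 0 →
      a * (starRingEnd ℂ) v = ((a * (starRingEnd ℂ) v).im : ℝ) * Complex.I := by
    intro a ha
    apply Complex.ext <;> simp [ha]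
  have h1 := hP _ hz0
  have h2 := hP _ hw0
  set m := ((z - y) * (starRingEnd ℂ) v).im
  set n := ((w - y) * (starRingEnd ℂ) v).im
  have hn : (n : ℂ) ≠ 0 := by
    intro hn
    rw [hn, zero_mul] at h2
    exact mul_ne_zero hwy hcv h2
  refine ⟨m / n, ?_⟩
  have : (z - y) * (starRingEnd ℂ) v = (m / n : ℝ) * (w - y) * (starRingEnd ℂ) v := by
    rw [h1, mul_assoc, h2]
    push_cast
    field_simp
  have := mul_right_cancel₀ hcv this
  linear_combination this

/-- Across the middle of the closing segment, `windingIntegral` jumps: if `φ` is transverse to the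
segment, the values before and after a crossing differ. -/
theorem windingIntegral_ne_across {γ γ' : ℝ → ℂ} {T : ℝ} (hT : 0 ≤ T) (hγ : Continuous γ)
    (hγ' : Continuous γ') {m v : ℂ} (hm : m = γ 0 + (1 / 2 : ℝ) * (γ T - γ 0))
    (hne : γ T ≠ γ 0) (hv : ((γ T - γ 0) * (starRingEnd ℂ) v).re = 0)
    (hmA : m ∉ γ '' Icc 0 T) {c : ℝ → ℂ} (hc : Continuous c) (hc0 : c 0 = m) {ε : ℝ} (hε : 0 < ε)
    (hpos : ∀ t ∈ Ioc 0 ε, 0 < ((c t - m) * (starRingEnd ℂ) v).re)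
    (hneg : ∀ t ∈ Ioc 0 ε, ((c (-t) - m) * (starRingEnd ℂ) v).re < 0)
    {w₁ w₂ : ℂ} (hw₁ : ∀ t ∈ Ioc 0 ε, windingIntegral γ γ' T (c t) = w₁)
    (hw₂ : ∀ t ∈ Ioc 0 ε, windingIntegral γ γ' T (c (-t)) = w₂) : w₁ ≠ w₂ := by
  -- The argument of `r a = (p - a) / (q - a)` is what `windingIntegral` adds to the continuous
  -- integral along the arc. On the segment `r` is negative, and a crossing exchanges its upper and
  -- lower sides, where `arg` differs by almost `2π`; the integral changes by less than `π`.
  intro heq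
  set p := γ 0
  set q := γ T
  have hpq : q - p ≠ 0 := sub_ne_zero.2 hne
  have hv0 : v ≠ 0 := by
    rintro rfl
    simpa using hpos ε ⟨hε, le_rfl⟩
  -- the segment direction is a nonzero real multiple `k` of `i v`
  obtain ⟨k, hk⟩ : ∃ k : ℝ, q - p = k * Complex.I * v := by
    have hnv : (Complex.normSq v : ℂ) ≠ 0 := by exact_mod_cast (Complex.normSq_pos.2 hv0).ne'
    refine ⟨((q - p) * (starRingEnd ℂ) v).im / Complex.normSq v, ?_⟩
    have h1 : (q - p) * (starRingEnd ℂ) v = (((q - p) * (starRingEnd ℂ) v).im : ℝ) * Complex.I := by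
      apply Complex.ext <;> simp [hv]
    push_cast
    field_simp
    rw [← h1, ← Complex.mul_conj]
    ring
  have hk0 : k ≠ 0 := by
    rintro rfl
    simp at hk
    exact hpq hk
  let r : ℂ → ℂ := fun a => (p - a) / (q - a)
  have hrm : r m = -1 := by
    have h2 : p - m = -(q - m) := by rw [hm]; push_cast; ring
    have h3 : q - m ≠ 0 := by
      have : q - m = (1 / 2 : ℂ) * (q - p) := by rw [hm]; push_cast; ring
      rw [this]
      exact mul_ne_zero (by norm_num) hpq
    simp only [r]
    rw [h2, neg_div, div_self h3]
  have hqm : q - m ≠ 0 := by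
    intro h0
    simp [r, h0] at hrm
  have hrc : ContinuousAt r m :=
    (continuousAt_const.sub continuousAt_id).div (continuousAt_const.sub continuousAt_id) hqm
  -- the imaginary part of `r` has the sign of `k` times the height over the segment
  have hrim : ∀ a, q - a ≠ 0 → (r a).im * Complex.normSq (q - a) =
      k * ((a - m) * (starRingEnd ℂ) v).re := by
    intro a ha
    have h1 : p - a = -((1 / 2 : ℝ) * (q - p)) - (a - m) := by rw [hm]; push_cast; ring
    have h2 : q - a = (1 / 2 : ℝ) * (q - p) - (a - m) := by rw [hm]; push_cast; ring
    have h3 : (r a).im * Complex.normSq (q - a) = ((p - a) * (starRingEnd ℂ) (q - a)).im := by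
      have : (p - a) * (starRingEnd ℂ) (q - a) = r a * (Complex.normSq (q - a) : ℝ) := by
        rw [← Complex.mul_conj]
        simp only [r]
        field_simp
      rw [this, Complex.im_mul_ofReal]
    rw [h3, h1, h2, hk]
    simp only [Complex.mul_im, Complex.mul_re, Complex.sub_re, Complex.sub_im, Complex.neg_re,
      Complex.neg_im, Complex.conj_re, Complex.conj_im, Complex.I_re, Complex.I_im,
      Complex.ofReal_re, Complex.ofReal_im]
    ring
  have hcc : ContinuousAt c 0 := hc.continuousAt
  have hcn : ContinuousAt (fun t => c (-t)) 0 := (hc.comp continuous_neg).continuousAt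
  have hI := (continuousOn_integral_inv_sub hT hγ hγ').continuousAt
    ((isCompact_Icc.image hγ).isClosed.isOpen_compl.mem_nhds hmA)
  set I : ℂ → ℂ := fun a => ∫ t in (0 : ℝ)..T, γ' t / (γ t - a)
  have hI1 : Tendsto (fun t => I (c (-t)) - I (c t)) (𝓝 0) (𝓝 0) := by
    have h1 : Tendsto (fun t => I (c (-t)) - I (c t)) (𝓝 0) (𝓝 (I m - I m)) :=
      ((show Tendsto I (𝓝 m) (𝓝 (I m)) from hI).comp (by simpa [hc0] using hcn.tendsto)).sub
        ((show Tendsto I (𝓝 m) (𝓝 (I m)) from hI).comp (by simpa [hc0] using hcc.tendsto))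
    simpa using h1
  -- for a crossing short enough, the integral changes by less than `π` and `r` stays in the left
  -- half-plane
  have hev1 : ∀ᶠ t in 𝓝 (0 : ℝ), ‖I (c (-t)) - I (c t)‖ < Real.pi := by
    have := hI1.norm
    rw [norm_zero] at this
    exact this.eventually (gt_mem_nhds Real.pi_pos)
  have hre : ∀ᶠ a in 𝓝 m, (r a).re < 0 ∧ q - a ≠ 0 := by
    have h1 : ∀ᶠ a in 𝓝 m, (r a).re < 0 :=
      (Complex.continuous_re.continuousAt.comp hrc).eventually
        (gt_mem_nhds (by simp [hrm]))
    exact h1.and ((continuousAt_const.sub continuousAt_id).eventually_ne hqm)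
  have hev2 : ∀ᶠ t in 𝓝 (0 : ℝ), (r (c t)).re < 0 ∧ q - c t ≠ 0 :=
    (show Tendsto c (𝓝 0) (𝓝 m) by simpa [hc0] using hcc.tendsto).eventually hre
  have hev3 : ∀ᶠ t in 𝓝 (0 : ℝ), (r (c (-t))).re < 0 ∧ q - c (-t) ≠ 0 :=
    (show Tendsto (fun t => c (-t)) (𝓝 0) (𝓝 m) by simpa [hc0] using hcn.tendsto).eventually hre
  have hex : ∃ t : ℝ, t ∈ Ioc 0 ε ∧ ‖I (c (-t)) - I (c t)‖ < Real.pi ∧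
      ((r (c t)).re < 0 ∧ q - c t ≠ 0) ∧ ((r (c (-t))).re < 0 ∧ q - c (-t) ≠ 0) := by
    have := (hev1.and (hev2.and hev3)).filter_mono (nhdsWithin_le_nhds (s := Ioi (0 : ℝ)))
    obtain ⟨t, h, ht⟩ := (this.and (eventually_mem_set.2 (Ioc_mem_nhdsGT hε))).exists
    exact ⟨t, ht, h⟩
  obtain ⟨t, ht, ht1, ⟨ht2, ht2'⟩, ht3, ht3'⟩ := hex
  have e1 := hw₁ t ht
  have e2 := hw₂ t ht
  rw [heq, ← e2] at e1
  have e3 : Complex.log (r (c t)) - Complex.log (r (c (-t))) = I (c (-t)) - I (c t) := by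
    simp only [windingIntegral] at e1
    linear_combination e1
  have e4 : |(r (c t)).arg - (r (c (-t))).arg| < Real.pi := by
    have : ((I (c (-t)) - I (c t))).im = (r (c t)).arg - (r (c (-t))).arg := by
      rw [← e3, Complex.sub_im, Complex.log_im, Complex.log_im]
    rw [← this]
    exact (Complex.abs_im_le_norm _).trans_lt ht1
  have hlow : ∀ a : ℂ, a.re < 0 → Real.pi / 2 < |a.arg| := fun a ha => by
    by_contra h0
    exact absurd (Complex.abs_arg_le_pi_div_two_iff.1 (not_lt.1 h0)) (not_le.2 ha)
  have hn1 := Complex.normSq_pos.2 ht2'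
  have hn2 := Complex.normSq_pos.2 ht3'
  have s1 := hrim _ ht2'
  have s2 := hrim _ ht3'
  have l1 := hlow _ ht2
  have l2 := hlow _ ht3
  have p1 := hpos t ht
  have p2 := hneg t ht
  -- the values of `r` before and after the crossing lie on opposite sides of the real axis
  have hprod : (r (c t)).im * (r (c (-t))).im < 0 := by
    have h1 : ((r (c t)).im * (r (c (-t))).im) *
        (Complex.normSq (q - c t) * Complex.normSq (q - c (-t))) < 0 := by
      calc _ = k ^ 2 * (((c t - m) * (starRingEnd ℂ) v).re *
            ((c (-t) - m) * (starRingEnd ℂ) v).re) := by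
            rw [show ((r (c t)).im * (r (c (-t))).im) *
              (Complex.normSq (q - c t) * Complex.normSq (q - c (-t))) =
              ((r (c t)).im * Complex.normSq (q - c t)) *
              ((r (c (-t))).im * Complex.normSq (q - c (-t))) by ring, s1, s2]
            ring
        _ < 0 := mul_neg_of_pos_of_neg (by positivity) (mul_neg_of_pos_of_neg p1 p2)
    exact neg_of_mul_neg_left h1 (by positivity)
  rcases mul_neg_iff.1 hprod with ⟨a1, a2⟩ | ⟨a1, a2⟩
  · have b1 : 0 ≤ (r (c t)).arg := Complex.arg_nonneg_iff.2 a1.le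
    have b2 : (r (c (-t))).arg < 0 := Complex.arg_neg_iff.2 a2
    rw [abs_of_nonneg b1] at l1
    rw [abs_of_neg b2] at l2
    have := (abs_lt.1 e4).2
    linarith
  · have b1 : 0 ≤ (r (c (-t))).arg := Complex.arg_nonneg_iff.2 a2.le
    have b2 : (r (c t)).arg < 0 := Complex.arg_neg_iff.2 a1
    rw [abs_of_nonneg b1] at l2
    rw [abs_of_neg b2] at l1
    have := (abs_lt.1 e4).1
    linarith

end PlanarRecurrence

section PoincareBendixson

variable {X : ℂ → ℂ} {φ : Flow ℝ ℂ}

/-- In the plane, a recurrent point of a flow at which the vector field does not vanish is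
periodic. -/
theorem exists_period_of_recurrent (h : φ.Integrates X) (hX : Continuous X) {y : ℂ}
    (hy : X y ≠ 0) (hrec : MapClusterPt y atTop fun t => φ t y) : ∃ T > 0, φ T y = y := by
  -- If `y` is not periodic, an arc of its orbit between consecutive crossings of a transverse
  -- segment, closed up along the segment, bounds a region that the orbit enters and cannot leave,
  -- which contradicts recurrence. Instead of the Jordan curve theorem, the winding integral `W`
  -- tells the two sides apart.
  by_contra! hper
  have hinj : ∀ s t, s < t → φ t y ≠ φ s y := by
    intro s t hst heq
    refine hper (t - s) (by linarith) ?_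
    have := congrArg (φ (-s)) heq
    rwa [← φ.map_add, ← φ.map_add, neg_add_cancel, φ.map_zero_apply, neg_add_eq_sub] at this
  set ℓ := transverseHeight y (X y) with hℓ
  have hℓc : Continuous ℓ := continuous_transverseHeight _ _
  have hℓy : ℓ y = 0 := by simp [hℓ, transverseHeight]
  obtain ⟨ρ, hρ, ε, hε, hmono⟩ := exists_transverse_time h hX hy
  have hyρ : y ∈ Metric.closedBall y ρ := Metric.mem_closedBall_self hρ.le
  have hcross : ∀ z ∈ Metric.closedBall y ρ, ℓ z = 0 → ∀ t ∈ Ioc 0 ε,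
      0 < ℓ (φ t z) ∧ ℓ (φ (-t) z) < 0 := by
    intro z hz hz0 t ht
    have h0 : ℓ (φ 0 z) = 0 := by rw [φ.map_zero_apply, hz0]
    rw [← h0]
    exact ⟨hmono z hz ⟨by linarith, by linarith⟩ ⟨by linarith [ht.1], ht.2⟩ ht.1,
      hmono z hz ⟨by linarith [ht.2], by linarith [ht.1]⟩ ⟨by linarith, by linarith⟩
        (by linarith [ht.1])⟩
  -- by recurrence the orbit crosses the normal line arbitrarily late and arbitrarily close to `y`
  have hreturn : ∀ r > 0, ∀ B, ∃ t > B, ℓ (φ t y) = 0 ∧ φ t y ∈ Metric.closedBall y r := by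
    intro r hr B
    have hev := eventually_exists_transverseHeight_eq_zero h hr hε (hmono y hyρ)
    obtain ⟨t, ⟨s, hs, hs0, hsr⟩, ht⟩ :=
      ((hrec.frequently hev).and_eventually (eventually_gt_atTop (B + ε))).exists
    refine ⟨s + t, by linarith [(abs_le.1 hs).1], ?_⟩
    rw [φ.map_add]
    exact ⟨hs0, hsr⟩
  -- the first return of the orbit of `y` to the normal segment of radius `ρ`
  let R : Set ℝ := {t | ε ≤ t ∧ ℓ (φ t y) = 0 ∧ φ t y ∈ Metric.closedBall y ρ}
  have hRc : IsClosed R := by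
    refine isClosed_Ici.inter (IsClosed.inter ?_ ?_)
    · exact isClosed_singleton.preimage (hℓc.comp (h.continuous_orbit y))
    · exact Metric.isClosed_closedBall.preimage (h.continuous_orbit y)
  have hRne : R.Nonempty := by
    obtain ⟨t, ht, h1, h2⟩ := hreturn ρ hρ ε
    exact ⟨t, ht.le, h1, h2⟩
  have hRb : BddBelow R := ⟨ε, fun t ht => ht.1⟩
  obtain ⟨hTε, hT0, hTρ⟩ : sInf R ∈ R := hRc.csInf_mem hRne hRb
  have hfirst : ∀ t, 0 < t → t < sInf R → ℓ (φ t y) = 0 → φ t y ∉ Metric.closedBall y ρ := by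
    intro t ht htT h0 hm
    rcases le_total t ε with htε | htε
    · exact (hcross y hyρ hℓy t ⟨ht, htε⟩).1.ne' h0
    · exact absurd (csInf_le hRb ⟨htε, h0, hm⟩) (not_le.2 htT)
  set T := sInf R
  have hTpos : 0 < T := lt_of_lt_of_le hε hTε
  set q := φ T y with hq
  have hqy : q ≠ y := hper T hTpos
  set d := q - y with hd
  have hd0 : d ≠ 0 := sub_ne_zero.2 hqy
  have hdn : 0 < ‖d‖ := norm_pos_iff.2 hd0
  set S := ρ / ‖d‖ with hS
  have hS1 : 1 ≤ S := by
    rw [hS, le_div_iff₀ hdn, one_mul, hd, ← dist_eq_norm]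
    exact hTρ
  -- the points of the normal line
  let σ : ℝ → ℂ := fun s => y + s * d
  have hσ1 : σ 1 = q := by simp [σ, hd]
  have hσinj : ∀ s s', σ s = σ s' → s = s' := by
    intro s s' hs
    simp only [σ, add_right_inj, mul_eq_mul_right_iff, hd0, or_false] at hs
    exact_mod_cast hs
  have hσℓ : ∀ s, ℓ (σ s) = 0 := by
    intro s
    have : ℓ (σ s) = s * ℓ q := by
      simp only [hℓ, transverseHeight, σ, add_sub_cancel_left, mul_assoc, Complex.re_ofReal_mul]
      rfl
    rw [this, hT0, mul_zero]
  have hσρ : ∀ s ∈ Icc (-S) S, σ s ∈ Metric.closedBall y ρ := by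
    intro s hs
    rw [mem_closedBall_iff_norm]
    simp only [σ, add_sub_cancel_left, norm_mul, Complex.norm_real, Real.norm_eq_abs]
    calc |s| * ‖d‖ ≤ S * ‖d‖ := by gcongr; exact abs_le.2 hs
      _ = ρ := by rw [hS]; field_simp
  have hσc : Continuous σ := by fun_prop
  have hlineσ : ∀ z, ℓ z = 0 → ∃ s : ℝ, z = σ s := fun z hz =>
    exists_real_mul_of_transverseHeight_eq_zero hy hqy hz hT0
  -- the orbit arc meets the normal segment only at its two ends
  have harc : ∀ t ∈ Icc 0 T, ∀ s ∈ Icc (-S) S, φ t y = σ s → (t = 0 ∧ s = 0) ∨ (t = T ∧ s = 1) := by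
    intro t ht s hs hts
    rcases eq_or_lt_of_le ht.1 with h0 | h0
    · refine Or.inl ⟨h0.symm, hσinj _ _ ?_⟩
      rw [← hts, ← h0, φ.map_zero_apply]; simp [σ]
    rcases eq_or_lt_of_le ht.2 with h1 | h1
    · refine Or.inr ⟨h1, hσinj _ _ ?_⟩
      rw [← hts, h1, hσ1]
    exact absurd (hts ▸ hσρ s hs) (hfirst t h0 h1 (hts ▸ hσℓ s))
  let γ : ℝ → ℂ := fun t => φ t y
  let γ' : ℝ → ℂ := fun t => X (φ t y)
  have hγ : ∀ t, HasDerivAt γ (γ' t) t := h y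
  have hγ'c : Continuous γ' := hX.comp (h.continuous_orbit y)
  have hγ0 : γ 0 = y := φ.map_zero_apply y
  have hseg : ∀ s : ℝ, γ 0 + s * (γ T - γ 0) = σ s := fun s => by rw [hγ0]
  let W := windingIntegral γ γ' T
  -- `W` is constant on connected sets that avoid the arc and the segment
  have hconst : ∀ S' : Set ℂ, IsPreconnected S' → (∀ a ∈ S', ∀ t ∈ Icc 0 T, a ≠ φ t y) →
      (∀ a ∈ S', ∀ s ∈ Icc (0 : ℝ) 1, a ≠ σ s) → ∀ a ∈ S', ∀ b ∈ S', W a = W b :=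
    fun S' hS' h1 h2 a ha b hb => windingIntegral_eq_of_isPreconnected hTpos.le hγ hγ'c hS' h1
      (fun a ha s hs => by rw [hseg]; exact h2 a ha s hs) ha hb
  have hφ2 : Continuous fun q : ℝ × ℝ => φ q.1 (σ q.2) :=
    φ.continuous continuous_fst (hσc.comp continuous_snd)
  have hφ2' : Continuous fun q : ℝ × ℝ => φ (-q.1) (σ q.2) :=
    φ.continuous continuous_fst.neg (hσc.comp continuous_snd)
  -- the value of `W` just after a crossing past `y` and up to `q`, and just before a crossing on
  -- the near side of `q`, does not depend on the crossing
  have hright : ∀ s ∈ Ioc (0 : ℝ) 1, ∀ t ∈ Ioc 0 ε, W (φ t (σ s)) = W (φ ε q) := by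
    intro s hs t ht
    have hIoc : ∀ s ∈ Ioc (0 : ℝ) 1, s ∈ Icc (-S) S := fun s hs =>
      ⟨by linarith [hs.1], by linarith [hs.2]⟩
    refine hconst ((fun q : ℝ × ℝ => φ q.1 (σ q.2)) '' (Ioc 0 ε ×ˢ Ioc 0 1))
      (((isPreconnected_Ioc).prod isPreconnected_Ioc).image _ hφ2.continuousOn) ?_ ?_ _
      ⟨(t, s), ⟨ht, hs⟩, rfl⟩ _ ⟨(ε, 1), ⟨⟨hε, le_rfl⟩, by norm_num⟩, by simp only [hσ1]⟩
    · rintro _ ⟨⟨t, s⟩, ⟨ht, hs⟩, rfl⟩ t' ht' heq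
      simp only at heq ht hs
      have h1 : φ (t' - t) y = σ s := by
        have := congrArg (φ (-t)) heq
        rw [← φ.map_add, ← φ.map_add, neg_add_cancel, φ.map_zero_apply, neg_add_eq_sub] at this
        exact this.symm
      rcases le_or_gt 0 (t' - t) with h2 | h2
      · rcases harc _ ⟨h2, by linarith [ht'.2, ht.1]⟩ s (hIoc s hs) h1 with h3 | h3
        · linarith [hs.1, h3.2]
        · linarith [h3.1, ht.1, ht'.2]
      · have := (hcross y hyρ hℓy (t - t') ⟨by linarith, by linarith [ht'.1, ht.2]⟩).2
        rw [neg_sub, h1, hσℓ] at this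
        exact lt_irrefl _ this
    · rintro _ ⟨⟨t, s⟩, ⟨ht, hs⟩, rfl⟩ s' _ heq
      have := (hcross (σ s) (hσρ s (hIoc s hs)) (hσℓ s) t ht).1
      simp only at heq
      rw [heq, hσℓ] at this
      exact lt_irrefl _ this
  have hleft : ∀ s ∈ Ico (-S) 1, ∀ t ∈ Ioc 0 ε, W (φ (-t) (σ s)) = W (φ (-ε) y) := by
    intro s hs t ht
    have hIco : ∀ s ∈ Ico (-S) 1, s ∈ Icc (-S) S := fun s hs => ⟨hs.1, by linarith [hs.2]⟩
    refine hconst ((fun q : ℝ × ℝ => φ (-q.1) (σ q.2)) '' (Ioc 0 ε ×ˢ Ico (-S) 1))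
      (((isPreconnected_Ioc).prod isPreconnected_Ico).image _ hφ2'.continuousOn) ?_ ?_ _
      ⟨(t, s), ⟨ht, hs⟩, rfl⟩ _
      ⟨(ε, 0), ⟨⟨hε, le_rfl⟩, ⟨by linarith, by norm_num⟩⟩, by simp [σ]⟩
    · rintro _ ⟨⟨t, s⟩, ⟨ht, hs⟩, rfl⟩ t' ht' heq
      simp only at heq ht hs
      have h1 : φ (t' + t) y = σ s := by
        have := congrArg (φ t) heq
        rw [← φ.map_add, ← φ.map_add, add_neg_cancel, φ.map_zero_apply, add_comm] at this
        exact this.symm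
      rcases le_or_gt (t' + t) T with h2 | h2
      · rcases harc _ ⟨by linarith [ht'.1, ht.1], h2⟩ s (hIco s hs) h1 with h3 | h3
        · linarith [h3.1, ht.1, ht'.1]
        · linarith [hs.2, h3.2]
      · have := (hcross q hTρ hT0 (t' + t - T) ⟨by linarith, by linarith [ht'.2, ht.2]⟩).1
        rw [hq, ← φ.map_add, sub_add_cancel, h1, hσℓ] at this
        exact lt_irrefl _ this
    · rintro _ ⟨⟨t, s⟩, ⟨ht, hs⟩, rfl⟩ s' _ heq
      have := (hcross (σ s) (hσρ s (hIco s hs)) (hσℓ s) t ht).2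
      simp only at heq
      rw [heq, hσℓ] at this
      exact lt_irrefl _ this
  -- the two values differ, as a crossing at the midpoint of the segment shows
  have hjump : W (φ ε q) ≠ W (φ (-ε) y) := by
    have hhalf : (1 / 2 : ℝ) ∈ Icc (-S) S := ⟨by linarith, by linarith⟩
    have hℓdiff : ∀ z, ((z - σ (1 / 2)) * (starRingEnd ℂ) (X y)).re = ℓ z := by
      intro z
      have : ((z - σ (1 / 2)) * (starRingEnd ℂ) (X y)).re = ℓ z - ℓ (σ (1 / 2)) := by
        simp only [hℓ, transverseHeight, ← Complex.sub_re, ← sub_mul]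
        congr 2; ring
      rw [this, hσℓ, sub_zero]
    refine windingIntegral_ne_across hTpos.le (h.continuous_orbit y) hγ'c (m := σ (1 / 2))
      (v := X y)
      (hseg (1 / 2)).symm (by rw [φ.map_zero_apply]; exact hqy)
      (by rw [φ.map_zero_apply]; exact hT0) ?_
      (c := fun t => φ t (σ (1 / 2))) (h.continuous_orbit _) (φ.map_zero_apply _) hε
      (fun t ht => ?_) (fun t ht => ?_) (hright (1 / 2) (by constructor <;> norm_num))
      (hleft (1 / 2) ⟨hhalf.1, by norm_num⟩)
    · rintro ⟨t, ht, htm⟩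
      rcases harc t ht _ hhalf htm with h1 | h1 <;> norm_num at h1
    · rw [hℓdiff]
      exact (hcross _ (hσρ _ hhalf) (hσℓ _) t ht).1
    · rw [hℓdiff]
      exact (hcross _ (hσρ _ hhalf) (hσℓ _) t ht).2
  -- after `q` the orbit never meets the part of the segment on the near side of `q` again
  have hnever : ∀ t, 0 < t → ∀ s ∈ Ico (-S) 1, φ t q ≠ σ s := by
    intro t₀ ht₀ s₀ hs₀ hhit
    -- at the first return time to that part, `W` would have changed along the orbit
    let Z : Set ℝ := {t | ε ≤ t ∧ φ t q ∈ σ '' Icc (-S) 1}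
    have hZc : IsClosed Z := isClosed_Ici.inter
      ((isCompact_Icc.image hσc).isClosed.preimage (h.continuous_orbit q))
    have hsmall : ∀ t, 0 < t → t < ε → ∀ s, φ t q ≠ σ s := by
      intro t ht htε s hts
      have := (hcross q hTρ hT0 t ⟨ht, htε.le⟩).1
      rw [hts, hσℓ] at this
      exact lt_irrefl _ this
    have hZne : Z.Nonempty :=
      ⟨t₀, not_lt.1 fun hlt => hsmall t₀ ht₀ hlt s₀ hhit, ⟨s₀, ⟨hs₀.1, hs₀.2.le⟩, hhit.symm⟩⟩
    have hZb : BddBelow Z := ⟨ε, fun t ht => ht.1⟩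
    obtain ⟨ht1ε, s₁, hs₁, hs₁t⟩ : sInf Z ∈ Z := hZc.csInf_mem hZne hZb
    have hlt : ∀ t, 0 < t → t < sInf Z → ∀ s ∈ Icc (-S) 1, φ t q ≠ σ s := by
      intro t ht htZ s hs hts
      refine absurd (csInf_le hZb ⟨?_, s, hs, hts.symm⟩) (not_le.2 htZ)
      exact not_lt.1 fun hlt => hsmall t ht hlt s hts
    set t₁ := sInf Z
    have hs₁1 : s₁ ≠ 1 := by
      rintro rfl
      rw [hσ1, hq, ← φ.map_add] at hs₁t
      exact hinj T (t₁ + T) (by linarith) hs₁t.symm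
    have hWconst : W (φ (ε / 2) q) = W (φ (t₁ - ε / 2) q) := by
      refine hconst ((fun t => φ t q) '' Ioo 0 t₁)
        (isPreconnected_Ioo.image _ (h.continuous_orbit q).continuousOn) ?_ ?_ _
        ⟨_, ⟨by linarith, by linarith⟩, rfl⟩ _ ⟨_, ⟨by linarith, by linarith⟩, rfl⟩
      · rintro _ ⟨t, ht, rfl⟩ t' ht' heq
        simp only [hq, ← φ.map_add] at heq
        exact hinj t' (t + T) (by linarith [ht'.2, ht.1]) heq
      · rintro _ ⟨t, ht, rfl⟩ s hs heq
        exact hlt t ht.1 ht.2 s ⟨by linarith [hs.1], hs.2⟩ heq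
    have e1 := hright 1 (by norm_num) (ε / 2) ⟨by linarith, by linarith⟩
    have e2 := hleft s₁ ⟨hs₁.1, lt_of_le_of_ne hs₁.2 hs₁1⟩ (ε / 2) ⟨by linarith, by linarith⟩
    rw [hσ1] at e1
    rw [hs₁t, ← φ.map_add, neg_add_eq_sub] at e2
    exact hjump (by rw [← e1, hWconst, e2])
  -- but recurrence brings it back close to `y`
  obtain ⟨t, htT, ht0, htd⟩ := hreturn (‖d‖ / 2) (by positivity) T
  obtain ⟨s, hs⟩ := hlineσ _ ht0
  have hs2 : |s| ≤ 1 / 2 := by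
    rw [hs, mem_closedBall_iff_norm] at htd
    simp only [σ, add_sub_cancel_left, norm_mul, Complex.norm_real, Real.norm_eq_abs] at htd
    have : |s| * ‖d‖ ≤ 1 / 2 * ‖d‖ := by linarith
    exact le_of_mul_le_mul_right this hdn
  refine hnever (t - T) (by linarith) s ⟨by linarith [(abs_le.1 hs2).1],
    by linarith [(abs_le.1 hs2).2]⟩ ?_
  rw [hq, ← φ.map_add, sub_add_cancel, hs]

/-- A compact nonempty invariant set of a flow contains a recurrent point: any point of a minimal
invariant subset. -/
theorem exists_recurrent_mem {α : Type*} [TopologicalSpace α] [T2Space α] (φ : Flow ℝ α)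
    {Ω : Set α} (hΩ : IsCompact Ω) (hne : Ω.Nonempty) (hinv : IsInvariant φ Ω) :
    ∃ y ∈ Ω, MapClusterPt y atTop fun t => φ t y := by
  obtain ⟨K, hKΩ, hK⟩ := zorn_superset_nonempty
    {K : Set α | IsCompact K ∧ K.Nonempty ∧ IsInvariant φ K} (by
      intro c hc hchain hcne
      have : Nonempty c := hcne.to_subtype
      refine ⟨⋂₀ c, ⟨?_, ?_, ?_⟩, fun s hs => sInter_subset_of_mem hs⟩
      · obtain ⟨s, hs⟩ := hcne
        exact (hc hs).1.of_isClosed_subset (isClosed_sInter fun t ht => (hc ht).1.isClosed)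
          (sInter_subset_of_mem hs)
      · exact IsCompact.nonempty_sInter_of_directed_nonempty_isCompact_isClosed
          (fun a ha b hb => (hchain.total ha hb).elim
            (fun h => ⟨a, ha, Subset.rfl, h⟩) fun h => ⟨b, hb, h, Subset.rfl⟩)
              (fun U hU => (hc hU).2.1) (fun U hU => (hc hU).1)
          (fun U hU => (hc hU).1.isClosed)
      · exact fun t x hx s hs => (hc hs).2.2 t (hx s hs)) Ω ⟨hΩ, hne, hinv⟩
  obtain ⟨hKc, ⟨y, hy⟩, hKi⟩ := hK.prop
  refine ⟨y, hKΩ hy, ?_⟩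
  have hsub : closure (image2 φ univ {y}) ⊆ K := by
    refine closure_minimal ?_ hKc.isClosed
    rintro _ ⟨t, -, _, rfl, rfl⟩
    exact hKi t hy
  have hωK : omegaLimit atTop φ {y} ⊆ K :=
    (omegaLimit_subset_closure_image2 atTop φ {y} univ_mem).trans hsub
  have hω : omegaLimit atTop φ {y} ∈ {K : Set α | IsCompact K ∧ K.Nonempty ∧ IsInvariant φ K} :=
    ⟨hKc.of_isClosed_subset (isClosed_omegaLimit _ _ _) hωK,
      nonempty_omegaLimit_of_isCompact_absorbing atTop φ {y} hKc ⟨univ, univ_mem, hsub⟩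
        (singleton_nonempty y),
      φ.isInvariant_omegaLimit atTop {y} fun t => tendsto_atTop_add_const_left _ t tendsto_id⟩
  have := hK.le_of_le hω hωK hy
  exact (mem_omegaLimit_singleton_iff_mapClusterPt _ _ _ _).1 this

/-- **Poincaré–Bendixson**: a compact nonempty invariant set of a planar flow that contains no
equilibrium contains a periodic point. -/
theorem exists_periodic_mem (h : φ.Integrates X) (hX : Continuous X) {Ω : Set ℂ}
    (hΩ : IsCompact Ω) (hne : Ω.Nonempty) (hinv : IsInvariant φ Ω) (h0 : ∀ z ∈ Ω, X z ≠ 0) :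
    ∃ y ∈ Ω, ∃ T > 0, φ T y = y := by
  obtain ⟨y, hy, hrec⟩ := exists_recurrent_mem φ hΩ hne hinv
  exact ⟨y, hy, exists_period_of_recurrent h hX (h0 y hy) hrec⟩

end PoincareBendixson

/-! ### Repelling equilibria -/

/-- A region cut out by finitely many inequalities `g i ≤ b i` such that the field `X` points
strictly outward along each active face. -/
def IsRepellingRegion (X : ℂ → ℂ) (N : Set ℂ) : Prop :=
  ∃ (n : ℕ) (g : Fin n → ℂ → ℝ) (g' : Fin n → ℂ → ℂ →L[ℝ] ℝ) (b : Fin n → ℝ),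
    (∀ i z, HasFDerivAt (g i) (g' i z) z) ∧ N = {z | ∀ i, g i z ≤ b i} ∧
      ∀ z ∈ N, ∀ i, g i z = b i → 0 < g' i z (X z)

namespace IsRepellingRegion

variable {X : ℂ → ℂ} {N : Set ℂ} {φ : Flow ℝ ℂ}

theorem backward_invariant (hN : IsRepellingRegion X N) (h : φ.Integrates X) {z : ℂ} (hz : z ∈ N)
    {t : ℝ} (ht : 0 ≤ t) : φ (-t) z ∈ N := by
  obtain ⟨n, g, g', b, hg, rfl, hout⟩ := hN
  have hgc : ∀ i, Continuous (g i) := fun i =>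
    continuous_iff_continuousAt.2 fun z => (hg i z).continuousAt
  have hoc : Continuous fun t : ℝ => φ (-t) z := (h.continuous_orbit z).comp continuous_neg
  have hd : ∀ i t, HasDerivAt (fun t => g i (φ (-t) z)) (-(g' i (φ (-t) z) (X (φ (-t) z)))) t := by
    intro i t
    refine ((hg i (φ (-t) z)).comp_hasDerivAt t (h.reverse z t)).congr_deriv ?_
    simp
  have hcl : IsClosed {t : ℝ | ∀ i, g i (φ (-t) z) ≤ b i} := by
    simp only [ofPred_forall]
    exact isClosed_iInter fun i => isClosed_le ((hgc i).comp hoc) continuous_const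
  have key := (hcl.inter isClosed_Icc).Icc_subset_of_forall_exists_gt (a := 0) (b := t)
    (by simpa using hz) (by
      rintro x ⟨hx, -⟩ y hy
      have hev : ∀ᶠ s in 𝓝[>] x, ∀ i, g i (φ (-s) z) ≤ b i := by
        refine eventually_all.2 fun i => ?_
        rcases lt_or_eq_of_le (hx i) with hlt | heq
        · have h1 : ∀ᶠ s in 𝓝 x, g i (φ (-s) z) < b i :=
            (((hgc i).comp hoc).tendsto x).eventually (gt_mem_nhds hlt)
          exact (h1.filter_mono nhdsWithin_le_nhds).mono fun s hs => hs.le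
        · have h1 := hasDerivAt_iff_tendsto_slope.1 (hd i x)
          have h2 := h1.eventually (gt_mem_nhds (neg_neg_iff_pos.2 (hout _ hx i heq)))
          have h3 := h2.filter_mono (nhdsWithin_mono x fun s (hs : x < s) => hs.ne')
          filter_upwards [h3, self_mem_nhdsWithin] with s hs hxs
          have hxs' : 0 < s - x := sub_pos.2 hxs
          rw [slope_def_field, div_neg_iff] at hs
          rcases hs with hs | hs
          · linarith [hs.2]
          · rw [← heq]; linarith [hs.1]
      obtain ⟨s, hs1, hs2⟩ := (hev.and (eventually_mem_set.2 (Ioc_mem_nhdsGT hy))).exists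
      exact ⟨s, hs1, hs2⟩)
  exact key ⟨ht, le_rfl⟩

theorem rotate {u : ℂ} (hu : u ≠ 0) (hN : IsRepellingRegion (fun z => u⁻¹ * X (u * z)) N) :
    IsRepellingRegion X ((u * ·) '' N) := by
  obtain ⟨n, g, g', b, hg, rfl, hout⟩ := hN
  let m : ℂ →L[ℝ] ℂ := ContinuousLinearMap.mul ℝ ℂ u⁻¹
  refine ⟨n, fun i z => g i (u⁻¹ * z), fun i z => (g' i (u⁻¹ * z)).comp m, b, fun i z => ?_, ?_, ?_⟩
  · exact (hg i (u⁻¹ * z)).comp z m.hasFDerivAt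
  · ext z
    constructor
    · rintro ⟨w, hw, rfl⟩ i
      simpa [hu] using hw i
    · intro hz
      exact ⟨u⁻¹ * z, hz, by simp [hu]⟩
  · rintro _ ⟨w, hw, rfl⟩ i hi
    have hw' : u⁻¹ * (u * w) = w := by field_simp
    simp only [hw'] at hi ⊢
    exact hout w hw i hi

end IsRepellingRegion

/-- `X z = z * exp (M z)` makes the angle from `z` to `X z` well defined along a connected set on
which both `u * z` and `u * X z` have a continuous principal logarithm. -/
theorem log_sub_log_add_eq {X M : ℂ → ℂ} {S : Set ℂ} (hS : IsPreconnected S) {u : ℂ}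
    (hXc : ContinuousOn X S) (hMc : ContinuousOn M S)
    (hM : ∀ z ∈ S, X z = z * Complex.exp (M z)) (h1 : ∀ z ∈ S, u * z ∈ Complex.slitPlane)
    (h2 : ∀ z ∈ S, u * X z ∈ Complex.slitPlane) {p q : ℂ} (hp : p ∈ S) (hq : q ∈ S) :
    Complex.log (u * p) - Complex.log (u * X p) + M p =
      Complex.log (u * q) - Complex.log (u * X q) + M q := by
  refine hS.eq_of_exp_eq_one (f := fun z => Complex.log (u * z) - Complex.log (u * X z) + M z)
    ?_ ?_ hp hq
  · exact (((continuousOn_const.mul continuousOn_id).clog h1).sub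
      ((continuousOn_const.mul hXc).clog h2)).add hMc
  · intro z hz
    have e1 := Complex.slitPlane_ne_zero (h1 z hz)
    have e2 := Complex.slitPlane_ne_zero (h2 z hz)
    rw [Complex.exp_add, Complex.exp_sub, Complex.exp_log e1, Complex.exp_log e2]
    rw [div_mul_eq_mul_div, div_eq_one_iff_eq e2, hM z hz]
    ring

/-- The angle information of `log_sub_log_add_eq` on both sides of a closed curve around `0`
determines the vertical direction of `X` at the two points where `X` is vertical. -/
theorem im_pos_and_im_neg_of_log {X M : ℂ → ℂ} {p q : ℂ} (hp : 0 < p.im) (hq : q.im < 0)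
    (hXp : (X p).im ≠ 0) (hXq : (X q).im ≠ 0)
    (h1 : Complex.log p - Complex.log (X p) + M p = Complex.log q - Complex.log (X q) + M q)
    (h2 : Complex.log (-p) - Complex.log (-X p) + M p =
      Complex.log (-q) - Complex.log (-X q) + M q) : 0 < (X p).im ∧ (X q).im < 0 := by
  have e1 := congrArg Complex.im h1
  have e2 := congrArg Complex.im h2
  simp only [Complex.add_im, Complex.sub_im, Complex.log_im] at e1 e2
  have a1 := Complex.arg_neg_eq_arg_sub_pi_of_im_pos hp
  have a2 := Complex.arg_neg_eq_arg_add_pi_of_im_neg hq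
  have hpi := Real.pi_pos
  rcases lt_or_gt_of_ne hXp with b1 | b1 <;> rcases lt_or_gt_of_ne hXq with b2 | b2
  · have a3 := Complex.arg_neg_eq_arg_add_pi_of_im_neg b1
    have a4 := Complex.arg_neg_eq_arg_add_pi_of_im_neg b2
    exfalso; linarith
  · have a3 := Complex.arg_neg_eq_arg_add_pi_of_im_neg b1
    have a4 := Complex.arg_neg_eq_arg_sub_pi_of_im_pos b2
    exfalso; linarith
  · exact ⟨b1, b2⟩
  · have a3 := Complex.arg_neg_eq_arg_sub_pi_of_im_pos b1
    have a4 := Complex.arg_neg_eq_arg_sub_pi_of_im_pos b2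
    exfalso; linarith

section LocalRepelling

variable {X : ℂ → ℂ} {A : ℂ →L[ℝ] ℂ}

theorem clm_complex_apply (A : ℂ →L[ℝ] ℂ) (z : ℂ) : A z = z.re * A 1 + z.im * A Complex.I := by
  conv_lhs => rw [show z = z.re • (1 : ℂ) + z.im • Complex.I by
    simp only [Complex.real_smul, mul_one]; exact (Complex.re_add_im z).symm]
  rw [map_add, map_smul, map_smul, Complex.real_smul, Complex.real_smul]

/-- An equilibrium whose linearization has positive trace and determinant has arbitrarily small
repelling neighbourhoods: sublevel sets of the quadratic form `det A * |z|² + |adj A z|²`. -/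
theorem exists_isRepellingRegion_of_det_pos (h0 : X 0 = 0) (hA : HasStrictFDerivAt X A 0)
    (htr : 0 < (A 1).re + (A Complex.I).im)
    (hdet : 0 < (A 1).re * (A Complex.I).im - (A Complex.I).re * (A 1).im) {ρ : ℝ} (hρ : 0 < ρ) :
    ∃ N ∈ 𝓝 (0 : ℂ), N ⊆ Metric.ball 0 ρ ∧ IsRepellingRegion X N := by
  set a := (A 1).re with ha
  set c := (A 1).im with hc
  set b := (A Complex.I).re with hb
  set d := (A Complex.I).im with hd
  set D := a * d - b * c with hD
  -- `C` bounds the derivative of the form `V`, and the radius is chosen so that the nonlinear part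
  -- of `X` takes away at most half of the growth of `V` along the linear part
  set C := 2 * (D + (|d| + |b|) ^ 2 + (|c| + |a|) ^ 2) with hC
  have hCpos : 0 < C := by positivity
  set ε := (a + d) * D / C with hε
  have hεpos : 0 < ε := by positivity
  have hev : ∀ᶠ z in 𝓝 (0 : ℂ), ‖X z - A z‖ ≤ ε * ‖z‖ := by
    have := hA.hasFDerivAt.isLittleO.def hεpos
    simpa [h0] using this
  obtain ⟨r, hr, hball⟩ := Metric.eventually_nhds_iff_ball.1 hev
  -- `V` is a Lyapunov function: its derivative along `A` is `2 * tr A * det A * ‖z‖ ^ 2`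
  let V : ℂ → ℝ := fun z => D * (z.re ^ 2 + z.im ^ 2) + (d * z.re - b * z.im) ^ 2 +
    (a * z.im - c * z.re) ^ 2
  let l₁ : ℂ →L[ℝ] ℝ := d • Complex.reCLM - b • Complex.imCLM
  let l₂ : ℂ →L[ℝ] ℝ := a • Complex.imCLM - c • Complex.reCLM
  let V' : ℂ → ℂ →L[ℝ] ℝ := fun z => D • ((2 * z.re) • Complex.reCLM + (2 * z.im) • Complex.imCLM) +
    (2 * l₁ z) • l₁ + (2 * l₂ z) • l₂
  have hsq : ∀ (l : ℂ →L[ℝ] ℝ) z, HasFDerivAt (fun z => l z ^ 2) ((2 * l z) • l) z := by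
    intro l z
    have := (l.hasFDerivAt (x := z)).pow 2
    simpa [smul_smul] using this
  have hV : ∀ z, HasFDerivAt V (V' z) z := by
    intro z
    exact ((((hsq Complex.reCLM z).add (hsq Complex.imCLM z)).const_mul D).add (hsq l₁ z)).add
      (hsq l₂ z)
  have hVlow : ∀ z, D * ‖z‖ ^ 2 ≤ V z := by
    intro z
    rw [← Complex.normSq_eq_norm_sq, Complex.normSq_apply]
    simp only [V]
    nlinarith [sq_nonneg (d * z.re - b * z.im), sq_nonneg (a * z.im - c * z.re)]
  set R := min ρ r with hR
  have hRpos : 0 < R := lt_min hρ hr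
  refine ⟨{z | V z ≤ D * (R / 2) ^ 2}, ?_, ?_, 1, fun _ => V, fun _ => V', fun _ => D * (R / 2) ^ 2,
    fun _ => hV, by simp, ?_⟩
  · have hVc : Continuous V := continuous_iff_continuousAt.2 fun z => (hV z).continuousAt
    have : V 0 < D * (R / 2) ^ 2 := by
      have : V 0 = 0 := by simp [V]
      rw [this]; positivity
    exact (hVc.continuousAt.eventually (gt_mem_nhds this)).mono fun z hz => hz.le
  all_goals
    have hin : ∀ z, V z ≤ D * (R / 2) ^ 2 → ‖z‖ < R := by
      intro z hz
      have h1 := (hVlow z).trans hz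
      have h2 : ‖z‖ ^ 2 ≤ (R / 2) ^ 2 := le_of_mul_le_mul_left h1 hdet
      have h3 := abs_le_of_sq_le_sq h2 (by positivity)
      rw [abs_of_nonneg (norm_nonneg z)] at h3
      linarith
  · intro z hz
    rw [mem_ball_zero_iff]
    exact (hin z hz).trans_le (min_le_left _ _)
  · intro z hz _ hzV
    have hz0 : z ≠ 0 := by
      rintro rfl
      have h1 : V 0 = 0 := by simp [V]
      have h2 : 0 < D * (R / 2) ^ 2 := by positivity
      linarith [hzV.symm.trans h1]
    have hzr : ‖X z - A z‖ ≤ ε * ‖z‖ :=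
      hball z (mem_ball_zero_iff.2 ((hin z hz).trans_le (min_le_right _ _)))
    have hnz : 0 < ‖z‖ := norm_pos_iff.2 hz0
    have hlin : V' z (A z) = 2 * ((a + d) * D) * ‖z‖ ^ 2 := by
      rw [← Complex.normSq_eq_norm_sq, Complex.normSq_apply, clm_complex_apply A z]
      simp [V', l₁, l₂, ← ha, ← hb, ← hc, ← hd]
      rw [hD]; ring
    have hbound : ∀ w, |V' z w| ≤ C * ‖z‖ * ‖w‖ := by
      intro w
      have q1 := Complex.abs_re_le_norm z
      have q2 := Complex.abs_im_le_norm z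
      have q3 := Complex.abs_re_le_norm w
      have q4 := Complex.abs_im_le_norm w
      have hl : ∀ (s t : ℝ) (v : ℂ), |s * v.re - t * v.im| ≤ (|s| + |t|) * ‖v‖ := by
        intro s t v
        calc |s * v.re - t * v.im| ≤ |s * v.re| + |t * v.im| := abs_sub _ _
          _ = |s| * |v.re| + |t| * |v.im| := by rw [abs_mul, abs_mul]
          _ ≤ |s| * ‖v‖ + |t| * ‖v‖ := by
            gcongr
            · exact Complex.abs_re_le_norm v
            · exact Complex.abs_im_le_norm v
          _ = _ := by ring
      have hl1 : ∀ v, |l₁ v| ≤ (|d| + |b|) * ‖v‖ := fun v => by simpa [l₁] using hl d b v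
      have hl2 : ∀ v, |l₂ v| ≤ (|c| + |a|) * ‖v‖ := fun v => by
        have := hl c a v
        rw [abs_sub_comm] at this
        simpa [l₂] using this
      have hin : |z.re * w.re + z.im * w.im| ≤ ‖z‖ * ‖w‖ := by
        have : z.re * w.re + z.im * w.im = (z * (starRingEnd ℂ) w).re := by simp
        rw [this]
        refine (Complex.abs_re_le_norm _).trans ?_
        rw [norm_mul, RCLike.norm_conj]
      have e : V' z w = 2 * (D * (z.re * w.re + z.im * w.im) + l₁ z * l₁ w + l₂ z * l₂ w) := by
        simp [V']; ring
      rw [e, abs_mul, abs_two]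
      calc 2 * |D * (z.re * w.re + z.im * w.im) + l₁ z * l₁ w + l₂ z * l₂ w|
          ≤ 2 * (|D * (z.re * w.re + z.im * w.im)| + |l₁ z * l₁ w| + |l₂ z * l₂ w|) := by
            gcongr; exact abs_add_three _ _ _
        _ = 2 * (D * |z.re * w.re + z.im * w.im| + |l₁ z| * |l₁ w| + |l₂ z| * |l₂ w|) := by
            rw [abs_mul, abs_mul, abs_mul, abs_of_pos hdet]
        _ ≤ 2 * (D * (‖z‖ * ‖w‖) + ((|d| + |b|) * ‖z‖) * ((|d| + |b|) * ‖w‖) +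
            ((|c| + |a|) * ‖z‖) * ((|c| + |a|) * ‖w‖)) := by
            gcongr
            · exact hl1 z
            · exact hl1 w
            · exact hl2 z
            · exact hl2 w
        _ = C * ‖z‖ * ‖w‖ := by rw [hC]; ring
    have hsplit : V' z (X z) = V' z (A z) + V' z (X z - A z) := by rw [← map_add]; congr 1; ring
    have h1 := (abs_le.1 (hbound (X z - A z))).1
    have h2 : C * ‖z‖ * ‖X z - A z‖ ≤ C * ‖z‖ * (ε * ‖z‖) := by gcongr
    have h3 : C * ‖z‖ * (ε * ‖z‖) = (a + d) * D * ‖z‖ ^ 2 := by rw [hε]; field_simp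
    have h4 : 0 < (a + d) * D * ‖z‖ ^ 2 := by positivity
    rw [hsplit, hlin]
    linarith

set_option maxHeartbeats 1000000 in
/-- An equilibrium whose linearization preserves the vertical axis, with eigenvalue below the
horizontal one, has arbitrarily small repelling neighbourhoods if `X z / z` has a continuous
logarithm around it. The region is a diamond with its top and bottom corners on the curve where
`X` is vertical; the logarithm forces `X` to point outward there. -/
theorem exists_isRepellingRegion_of_vertical (h0 : X 0 = 0) (hX : Continuous X)
    (hA : HasStrictFDerivAt X A 0) {μ : ℝ} (hI : A Complex.I = μ * Complex.I)
    (hl : 0 < (A 1).re) (hμ : μ < (A 1).re) {r : ℝ} (hr : 0 < r) {M : ℂ → ℂ}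
    (hMc : ContinuousOn M (Metric.ball 0 r \ {0}))
    (hM : ∀ z ∈ Metric.ball 0 r \ {0}, X z = z * Complex.exp (M z)) {ρ : ℝ} (hρ : 0 < ρ) :
    ∃ N ∈ 𝓝 (0 : ℂ), N ⊆ Metric.ball 0 ρ ∧ IsRepellingRegion X N := by
  set l := (A 1).re with hl_def
  set k := (A 1).im with hk_def
  -- `κ` is the slope of the faces: steep enough for the difference `l - μ` of the eigenvalues to
  -- dominate the shear `k`
  obtain ⟨κ, hκ1, hκ⟩ : ∃ κ : ℝ, 1 ≤ κ ∧ |k| + 1 ≤ κ * (l - μ) := by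
    have h1 : 0 < l - μ := by linarith
    refine ⟨(|k| + 1) / (l - μ) + 1, ?_, ?_⟩
    · have : 0 ≤ (|k| + 1) / (l - μ) := by positivity
      linarith
    · rw [add_mul, div_mul_cancel₀ _ h1.ne']; linarith
  have hκ0 : 0 < κ := by linarith
  -- `ε` is the error of linearization that the estimates at the corners and on the faces tolerate
  obtain ⟨ε, hε, hεl, hεκ⟩ : ∃ ε > 0, ε * (2 * κ) ≤ l / 4 ∧ ε * (1 + κ) * (1 + κ) ≤ 1 / 2 := by
    refine ⟨min (l / (8 * κ)) (1 / (8 * κ ^ 2)), by positivity, ?_, ?_⟩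
    · calc _ ≤ l / (8 * κ) * (2 * κ) := by gcongr; exact min_le_left _ _
        _ = l / 4 := by field_simp; norm_num
    · calc _ ≤ 1 / (8 * κ ^ 2) * (κ + κ) * (κ + κ) := by gcongr; exact min_le_right _ _
        _ = 1 / 2 := by field_simp; norm_num
  have hεκ' : ε * (1 + κ) ≤ l / 4 := by nlinarith
  obtain ⟨r₁, hr₁, hball⟩ := Metric.eventually_nhds_iff_ball.1 (hA.isLittleO.def hε)
  set R := min ρ (min r r₁) with hR
  have hRpos : 0 < R := lt_min hρ (lt_min hr hr₁)
  have hRr : R ≤ r := (min_le_right _ _).trans (min_le_left _ _)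
  have hRr₁ : R ≤ r₁ := (min_le_right _ _).trans (min_le_right _ _)
  -- strict differentiability bounds differences of values of `X`, not only values
  have hest : ∀ z w : ℂ, ‖z‖ < R → ‖w‖ < R →
      |(X z).re - (X w).re - l * (z.re - w.re)| ≤ ε * (|z.re - w.re| + |z.im - w.im|) ∧
      |(X z).im - (X w).im - (k * (z.re - w.re) + μ * (z.im - w.im))| ≤
        ε * (|z.re - w.re| + |z.im - w.im|) := by
    intro z w hz hw
    have h1 := hball (z, w) (by
      rw [Metric.mem_ball, Prod.dist_eq, max_lt_iff]
      exact ⟨by simpa using hz.trans_le hRr₁, by simpa using hw.trans_le hRr₁⟩)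
    simp only at h1
    have h2 : ‖z - w‖ ≤ |z.re - w.re| + |z.im - w.im| := by
      simpa using Complex.norm_le_abs_re_add_abs_im (z - w)
    have h3 := h1.trans (mul_le_mul_of_nonneg_left h2 hε.le)
    have h4 := (Complex.abs_re_le_norm _).trans h3
    have h5 := (Complex.abs_im_le_norm _).trans h3
    rw [clm_complex_apply A, hI] at h4 h5
    refine ⟨le_of_eq_of_le ?_ h4, le_of_eq_of_le ?_ h5⟩
    · congr 1
      simp [← hl_def, ← hk_def]; ring
    · congr 1
      simp [← hl_def, ← hk_def]; ring
  -- the diamond has height `b`; its corners are within the distance `η` of the vertical axis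
  set b := R / 8 with hb
  have hb0 : 0 < b := by positivity
  set η := b / (2 * κ) with hη
  have hη0 : 0 < η := by positivity
  have hηκ : κ * η = b / 2 := by rw [hη]; field_simp
  have hηb : η ≤ b / 2 := by nlinarith
  have hnorm : ∀ z : ℂ, |z.re| + |z.im| < 8 * b → ‖z‖ < R := fun z hz =>
    (Complex.norm_le_abs_re_add_abs_im z).trans_lt (by linarith)
  -- corners: points at height `±b` where `X` is vertical
  have hcorner : ∀ y : ℝ, |y| = b → ∃ p : ℂ, |p.re| ≤ η ∧ p.im = y ∧ (X p).re = 0 := by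
    intro y hy
    have hpt : ∀ x : ℝ, |x| = η → |(X ⟨x, y⟩).re - l * x| ≤ l * η / 2 := by
      intro x hx
      have := (hest ⟨x, y⟩ 0 (hnorm _ (by simp only [hx, hy]; linarith)) (by simpa using hRpos)).1
      simp only [h0, Complex.zero_re, Complex.zero_im, sub_zero, hx, hy] at this
      refine this.trans ?_
      have h1 : b = 2 * κ * η := by linarith
      rw [h1]
      nlinarith
    have hc : Continuous fun x : ℝ => (X ⟨x, y⟩).re := by
      have : Continuous fun x : ℝ => (⟨x, y⟩ : ℂ) := by
        have : (fun x : ℝ => (⟨x, y⟩ : ℂ)) = fun x : ℝ => (x : ℂ) + y * Complex.I := by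
          funext x; exact Complex.mk_eq_add_mul_I x y
        rw [this]; fun_prop
      exact Complex.continuous_re.comp (hX.comp this)
    have h1 := (abs_le.1 (hpt η (abs_of_pos hη0))).1
    have h2 := (abs_le.1 (hpt (-η) (by rw [abs_neg, abs_of_pos hη0]))).2
    have h3 : 0 < l * η := by positivity
    obtain ⟨x, hx, hx0⟩ := intermediate_value_Icc (show -η ≤ η by linarith) hc.continuousOn
      (show (0 : ℝ) ∈ _ from ⟨by linarith, by linarith⟩)
    exact ⟨⟨x, y⟩, abs_le.2 hx, rfl, hx0⟩
  obtain ⟨p, hp, hpb, hpX⟩ := hcorner b (abs_of_pos hb0)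
  obtain ⟨q, hq, hqb, hqX⟩ := hcorner (-b) (by rw [abs_neg, abs_of_pos hb0])
  have hMR : ∀ z : ℂ, ‖z‖ < R → z ≠ 0 → z ∈ Metric.ball 0 r \ {0} := fun z h1 h2 =>
    ⟨mem_ball_zero_iff.2 (h1.trans_le hRr), h2⟩
  -- `X` does not vanish at a corner, because of its logarithm
  have hcim : ∀ p : ℂ, |p.re| ≤ η → |p.im| = b → (X p).re = 0 → (X p).im ≠ 0 := by
    intro p h1 h2 h3 h4
    have hp0 : p ≠ 0 := by
      rintro rfl
      simp at h2
      linarith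
    have hXp : X p = 0 := Complex.ext h3 h4
    rw [hM p (hMR p (hnorm p (by linarith)) hp0)] at hXp
    exact mul_ne_zero hp0 (Complex.exp_ne_zero _) hXp
  -- near a corner, `X` is controlled by its linear part
  have hcone : ∀ p z : ℂ, ‖p‖ < R → ‖z‖ < R → (X p).re = 0 → |z.im - p.im| ≤ κ * |z.re - p.re| →
      |(X z).re - l * (z.re - p.re)| ≤ ε * (1 + κ) * |z.re - p.re| ∧
      |(X z).im - (X p).im - (k * (z.re - p.re) + μ * (z.im - p.im))| ≤
        ε * (1 + κ) * |z.re - p.re| := by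
    intro p z hp hz hp0 hzp
    have := hest z p hz hp
    rw [hp0, sub_zero] at this
    have h1 : ε * (|z.re - p.re| + |z.im - p.im|) ≤ ε * (1 + κ) * |z.re - p.re| := by
      rw [mul_assoc, one_add_mul]
      gcongr
    exact ⟨this.1.trans h1, this.2.trans h1⟩
  -- on the path from the top corner to the bottom corner through the point `u * 4η` of the
  -- horizontal axis, both `u * z` and `u * X z` admit the principal logarithm
  have hseg : ∀ u : ℝ, (u = 1 ∨ u = -1) → ∀ p : ℂ, |p.re| ≤ η → |p.im| = b → (X p).re = 0 →
      ∀ z ∈ segment ℝ p ((u * (4 * η) : ℝ) : ℂ), ‖z‖ < R ∧ z ≠ 0 ∧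
        (u : ℂ) * z ∈ Complex.slitPlane ∧ (u : ℂ) * X z ∈ Complex.slitPlane := by
    intro u hu p hp1 hp2 hp3 z hz
    rw [segment_eq_image] at hz
    obtain ⟨t, ht, rfl⟩ := hz
    set z : ℂ := (1 - t) • p + t • ((u * (4 * η) : ℝ) : ℂ) with hz
    change ‖z‖ < R ∧ z ≠ 0 ∧ (u : ℂ) * z ∈ Complex.slitPlane ∧ (u : ℂ) * X z ∈ Complex.slitPlane
    have hzre : z.re = (1 - t) * p.re + t * (u * (4 * η)) := by simp [hz]
    have hzim : z.im = (1 - t) * p.im := by simp [hz]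
    have hu1 : u * u = 1 := by rcases hu with rfl | rfl <;> norm_num
    have hua : |u| = 1 := by rcases hu with rfl | rfl <;> norm_num
    have hpim : p.im ≠ 0 := by
      intro h; rw [h, abs_zero] at hp2; linarith
    have hub : u * p.re ≤ η := by
      refine (le_abs_self _).trans ?_
      rw [abs_mul, hua, one_mul]; exact hp1
    have hus : u * (z.re - p.re) = t * (4 * η - u * p.re) := by
      rw [hzre]; linear_combination t * (4 * η) * hu1
    have hus0 : 0 ≤ u * (z.re - p.re) := by
      rw [hus]; exact mul_nonneg ht.1 (by linarith)
    have habs : |z.re - p.re| = u * (z.re - p.re) := by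
      rw [← abs_of_nonneg hus0, abs_mul, hua, one_mul]
    have hzn : ‖z‖ < R := by
      refine hnorm z ?_
      have h1 : |z.re| ≤ (1 - t) * η + t * (4 * η) := by
        rw [hzre]
        refine (abs_add_le _ _).trans ?_
        rw [abs_mul, abs_mul, abs_mul, hua, one_mul, abs_of_nonneg ht.1,
          abs_of_nonneg (sub_nonneg.2 ht.2), abs_of_pos (by positivity : 0 < 4 * η)]
        gcongr
        linarith [ht.2]
      have h2 : |z.im| ≤ b := by
        rw [hzim, abs_mul, hp2, abs_of_nonneg (sub_nonneg.2 ht.2)]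
        have : 0 ≤ t * b := mul_nonneg ht.1 hb0.le
        linarith
      have h3 : t * η ≤ η := mul_le_of_le_one_left hη0.le ht.2
      linarith
    have hslit : (u : ℂ) * z ∈ Complex.slitPlane := by
      rw [Complex.mem_slitPlane_iff, Complex.re_ofReal_mul, Complex.im_ofReal_mul]
      rcases eq_or_lt_of_le ht.2 with h | h
      · left
        have : u * z.re = u * u * (4 * η) := by rw [hzre, h]; ring
        rw [this, hu1]; linarith
      · right
        rw [hzim]
        refine mul_ne_zero (by rcases hu with rfl | rfl <;> norm_num)
          (mul_ne_zero (by linarith) hpim)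
    refine ⟨hzn, ?_, hslit, ?_⟩
    · intro h
      rw [h, mul_zero] at hslit
      exact Complex.slitPlane_ne_zero hslit rfl
    · rw [Complex.mem_slitPlane_iff, Complex.re_ofReal_mul, Complex.im_ofReal_mul]
      rcases eq_or_lt_of_le ht.1 with h | h
      · right
        have : z = p := by simp [hz, ← h]
        rw [this]
        exact mul_ne_zero (by rcases hu with rfl | rfl <;> norm_num) (hcim p hp1 hp2 hp3)
      · left
        have hpn : ‖p‖ < R := hnorm p (by linarith)
        have h1 : |z.im - p.im| ≤ κ * |z.re - p.re| := by
          rw [habs, hus, hzim, show (1 - t) * p.im - p.im = -(t * p.im) by ring, abs_neg, abs_mul,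
            abs_of_pos h, hp2, mul_left_comm]
          refine mul_le_mul_of_nonneg_left ?_ h.le
          have : κ * (3 * η) ≤ κ * (4 * η - u * p.re) := by gcongr; linarith
          linarith
        have h2 := (hcone p z hpn hzn hp3 h1).1
        have hpos : 0 < u * (z.re - p.re) := by
          rw [hus]; exact mul_pos h (by linarith)
        have h3 : |u * ((X z).re - l * (z.re - p.re))| ≤ l / 4 * (u * (z.re - p.re)) := by
          rw [abs_mul, hua, one_mul]
          refine h2.trans ?_
          rw [habs]
          exact mul_le_mul_of_nonneg_right hεκ' hus0
        have h4 := (abs_le.1 h3).1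
        have h5 : 0 < l * (u * (z.re - p.re)) := by positivity
        have h6 : u * ((X z).re - l * (z.re - p.re)) = u * (X z).re - l * (u * (z.re - p.re)) := by
          ring
        rw [h6] at h4
        linarith
  have hpabs : |p.im| = b := by rw [hpb, abs_of_pos hb0]
  have hqabs : |q.im| = b := by rw [hqb, abs_neg, abs_of_pos hb0]
  have hlog : ∀ u : ℝ, (u = 1 ∨ u = -1) →
      Complex.log (u * p) - Complex.log (u * X p) + M p =
        Complex.log (u * q) - Complex.log (u * X q) + M q := by
    intro u hu
    set Q : ℂ := ((u * (4 * η) : ℝ) : ℂ)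
    have hall : ∀ z ∈ segment ℝ p Q ∪ segment ℝ q Q, ‖z‖ < R ∧ z ≠ 0 ∧
        (u : ℂ) * z ∈ Complex.slitPlane ∧ (u : ℂ) * X z ∈ Complex.slitPlane := by
      rintro z (hz | hz)
      · exact hseg u hu p hp hpabs hpX z hz
      · exact hseg u hu q hq hqabs hqX z hz
    refine log_sub_log_add_eq (S := segment ℝ p Q ∪ segment ℝ q Q)
      (IsPreconnected.union Q (right_mem_segment ℝ p Q) (right_mem_segment ℝ q Q)
        (convex_segment p Q).isPreconnected (convex_segment q Q).isPreconnected)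
      hX.continuousOn (hMc.mono fun z hz => ?_) (fun z hz => ?_) (fun z hz => (hall z hz).2.2.1)
      (fun z hz => (hall z hz).2.2.2) (Or.inl (left_mem_segment ℝ p Q))
      (Or.inr (left_mem_segment ℝ q Q))
    · exact hMR z (hall z hz).1 (hall z hz).2.1
    · exact hM z (hMR z (hall z hz).1 (hall z hz).2.1)
  obtain ⟨hXp, hXq⟩ := im_pos_and_im_neg_of_log (X := X) (M := M) (p := p) (q := q) (by linarith)
    (by linarith) (hcim p hp hpabs hpX) (hcim q hq hqabs hqX)
    (by simpa using hlog 1 (Or.inl rfl)) (by simpa using hlog (-1) (Or.inr rfl))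
  -- `X` points outward along the faces of the diamond
  have hface : ∀ σ τ : ℝ, σ * σ = 1 → τ * τ = 1 → ∀ p z : ℂ, ‖p‖ < R → ‖z‖ < R → (X p).re = 0 →
      p.im = σ * b → 0 < σ * (X p).im → σ * z.im + τ * κ * (z.re - p.re) = b →
      σ * z.im - τ * κ * (z.re - p.re) ≤ b → 0 < σ * (X z).im + τ * κ * (X z).re := by
    intro σ τ hσ hτ p z hp hz hpX hpb hpos h1 h2
    have hσa : |σ| = 1 := by
      rcases mul_self_eq_one_iff.1 hσ with rfl | rfl <;> norm_num
    have hτa : |τ| = 1 := by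
      rcases mul_self_eq_one_iff.1 hτ with rfl | rfl <;> norm_num
    set s := z.re - p.re with hs
    have hh : z.im - p.im = -(σ * τ * κ * s) := by
      rw [hpb]; linear_combination σ * h1 - z.im * hσ
    have hτs : 0 ≤ τ * s := by
      have : 0 ≤ κ * (τ * s) := by linarith
      exact nonneg_of_mul_nonneg_right this hκ0
    have habs : |s| = τ * s := by rw [← abs_of_nonneg hτs, abs_mul, hτa, one_mul]
    obtain ⟨e1, e2⟩ := hcone p z hp hz hpX (by
      rw [hh, abs_neg, abs_mul, abs_mul, abs_mul, hσa, hτa, one_mul, one_mul, abs_of_pos hκ0])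
    rw [← hs, hh] at e2
    rw [← hs] at e1
    have f1 : |τ * κ * ((X z).re - l * s)| ≤ κ * (ε * (1 + κ) * |s|) := by
      rw [abs_mul, abs_mul, hτa, one_mul, abs_of_pos hκ0]
      gcongr
    have f2 : |σ * ((X z).im - (X p).im - (k * s + μ * -(σ * τ * κ * s)))| ≤ ε * (1 + κ) * |s| := by
      rw [abs_mul, hσa, one_mul]; exact e2
    have f3 : |σ * k * s| ≤ |k| * |s| := by rw [abs_mul, abs_mul, hσa, one_mul]
    have g1 := (abs_le.1 f1).1
    have g2 := (abs_le.1 f2).1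
    have g3 := (abs_le.1 f3).1
    have key : σ * (X z).im + τ * κ * (X z).re = σ * (X p).im +
        τ * κ * ((X z).re - l * s) +
        σ * ((X z).im - (X p).im - (k * s + μ * -(σ * τ * κ * s))) + σ * k * s +
        κ * (l - μ) * |s| := by
      rw [habs]; linear_combination -(μ * τ * κ * s) * hσ
    have g4 : (|k| + 1) * |s| ≤ κ * (l - μ) * |s| := by gcongr
    have g5 : ε * (1 + κ) * (1 + κ) * |s| ≤ 1 / 2 * |s| := by gcongr
    have g6 : κ * (ε * (1 + κ) * |s|) + ε * (1 + κ) * |s| = ε * (1 + κ) * (1 + κ) * |s| := by ring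
    have g7 := abs_nonneg s
    rw [key]
    linarith
  have hpn : ‖p‖ < R := hnorm p (by linarith)
  have hqn : ‖q‖ < R := hnorm q (by linarith)
  -- the four faces: `σ` is the sign of the height of the corner `P` on the face, `τ` its side
  let σ : Fin 4 → ℝ := ![1, 1, -1, -1]
  let τ : Fin 4 → ℝ := ![1, -1, 1, -1]
  let P : Fin 4 → ℂ := ![p, p, q, q]
  have hN : ∀ z : ℂ, (∀ i, σ i * z.im + τ i * κ * (z.re - (P i).re) ≤ b) ↔
      (z.im + κ * (z.re - p.re) ≤ b ∧ z.im - κ * (z.re - p.re) ≤ b ∧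
        -z.im + κ * (z.re - q.re) ≤ b ∧ -z.im - κ * (z.re - q.re) ≤ b) := by
    intro z
    simp [Fin.forall_fin_succ, σ, τ, P, sub_eq_add_neg]
  have hNn : ∀ z : ℂ, (∀ i, σ i * z.im + τ i * κ * (z.re - (P i).re) ≤ b) → ‖z‖ < R := by
    intro z hz
    obtain ⟨h1, h2, h3, h4⟩ := (hN z).1 hz
    refine hnorm z ?_
    have i1 : |z.im| ≤ b := abs_le.2 ⟨by linarith, by linarith⟩
    have i2 : κ * |z.re - p.re| ≤ 2 * b := by
      rw [show κ * |z.re - p.re| = |κ * (z.re - p.re)| by rw [abs_mul, abs_of_pos hκ0]]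
      exact abs_le.2 ⟨by linarith, by linarith⟩
    have i3 : |z.re - p.re| ≤ 2 * b := by nlinarith [abs_nonneg (z.re - p.re)]
    have i4 : |z.re| ≤ |z.re - p.re| + |p.re| := by
      simpa using abs_add_le (z.re - p.re) p.re
    linarith
  refine ⟨{z | ∀ i, σ i * z.im + τ i * κ * (z.re - (P i).re) ≤ b}, ?_, ?_, 4,
    fun i z => σ i * z.im + τ i * κ * (z.re - (P i).re),
    fun i _ => σ i • Complex.imCLM + (τ i * κ) • Complex.reCLM, fun _ => b, fun i z => ?_, rfl, ?_⟩
  · have hev : ∀ᶠ z : ℂ in 𝓝 0, ∀ i, σ i * z.im + τ i * κ * (z.re - (P i).re) ≤ b := by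
      refine eventually_all.2 fun i => ?_
      have hc : Continuous fun z : ℂ => σ i * z.im + τ i * κ * (z.re - (P i).re) := by fun_prop
      have hlt : σ i * (0 : ℂ).im + τ i * κ * ((0 : ℂ).re - (P i).re) < b := by
        have h1 : |τ i| = 1 := by fin_cases i <;> simp [τ]
        have h2 : |(P i).re| ≤ η := by fin_cases i <;> simp [P, hp, hq]
        have h3 : |τ i * κ * (P i).re| ≤ κ * η := by
          rw [abs_mul, abs_mul, h1, one_mul, abs_of_pos hκ0]; gcongr
        simp only [Complex.zero_im, Complex.zero_re, mul_zero, zero_add, zero_sub]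
        linarith [(abs_le.1 h3).1]
      exact (hc.continuousAt.eventually (gt_mem_nhds hlt)).mono fun z hz => hz.le
    exact hev
  · intro z hz
    exact mem_ball_zero_iff.2 ((hNn z hz).trans_le (min_le_left _ _))
  · exact (((Complex.imCLM.hasFDerivAt (x := z)).const_mul (σ i))).add
      (((Complex.reCLM.hasFDerivAt (x := z)).sub_const (P i).re).const_mul (τ i * κ))
  · intro z hz i hi
    have hzn := hNn z hz
    obtain ⟨h1, h2, h3, h4⟩ := (hN z).1 hz
    have hgoal : (σ i • Complex.imCLM + (τ i * κ) • Complex.reCLM) (X z) =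
        σ i * (X z).im + τ i * κ * (X z).re := by simp
    rw [hgoal]
    refine hface (σ i) (τ i) ?_ ?_ (P i) z ?_ hzn ?_ ?_ ?_ hi ?_
    · fin_cases i <;> simp [σ]
    · fin_cases i <;> simp [τ]
    · fin_cases i <;> simp [P, hpn, hqn]
    · fin_cases i <;> simp [P, hpX, hqX]
    · fin_cases i <;> simp [P, σ, hpb, hqb]
    · fin_cases i <;> simp [P, σ, hXp, hXq]
    · fin_cases i <;> simp [P, σ, τ] <;> linarith

/-- A real linear map of the plane with nonpositive determinant and positive trace has an eigenvalue
at most zero. -/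
theorem exists_eigenvector_of_det_nonpos (A : ℂ →L[ℝ] ℂ)
    (hdet : (A 1).re * (A Complex.I).im - (A Complex.I).re * (A 1).im ≤ 0) :
    ∃ (μ : ℝ) (v : ℂ), μ ≤ 0 ∧ v ≠ 0 ∧ A v = μ * v := by
  set a := (A 1).re with ha
  set c := (A 1).im with hc
  set b := (A Complex.I).re with hb
  set d := (A Complex.I).im with hd
  obtain ⟨μ, hμ0, hμ⟩ : ∃ μ : ℝ, μ ≤ 0 ∧ (a - μ) * (d - μ) = b * c := by
    have hdisc : (a + d) ^ 2 ≤ (a + d) ^ 2 - 4 * (a * d - b * c) := by linarith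
    have hsq := Real.sq_sqrt ((sq_nonneg _).trans hdisc)
    refine ⟨(a + d - √((a + d) ^ 2 - 4 * (a * d - b * c))) / 2, ?_, ?_⟩
    · have := Real.sqrt_le_sqrt hdisc
      rw [Real.sqrt_sq_eq_abs] at this
      linarith [le_abs_self (a + d)]
    · linear_combination hsq / 4
  have hA : ∀ x y : ℝ, (a - μ) * x + b * y = 0 → c * x + (d - μ) * y = 0 →
      A ⟨x, y⟩ = μ * (⟨x, y⟩ : ℂ) := by
    intro x y h1 h2
    rw [clm_complex_apply A]
    apply Complex.ext
    · simp [← ha, ← hb]; linarith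
    · simp [← hc, ← hd]; linarith
  by_cases h1 : a - μ = 0 ∧ b = 0
  · by_cases h2 : d - μ = 0 ∧ c = 0
    · exact ⟨μ, ⟨1, 0⟩, hμ0, fun h => by simpa using congrArg Complex.re h,
        hA 1 0 (by simp [h1.1]) (by simp [h2.2])⟩
    · refine ⟨μ, ⟨d - μ, -c⟩, hμ0, fun h => h2 ⟨congrArg Complex.re h, ?_⟩, hA _ _ ?_ ?_⟩
      · simpa using congrArg Complex.im h
      · rw [h1.1, h1.2]; ring
      · ring
  · refine ⟨μ, ⟨-b, a - μ⟩, hμ0, fun h => h1 ⟨congrArg Complex.im h, ?_⟩, hA _ _ ?_ ?_⟩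
    · simpa using congrArg Complex.re h
    · ring
    · linear_combination hμ

/-- An equilibrium with positive divergence has arbitrarily small repelling neighbourhoods, provided
`X z / z` has a continuous logarithm around it (that is, its index is `1`). -/
theorem exists_isRepellingRegion (h0 : X 0 = 0) (hX : Continuous X)
    (hA : HasStrictFDerivAt X A 0) (htr : 0 < (A 1).re + (A Complex.I).im) {r : ℝ} (hr : 0 < r)
    {M : ℂ → ℂ} (hMc : ContinuousOn M (Metric.ball 0 r \ {0}))
    (hM : ∀ z ∈ Metric.ball 0 r \ {0}, X z = z * Complex.exp (M z)) {ρ : ℝ} (hρ : 0 < ρ) :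
    ∃ N ∈ 𝓝 (0 : ℂ), N ⊆ Metric.ball 0 ρ ∧ IsRepellingRegion X N := by
  rcases lt_or_ge 0 ((A 1).re * (A Complex.I).im - (A Complex.I).re * (A 1).im) with hdet | hdet
  · exact exists_isRepellingRegion_of_det_pos h0 hA htr hdet hρ
  obtain ⟨μ, v, hμ, hv, hAv⟩ := exists_eigenvector_of_det_nonpos A hdet
  -- rotate the eigenvector to the vertical axis
  set n : ℂ := ((‖v‖ : ℝ) : ℂ) with hn_def
  have hn : n ≠ 0 := by rw [hn_def]; exact_mod_cast norm_ne_zero_iff.2 hv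
  set u : ℂ := -Complex.I * (v / n) with hu_def
  have hu1 : ‖u‖ = 1 := by
    rw [hu_def]; simp [n, norm_ne_zero_iff.2 hv]
  have hu : u ≠ 0 := norm_ne_zero_iff.1 (by rw [hu1]; norm_num)
  have huI : u * Complex.I = ((‖v‖⁻¹ : ℝ) : ℂ) * v := by
    rw [hu_def]; push_cast; field_simp
    rw [← hn_def]; field_simp; linear_combination (-1 : ℂ) * Complex.I_sq
  let U : ℂ →L[ℝ] ℂ := ContinuousLinearMap.mul ℝ ℂ u
  let U' : ℂ →L[ℝ] ℂ := ContinuousLinearMap.mul ℝ ℂ u⁻¹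
  let B : ℂ →L[ℝ] ℂ := U'.comp (A.comp U)
  have hBI : B Complex.I = μ * Complex.I := by
    have : A (u * Complex.I) = μ * (u * Complex.I) := by
      rw [huI, ← Complex.real_smul, map_smul, hAv, Complex.real_smul, Complex.real_smul]; ring
    simp only [B, U, U', ContinuousLinearMap.comp_apply, ContinuousLinearMap.mul_apply', this]
    field_simp
  -- the rotation does not change the trace, so that the other eigenvalue is `tr A - μ > μ`
  have hBtr : (B 1).re + (B Complex.I).im = (A 1).re + (A Complex.I).im := by
    have hconj : u⁻¹ = (starRingEnd ℂ) u := by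
      rw [Complex.inv_def, Complex.normSq_eq_norm_sq, hu1]; simp
    have hns : u.re * u.re + u.im * u.im = 1 := by
      rw [← Complex.normSq_apply, Complex.normSq_eq_norm_sq, hu1]; norm_num
    have e1 := clm_complex_apply A u
    have e2 := clm_complex_apply A (u * Complex.I)
    simp only [B, U, U', ContinuousLinearMap.comp_apply, ContinuousLinearMap.mul_apply', mul_one]
    rw [e1, e2, hconj]
    simp
    linear_combination ((A 1).re + (A Complex.I).im) * hns
  have hB1 : (B 1).re = (A 1).re + (A Complex.I).im - μ := by
    rw [← hBtr, hBI]; simp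
  have hball : ∀ z, z ∈ Metric.ball (0 : ℂ) r \ {0} → u * z ∈ Metric.ball (0 : ℂ) r \ {0} := by
    rintro z ⟨h1, h2⟩
    refine ⟨?_, mul_ne_zero hu h2⟩
    rw [mem_ball_zero_iff] at h1 ⊢
    rwa [norm_mul, hu1, one_mul]
  obtain ⟨N, hN, hNρ, hrep⟩ := exists_isRepellingRegion_of_vertical (X := fun z => u⁻¹ * X (u * z))
    (A := B) (μ := μ) (M := fun z => M (u * z)) (r := r) (ρ := ρ) (by simp [h0])
    (continuous_const.mul (hX.comp (continuous_const.mul continuous_id)))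
    (by
      have h1 : HasStrictFDerivAt X A (U 0) := by simpa using hA
      exact (U'.hasStrictFDerivAt.comp _ (h1.comp _ U.hasStrictFDerivAt)))
    hBI (by rw [hB1]; linarith) (by rw [hB1]; linarith) hr
    (hMc.comp (continuous_const.mul continuous_id).continuousOn hball)
    (fun z hz => by rw [hM _ (hball z hz)]; field_simp) hρ
  refine ⟨(u * ·) '' N, ?_, ?_, hrep.rotate hu⟩
  · have := (Homeomorph.mulLeft₀ u hu).isOpenMap.image_mem_nhds hN
    simpa using this
  · rintro _ ⟨z, hz, rfl⟩
    have := hNρ hz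
    rw [mem_ball_zero_iff] at this ⊢
    rwa [norm_mul, hu1, one_mul]

/-- A planar field that does not vanish on the punctured closed unit disc and rotates the unit
circle has `X z / z = exp (M z)` with `M` continuous on the punctured disc: integrate the
logarithmic derivative along radii, starting from the circle. -/
theorem exists_log_div (hX : ContDiff ℝ 1 X) (hne : ∀ z, ‖z‖ ≤ 1 → z ≠ 0 → X z ≠ 0)
    (hcirc : ∀ z, ‖z‖ = 1 → X z = Complex.I * z) :
    ∃ M : ℂ → ℂ, ContinuousOn M (Metric.ball 0 1 \ {0}) ∧
      ∀ z ∈ Metric.ball 0 1 \ {0}, X z = z * Complex.exp (M z) := by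
  -- the radius through `z`, from `z` at time `0` to the circle at time `1`
  let w : ℂ → ℝ → ℂ := fun z s => z * Complex.exp (-(s * Real.log ‖z‖ : ℝ))
  let w' : ℂ → ℝ → ℂ := fun z s => -(Real.log ‖z‖ : ℝ) * w z s
  -- the quotient whose logarithm is sought, along the radius, and its derivative
  let γ : ℂ → ℝ → ℂ := fun z s => X (w z s) / w z s
  let γ' : ℂ → ℝ → ℂ := fun z s =>
    (fderiv ℝ X (w z s) (w' z s) * w z s - X (w z s) * w' z s) / w z s ^ 2
  have hw0 : ∀ z s, z ≠ 0 → w z s ≠ 0 := fun z s hz => mul_ne_zero hz (Complex.exp_ne_zero _)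
  have hwn : ∀ z s, z ≠ 0 → ‖w z s‖ = Real.exp ((1 - s) * Real.log ‖z‖) := by
    intro z s hz
    rw [norm_mul, Complex.norm_exp]
    simp only [Complex.neg_re, Complex.ofReal_re]
    nth_rewrite 1 [← Real.exp_log (norm_pos_iff.2 hz)]
    rw [← Real.exp_add]; congr 1; ring
  have hwle : ∀ z s, z ∈ Metric.ball (0 : ℂ) 1 \ {0} → s ∈ Icc (0 : ℝ) 1 → ‖w z s‖ ≤ 1 := by
    intro z s hz hs
    rw [hwn z s hz.2, Real.exp_le_one_iff]
    refine mul_nonpos_of_nonneg_of_nonpos (by linarith [hs.2]) ?_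
    exact Real.log_nonpos (norm_nonneg _) (mem_ball_zero_iff.1 hz.1).le
  have hwd : ∀ z s, HasDerivAt (w z) (w' z s) s := by
    intro z s
    have h1 : HasDerivAt (fun s : ℝ => ((s * Real.log ‖z‖ : ℝ) : ℂ)) (Real.log ‖z‖ : ℝ) s := by
      have := ((hasDerivAt_id s).mul_const (Real.log ‖z‖)).ofReal_comp
      simpa using this
    refine (h1.neg.cexp.const_mul z).congr_deriv ?_
    simp only [w', w, Pi.neg_apply]
    ring
  have hγd : ∀ z s, z ≠ 0 → HasDerivAt (γ z) (γ' z s) s := by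
    intro z s hz
    have h1 : HasDerivAt (fun s => X (w z s)) (fderiv ℝ X (w z s) (w' z s)) s :=
      ((hX.differentiable one_ne_zero _).hasFDerivAt).comp_hasDerivAt s (hwd z s)
    exact h1.div (hwd z s) (hw0 z s hz)
  have hwc : Continuous fun q : (({0}ᶜ : Set ℂ)) × ℝ => w q.1 q.2 := by
    have h1 : Continuous fun q : (({0}ᶜ : Set ℂ)) × ℝ => Real.log ‖(q.1 : ℂ)‖ :=
      Continuous.log (by fun_prop) fun q => norm_ne_zero_iff.2 q.1.2
    exact (continuous_subtype_val.comp continuous_fst).mul (Complex.continuous_exp.comp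
      (Complex.continuous_ofReal.comp (continuous_snd.mul h1)).neg)
  have hlc : Continuous fun q : (({0}ᶜ : Set ℂ)) × ℝ => ((Real.log ‖(q.1 : ℂ)‖ : ℝ) : ℂ) :=
    Complex.continuous_ofReal.comp
      (Continuous.log (by fun_prop) fun q => norm_ne_zero_iff.2 q.1.2)
  have hw'c : Continuous fun q : (({0}ᶜ : Set ℂ)) × ℝ => w' q.1 q.2 := hlc.neg.mul hwc
  have hfd : Continuous (fderiv ℝ X) := hX.continuous_fderiv one_ne_zero
  have hγ'c : Continuous fun q : (({0}ᶜ : Set ℂ)) × ℝ => γ' q.1 q.2 :=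
    ((((hfd.comp hwc).clm_apply hw'c).mul hwc).sub ((hX.continuous.comp hwc).mul hw'c)).div
      (hwc.pow 2) fun q => pow_ne_zero _ (hw0 _ _ q.1.2)
  have hγc : Continuous fun q : (({0}ᶜ : Set ℂ)) × ℝ => γ q.1 q.2 :=
    (hX.continuous.comp hwc).div hwc fun q => hw0 _ _ q.1.2
  have hγ0 : ∀ z s, z ∈ Metric.ball (0 : ℂ) 1 \ {0} → s ∈ Icc (0 : ℝ) 1 → γ z s ≠ 0 :=
    fun z s hz hs => div_ne_zero (hne _ (hwle z s hz hs) (hw0 z s hz.2)) (hw0 z s hz.2)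
  -- on the circle the quotient is `I = exp (π I / 2)`
  refine ⟨fun z => Real.pi / 2 * Complex.I - ∫ s in (0 : ℝ)..1, γ' z s / (γ z s - 0), ?_, ?_⟩
  · refine continuousOn_const.sub ?_
    rw [continuousOn_iff_continuous_domRestrict]
    -- the integrand is continuous only for `s` in `[0, 1]`, hence the projection to this interval
    let ι : (Metric.ball (0 : ℂ) 1 \ {0} : Set ℂ) → (({0}ᶜ : Set ℂ)) := fun z => ⟨z, z.2.2⟩
    have hι : Continuous ι := continuous_subtype_val.subtype_mk _
    have hp : Continuous fun q : (Metric.ball (0 : ℂ) 1 \ {0} : Set ℂ) × ℝ =>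
        (ι q.1, ((projIcc 0 1 (zero_le_one' ℝ) q.2 : Icc (0 : ℝ) 1) : ℝ)) :=
      (hι.comp continuous_fst).prodMk
        (continuous_subtype_val.comp (continuous_projIcc.comp continuous_snd))
    have h : Continuous fun z : (Metric.ball (0 : ℂ) 1 \ {0} : Set ℂ) =>
        ∫ s in (0 : ℝ)..1, γ' z (projIcc 0 1 (zero_le_one' ℝ) s) /
          (γ z (projIcc 0 1 (zero_le_one' ℝ) s) - 0) := by
      refine intervalIntegral.continuous_parametric_intervalIntegral_of_continuous' ?_ 0 1
      refine (hγ'c.comp hp).div ((hγc.comp hp).sub continuous_const) ?_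
      rintro ⟨z, s⟩
      rw [sub_zero]
      exact hγ0 z _ z.2 (projIcc 0 1 (zero_le_one' ℝ) s).2
    refine h.congr fun z => ?_
    refine intervalIntegral.integral_congr fun s hs => ?_
    rw [uIcc_of_le zero_le_one] at hs
    simp only [projIcc_of_mem (zero_le_one' ℝ) hs]
  · intro z hz
    have hz0 : z ≠ 0 := hz.2
    have hpair : Continuous fun s : ℝ => ((⟨z, hz0⟩ : ({0}ᶜ : Set ℂ)), s) :=
      continuous_const.prodMk continuous_id
    have hγ'z : Continuous (γ' z) := by
      clear_value γ' γ
      exact hγ'c.comp hpair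
    have hmem : (0 : ℂ) ∉ γ z '' Icc 0 1 := by
      rintro ⟨s, hs, h⟩
      exact hγ0 z s hz hs h
    have h1 := exp_integral_inv_sub zero_le_one (fun s => hγd z s hz0) hγ'z hmem
    have hγ1 : γ z 1 = Complex.I := by
      have : ‖w z 1‖ = 1 := by rw [hwn z 1 hz0]; simp
      simp only [γ]
      rw [hcirc _ this, mul_div_cancel_right₀ _ (hw0 z 1 hz0)]
    have hγ00 : γ z 0 = X z / z := by simp [γ, w]
    rw [Complex.exp_sub, h1, sub_zero, sub_zero, hγ1, hγ00, Complex.exp_pi_div_two_mul_I]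
    have := hne z (mem_ball_zero_iff.1 hz.1).le hz0
    field_simp

end LocalRepelling

/-! ### Spiralling flows on the disc -/

/-- A neighbourhood of the unit circle contains a collar of the unit disc. -/
theorem exists_collar_of_sphere_subset {V : Set ℂ} (hV : IsOpen V)
    (hs : Metric.sphere (0 : ℂ) 1 ⊆ V) : ∃ r < 1, 0 < r ∧ ∀ z, r < ‖z‖ → ‖z‖ ≤ 1 → z ∈ V := by
  obtain ⟨η, hη, hηu⟩ := (isCompact_sphere (0 : ℂ) 1).exists_thickening_subset_open hV hs
  refine ⟨max (1 - η) (1 / 2), ?_, ?_, fun z hz hz1 => hηu ?_⟩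
  · rw [max_lt_iff]; exact ⟨by linarith, by norm_num⟩
  · exact lt_of_lt_of_le (by norm_num) (le_max_right _ _)
  · rw [max_lt_iff] at hz
    have hz0 : 0 < ‖z‖ := by linarith [hz.2]
    rw [Metric.mem_thickening_iff]
    refine ⟨((‖z‖⁻¹ : ℝ) : ℂ) * z, ?_, ?_⟩
    · rw [mem_sphere_zero_iff_norm, norm_mul, Complex.norm_real, norm_inv, norm_norm,
        inv_mul_cancel₀ hz0.ne']
    · have e : z - ((‖z‖⁻¹ : ℝ) : ℂ) * z = ((1 - ‖z‖⁻¹ : ℝ) : ℂ) * z := by push_cast; ring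
      rw [dist_eq_norm, e, norm_mul, Complex.norm_real, Real.norm_eq_abs, abs_of_nonpos, neg_sub,
        sub_mul, inv_mul_cancel₀ hz0.ne']
      · linarith [hz.1]
      · rw [sub_nonpos]; exact (one_le_inv₀ hz0).2 hz1

/-- The planar flow `φ` of `X` preserves the unit disc, rotates the unit circle with angular speed
`ε = ± 1` (as well as the angles of the points close to it), and has `0` as its only equilibrium in
the disc, with nonzero divergence there. -/
structure IsDiscFlow (ε : ℝ) (X : ℂ → ℂ) (φ : Flow ℝ ℂ) : Prop where
  sign : ε = 1 ∨ ε = -1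
  smooth : ContDiff ℝ ∞ X
  lipschitz : ∃ K, LipschitzWith K X
  integrates : φ.Integrates X
  zero : X 0 = 0
  ne_zero : ∀ z, ‖z‖ ≤ 1 → z ≠ 0 → X z ≠ 0
  trace : (fderiv ℝ X 0 1).re + (fderiv ℝ X 0 Complex.I).im ≠ 0
  collar : ∃ r < 1, ∀ z, r < ‖z‖ → ‖z‖ ≤ 1 → (X z / z).im = ε
  circle : ∀ z, ‖z‖ = 1 → X z = ε * Complex.I * z

/-- A disc flow without periodic orbits in the interior of the disc, apart from the equilibrium. -/
structure IsSpiralFlow (ε : ℝ) (X : ℂ → ℂ) (φ : Flow ℝ ℂ) : Prop extends IsDiscFlow ε X φ where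
  not_periodic : ∀ z, ‖z‖ < 1 → z ≠ 0 → ∀ T, 0 < T → φ T z ≠ z

theorem Flow.neg_apply_apply {α : Type*} [TopologicalSpace α] (φ : Flow ℝ α) (t : ℝ) (z : α) :
    φ (-t) (φ t z) = z := by
  rw [← φ.map_add]; simp

namespace IsDiscFlow

variable {ε : ℝ} {X : ℂ → ℂ} {φ : Flow ℝ ℂ}

theorem reverse (h : IsDiscFlow ε X φ) : IsDiscFlow (-ε) (-X) φ.reverse where
  sign := h.sign.symm.imp (fun h => by rw [h, neg_neg]) (fun h => by rw [h])
  smooth := h.smooth.neg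
  lipschitz := h.lipschitz.imp fun _ hK => hK.neg
  integrates := h.integrates.reverse
  zero := by simp [h.zero]
  ne_zero z hz hz0 := neg_ne_zero.2 (h.ne_zero z hz hz0)
  trace := by
    intro h'
    rw [fderiv_neg] at h'
    simp only [neg_apply, Complex.neg_re, Complex.neg_im] at h'
    exact h.trace (by linarith)
  collar := h.collar.imp fun r hr => ⟨hr.1, fun z h1 h2 => by simp [neg_div, hr.2 z h1 h2]⟩
  circle z hz := by simp [h.circle z hz]

theorem apply_zero (h : IsDiscFlow ε X φ) (t : ℝ) : φ t 0 = 0 :=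
  h.lipschitz.elim fun _ hK => h.integrates.fixed_of_zero hK h.zero t

theorem apply_eq_zero (h : IsDiscFlow ε X φ) {t : ℝ} {z : ℂ} : φ t z = 0 ↔ z = 0 := by
  refine ⟨fun hz => ?_, fun hz => by rw [hz, h.apply_zero]⟩
  rw [← Flow.neg_apply_apply φ t z, hz, h.apply_zero]

theorem apply_of_norm_eq_one (h : IsDiscFlow ε X φ) {z : ℂ} (hz : ‖z‖ = 1) (t : ℝ) :
    φ t z = z * Complex.exp (ε * t * Complex.I) := by
  obtain ⟨K, hK⟩ := h.lipschitz
  refine congrFun (integralCurve_unique hK (γ := fun t => φ t z)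
    (δ := fun t : ℝ => z * Complex.exp (ε * t * Complex.I)) (t₀ := 0) (h.integrates z) ?_
    (by simp)) t
  intro t
  have h1 : ‖z * Complex.exp (ε * t * Complex.I)‖ = 1 := by
    rw [norm_mul, hz, ← Complex.ofReal_mul, Complex.norm_exp_ofReal_mul_I, one_mul]
  rw [h.circle _ h1]
  have h2 : HasDerivAt (fun t : ℝ => (ε * t * Complex.I : ℂ)) (ε * Complex.I) t := by
    have := ((Complex.ofRealCLM.hasDerivAt (x := t)).const_mul (ε : ℂ)).mul_const Complex.I
    simpa using this
  exact (h2.cexp.const_mul z).congr_deriv (by ring)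

theorem norm_apply_of_norm_eq_one (h : IsDiscFlow ε X φ) {z : ℂ} (hz : ‖z‖ = 1) (t : ℝ) :
    ‖φ t z‖ = 1 := by
  rw [h.apply_of_norm_eq_one hz, norm_mul, hz, ← Complex.ofReal_mul,
    Complex.norm_exp_ofReal_mul_I, one_mul]

theorem norm_apply_eq_one (h : IsDiscFlow ε X φ) {z : ℂ} {t : ℝ} : ‖φ t z‖ = 1 ↔ ‖z‖ = 1 := by
  refine ⟨fun hz => ?_, fun hz => h.norm_apply_of_norm_eq_one hz t⟩
  rw [← Flow.neg_apply_apply φ t z]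
  exact h.norm_apply_of_norm_eq_one hz _

theorem norm_apply_lt_one (h : IsDiscFlow ε X φ) {z : ℂ} (hz : ‖z‖ < 1) (t : ℝ) :
    ‖φ t z‖ < 1 := by
  by_contra! hc
  have h1 : (1 : ℝ) ∈ uIcc ‖φ 0 z‖ ‖φ t z‖ := by
    rw [φ.map_zero_apply, uIcc_of_le (hz.le.trans hc)]
    exact ⟨hz.le, hc⟩
  obtain ⟨s, -, hs⟩ := intermediate_value_uIcc
    (h.integrates.continuous_orbit z).norm.continuousOn h1
  exact hz.ne (h.norm_apply_eq_one.1 hs)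

end IsDiscFlow

namespace IsSpiralFlow

variable {ε : ℝ} {X : ℂ → ℂ} {φ : Flow ℝ ℂ}

theorem reverse (h : IsSpiralFlow ε X φ) : IsSpiralFlow (-ε) (-X) φ.reverse where
  toIsDiscFlow := h.toIsDiscFlow.reverse
  not_periodic z hz hz0 T hT heq := by
    refine h.not_periodic z hz hz0 T hT ?_
    conv_lhs => rw [← heq]
    rw [Flow.reverse_apply, ← φ.map_add]
    simp

/-- Points close to the unit circle stay close to it for a bounded time. -/
theorem exists_lt_norm_apply (h : IsSpiralFlow ε X φ) {ρ : ℝ} (hρ : ρ < 1) (T : ℝ) :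
    ∃ r < 1, ρ ≤ r ∧ 0 < r ∧ ∀ z, r < ‖z‖ → ‖z‖ ≤ 1 → ∀ t, |t| ≤ T → ρ < ‖φ t z‖ := by
  have hopen : IsOpen {q : ℂ × ℝ | ρ < ‖φ q.2 q.1‖} :=
    isOpen_lt continuous_const (φ.continuous continuous_snd continuous_fst).norm
  obtain ⟨u, v, hu, -, hsu, hsv, huv⟩ := generalized_tube_lemma
    (isCompact_sphere (0 : ℂ) 1) (isCompact_Icc (a := -T) (b := T)) hopen (by
      rintro ⟨z, t⟩ ⟨hz, -⟩
      rw [mem_sphere_zero_iff_norm] at hz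
      show ρ < ‖φ t z‖
      rwa [h.norm_apply_of_norm_eq_one hz])
  obtain ⟨r, hr, hr0, hru⟩ := exists_collar_of_sphere_subset hu hsu
  refine ⟨max r ρ, max_lt hr hρ, le_max_right _ _, hr0.trans_le (le_max_left _ _),
    fun z hz hz1 t ht => ?_⟩
  exact huv (a := (z, t)) ⟨hru z ((le_max_left _ _).trans_lt hz) hz1, hsv (abs_le.1 ht)⟩

/-- As long as an orbit stays in the collar, its angle changes at the constant speed `ε`. -/
theorem apply_eq_of_mem_collar (h : IsSpiralFlow ε X φ) {r : ℝ}
    (hr : ∀ z, r < ‖z‖ → ‖z‖ ≤ 1 → (X z / z).im = ε) {z : ℂ} (hz : ‖z‖ ≤ 1) (hz0 : z ≠ 0) {t : ℝ}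
    (ht : 0 ≤ t) (hcol : ∀ s ∈ Icc 0 t, r < ‖φ s z‖) :
    ∃ R : ℝ, φ t z = z * Complex.exp (R + ε * t * Complex.I) := by
  have hn : ∀ s, ‖φ s z‖ ≤ 1 := fun s => by
    rcases hz.lt_or_eq with hz | hz
    · exact (h.norm_apply_lt_one hz s).le
    · exact (h.norm_apply_of_norm_eq_one hz s).le
  have hc := h.integrates.continuous_orbit z
  have key := exp_integral_inv_sub (γ := fun s => φ s z) (γ' := fun s => X (φ s z)) ht
    (h.integrates z) (h.smooth.continuous.comp hc) (a := 0) (by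
      rintro ⟨s, -, hs⟩
      exact hz0 (h.apply_eq_zero.1 hs))
  set J : ℂ := ∫ s in (0 : ℝ)..t, X (φ s z) / (φ s z - 0) with hJ
  have hint : IntervalIntegrable (fun s => X (φ s z) / (φ s z - 0)) MeasureTheory.volume 0 t := by
    refine Continuous.intervalIntegrable ?_ _ _
    refine (h.smooth.continuous.comp hc).div (hc.sub continuous_const) fun s => ?_
    rw [sub_zero]
    exact fun hs => hz0 (h.apply_eq_zero.1 hs)
  have him : J.im = ε * t := by
    have h1 := Complex.imCLM.intervalIntegral_comp_comm hint
    simp only [Complex.imCLM_apply] at h1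
    rw [hJ, ← h1]
    have h2 : ∫ s in (0 : ℝ)..t, (X (φ s z) / (φ s z - 0)).im = ∫ _ in (0 : ℝ)..t, ε := by
      refine intervalIntegral.integral_congr fun s hs => ?_
      rw [uIcc_of_le ht] at hs
      simp only [sub_zero]
      exact hr _ (hcol s hs) (hn s)
    rw [h2, intervalIntegral.integral_const]
    simp [mul_comm]
  refine ⟨J.re, ?_⟩
  have e : (J.re : ℂ) + ε * t * Complex.I = J := by
    conv_rhs => rw [← Complex.re_add_im J, him]
    push_cast; ring
  rw [e, key]
  simp only [sub_zero, φ.map_zero_apply]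
  field_simp

theorem apply_eq_of_mem_collar' (h : IsSpiralFlow ε X φ) {r : ℝ}
    (hr : ∀ z, r < ‖z‖ → ‖z‖ ≤ 1 → (X z / z).im = ε) {z : ℂ} (hz : ‖z‖ < 1) (hz0 : z ≠ 0) {t T : ℝ}
    (ht : |t| ≤ T) (hcol : ∀ s, |s| ≤ T → r < ‖φ s z‖) :
    ∃ R : ℝ, φ t z = z * Complex.exp (R + ε * t * Complex.I) := by
  rcases le_total 0 t with h0 | h0
  · refine h.apply_eq_of_mem_collar hr hz.le hz0 h0 fun s hs => hcol s ?_
    rw [abs_of_nonneg hs.1]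
    rw [abs_of_nonneg h0] at ht
    exact hs.2.trans ht
  · rw [abs_of_nonpos h0] at ht
    obtain ⟨R, hR⟩ := h.apply_eq_of_mem_collar hr (h.norm_apply_lt_one hz t).le
      (fun h' => hz0 (h.apply_eq_zero.1 h')) (t := -t) (by linarith) fun s hs => by
        rw [← φ.map_add]
        refine hcol _ (abs_le.2 ⟨by linarith [hs.1], by linarith [hs.2]⟩)
    rw [Flow.neg_apply_apply] at hR
    refine ⟨-R, ?_⟩
    conv_rhs => rw [hR]
    rw [mul_assoc, ← Complex.exp_add]
    push_cast
    ring_nf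
    simp

/-- The field of a spiralling flow has arbitrarily small repelling regions around `0` if its
divergence there is positive. -/
theorem exists_isRepellingRegion (h : IsSpiralFlow ε X φ)
    (htr : 0 < (fderiv ℝ X 0 1).re + (fderiv ℝ X 0 Complex.I).im) {ρ : ℝ} (hρ : 0 < ρ) :
    ∃ N ∈ 𝓝 (0 : ℂ), N ⊆ Metric.ball 0 ρ ∧ IsRepellingRegion X N := by
  have hX1 : ContDiff ℝ 1 X := h.smooth.of_le (by exact_mod_cast le_top)
  have hM : ∃ M : ℂ → ℂ, ContinuousOn M (Metric.ball 0 1 \ {0}) ∧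
      ∀ z ∈ Metric.ball 0 1 \ {0}, X z = z * Complex.exp (M z) := by
    rcases h.sign with hε | hε
    · exact exists_log_div hX1 h.ne_zero fun z hz => by simp [h.circle z hz, hε]
    · obtain ⟨M, hMc, hM⟩ := exists_log_div (X := -X) hX1.neg
        (fun z hz hz0 => neg_ne_zero.2 (h.ne_zero z hz hz0))
        fun z hz => by simp [h.circle z hz, hε]
      refine ⟨fun z => M z + Real.pi * Complex.I, hMc.add continuousOn_const, fun z hz => ?_⟩
      rw [Complex.exp_add, Complex.exp_pi_mul_I]
      have := hM z hz
      rw [Pi.neg_apply] at this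
      linear_combination -this
  obtain ⟨M, hMc, hM⟩ := hM
  exact _root_.exists_isRepellingRegion h.zero h.smooth.continuous
    (h.smooth.contDiffAt.hasStrictFDerivAt (by simp)) htr one_pos hMc hM hρ

/-- Poincaré–Bendixson: the forward orbit of a point cannot stay, from some time on, in a compact
subset of the punctured open disc. -/
theorem not_eventually_mem (h : IsSpiralFlow ε X φ) {K : Set ℂ} (hK : IsCompact K)
    (hKs : K ⊆ Metric.ball 0 1 \ {0}) (z : ℂ) : ¬ ∀ᶠ t in atTop, φ t z ∈ K := by
  intro hev
  have himg : closure (image2 φ {t | φ t z ∈ K} {z}) ⊆ K := by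
    refine closure_minimal ?_ hK.isClosed
    rintro _ ⟨t, ht, _, rfl, rfl⟩
    exact ht
  have hsub : omegaLimit atTop φ {z} ⊆ K :=
    (omegaLimit_subset_closure_image2 _ _ _ hev).trans himg
  obtain ⟨y, hy, T, hT, hper⟩ := exists_periodic_mem (Ω := omegaLimit atTop φ {z}) h.integrates
    h.smooth.continuous (hK.of_isClosed_subset (isClosed_omegaLimit _ _ _) hsub)
    (nonempty_omegaLimit_of_isCompact_absorbing _ _ _ hK ⟨_, hev, himg⟩ (singleton_nonempty z))
    (Flow.isInvariant_omegaLimit _ _ _ fun t => tendsto_atTop_add_const_left _ t tendsto_id)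
    fun y hy => h.ne_zero y (mem_ball_zero_iff.1 (hKs (hsub hy)).1).le (hKs (hsub hy)).2
  exact h.not_periodic y (mem_ball_zero_iff.1 (hKs (hsub hy)).1) (hKs (hsub hy)).2 T hT hper

/-- If `0` is repelling then every orbit comes close to the unit circle in forward time. -/
theorem exists_lt_norm_of_trace_pos (h : IsSpiralFlow ε X φ)
    (htr : 0 < (fderiv ℝ X 0 1).re + (fderiv ℝ X 0 Complex.I).im) {z : ℂ} (hz0 : z ≠ 0)
    {ρ : ℝ} (hρ : ρ < 1) : ∃ t, 0 ≤ t ∧ ρ < ‖φ t z‖ := by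
  by_contra! hc
  obtain ⟨N, hN, hNz, hrep⟩ := h.exists_isRepellingRegion htr (norm_pos_iff.2 hz0)
  have hout : ∀ t, 0 ≤ t → φ t z ∉ N := by
    intro t ht hmem
    have := hNz (hrep.backward_invariant h.integrates hmem ht)
    rw [Flow.neg_apply_apply, mem_ball_zero_iff] at this
    exact lt_irrefl _ this
  refine h.not_eventually_mem (K := Metric.closedBall 0 ρ \ interior N)
    ((isCompact_closedBall _ _).diff isOpen_interior) ?_ z ?_
  · rintro y ⟨hy1, hy2⟩
    refine ⟨mem_ball_zero_iff.2 ((mem_closedBall_zero_iff.1 hy1).trans_lt hρ), ?_⟩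
    rintro rfl
    exact hy2 (mem_interior_iff_mem_nhds.2 hN)
  · filter_upwards [eventually_ge_atTop 0] with t ht
    exact ⟨mem_closedBall_zero_iff.2 (hc t ht), fun h' => hout t ht (interior_subset h')⟩

/-- Every orbit in the punctured open disc comes close to the unit circle. -/
theorem exists_lt_norm (h : IsSpiralFlow ε X φ) {z : ℂ} (hz0 : z ≠ 0) {ρ : ℝ} (hρ : ρ < 1) :
    ∃ t, ρ < ‖φ t z‖ := by
  rcases lt_or_gt_of_ne h.trace with htr | htr
  · obtain ⟨t, -, ht⟩ := h.reverse.exists_lt_norm_of_trace_pos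
      (by rw [fderiv_neg]; simp; linarith) hz0 hρ
    exact ⟨-t, ht⟩
  · obtain ⟨t, -, ht⟩ := h.exists_lt_norm_of_trace_pos htr hz0 hρ
    exact ⟨t, ht⟩

/-- Within time `π`, a point of the collar is carried to the positive real axis. -/
theorem exists_apply_eq_ofReal (h : IsSpiralFlow ε X φ) {ρ : ℝ} (hρ : ρ < 1) :
    ∃ r < 1, ∀ z, r < ‖z‖ → ‖z‖ < 1 → ∃ t, |t| ≤ Real.pi ∧ ∃ x : ℝ, ρ < x ∧ 0 < x ∧ x < 1 ∧
      φ t z = x := by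
  obtain ⟨r₁, hr₁, hcol⟩ := h.collar
  obtain ⟨r, hr, hρr, hr0, hrφ⟩ := h.exists_lt_norm_apply (max_lt hρ hr₁) Real.pi
  refine ⟨r, hr, fun z hz hz1 => ?_⟩
  have hz0 : z ≠ 0 := norm_pos_iff.1 (hr0.trans hz)
  have hε2 : ε * ε = 1 := by rcases h.sign with h | h <;> simp [h]
  have ht : |-(ε * z.arg)| ≤ Real.pi := by
    rw [abs_neg, abs_mul, show |ε| = 1 by rcases h.sign with h | h <;> simp [h], one_mul]
    exact Complex.abs_arg_le_pi z
  have hrz := hrφ z hz hz1.le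
  obtain ⟨R, hR⟩ := h.apply_eq_of_mem_collar' hcol hz1 hz0 ht
    fun s hs => (le_max_right _ _).trans_lt (hrz s hs)
  have hval : φ (-(ε * z.arg)) z = ((‖z‖ * Real.exp R : ℝ) : ℂ) := by
    rw [hR]
    conv_lhs => rw [← Complex.norm_mul_exp_arg_mul_I z]
    rw [mul_assoc, ← Complex.exp_add]
    push_cast
    rw [Complex.norm_mul_exp_arg_mul_I]
    congr 2
    have hε2' : (ε : ℂ) * ε = 1 := by exact_mod_cast hε2
    linear_combination -(z.arg : ℂ) * Complex.I * hε2'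
  have hx0 : 0 < ‖z‖ * Real.exp R := mul_pos (hr0.trans hz) (Real.exp_pos R)
  have hnorm : ‖φ (-(ε * z.arg)) z‖ = ‖z‖ * Real.exp R := by
    rw [hval, Complex.norm_real, Real.norm_of_nonneg hx0.le]
  refine ⟨_, ht, _, ?_, hx0, ?_, hval⟩
  · rw [← hnorm]; exact (le_max_left _ _).trans_lt (hrz _ ht)
  · rw [← hnorm]; exact h.norm_apply_lt_one hz1 _

/-- Every orbit in the punctured open disc meets the positive real axis close to `1`. -/
theorem exists_apply_eq_ofReal' (h : IsSpiralFlow ε X φ) {z : ℂ} (hz : ‖z‖ < 1) (hz0 : z ≠ 0)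
    {ρ : ℝ} (hρ : ρ < 1) : ∃ t, ∃ x : ℝ, ρ < x ∧ 0 < x ∧ x < 1 ∧ φ t z = x := by
  obtain ⟨r, hr, hrz⟩ := h.exists_apply_eq_ofReal hρ
  obtain ⟨s, hs⟩ := h.exists_lt_norm hz0 hr
  obtain ⟨t, -, x, h1, h0, h2, h3⟩ := hrz _ hs (h.norm_apply_lt_one hz s)
  exact ⟨t + s, x, h1, h0, h2, by rw [φ.map_add, h3]⟩

end IsSpiralFlow

/-! ### The return map and the orbit space -/

/-- The segment `[x₀, 1)` of the positive real axis is a return segment: for time `2π` in both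
directions its points stay in the collar `r < ‖z‖`, where the angle changes at the constant speed
`ε`, so that the time `2π` map of `φ` is the return map to the positive real axis; and this map
moves the points of the segment towards `1`. -/
structure IsReturnSegment (X : ℂ → ℂ) (φ : Flow ℝ ℂ) (ε r x₀ : ℝ) : Prop where
  collar : ∀ z, r < ‖z‖ → ‖z‖ ≤ 1 → (X z / z).im = ε
  pos : 0 < x₀
  lt_one : x₀ < 1
  near : ∀ x : ℝ, x₀ ≤ x → x < 1 → ∀ s, |s| ≤ 2 * Real.pi → r < ‖φ s x‖
  lt_norm : ∀ x : ℝ, x₀ ≤ x → x < 1 → x < ‖φ (2 * Real.pi) x‖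

namespace IsSpiralFlow

variable {ε : ℝ} {X : ℂ → ℂ} {φ : Flow ℝ ℂ}

theorem exp_sign_mul_two_pi (h : IsSpiralFlow ε X φ) (R : ℝ) (n : ℕ) :
    Complex.exp (R + ε * (2 * Real.pi * n : ℝ) * Complex.I) = Real.exp R := by
  rw [Complex.exp_add, Complex.ofReal_exp]
  have : Complex.exp (ε * (2 * Real.pi * n : ℝ) * Complex.I) = 1 := by
    rw [Complex.exp_eq_one_iff]
    rcases h.sign with h | h
    · exact ⟨n, by rw [h]; push_cast; ring⟩
    · exact ⟨-n, by rw [h]; push_cast; ring⟩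
  rw [this, mul_one]

/-- Either the flow or its reverse admits a return segment: the displacement of the time `2π` map
on a segment close to `1` does not vanish, so that it has a constant sign. -/
theorem exists_isReturnSegment (h : IsSpiralFlow ε X φ) :
    (∃ r x₀, IsReturnSegment X φ ε r x₀) ∨ ∃ r x₀, IsReturnSegment (-X) φ.reverse (-ε) r x₀ := by
  obtain ⟨r, hr, hcol⟩ := h.collar
  obtain ⟨r₀, hr₀, hrr₀, hr₀0, hφ⟩ := h.exists_lt_norm_apply hr (2 * Real.pi)
  have hpi := Real.pi_pos
  have hreal : ∀ x ∈ Ioo r₀ 1, φ (2 * Real.pi) x = (‖φ (2 * Real.pi) x‖ : ℝ) := by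
    intro x hx
    have hx0 : 0 < x := hr₀0.trans hx.1
    have hnx : ‖(x : ℂ)‖ = x := by rw [Complex.norm_real, Real.norm_of_nonneg hx0.le]
    obtain ⟨R, hR⟩ := h.apply_eq_of_mem_collar' hcol (z := x) (t := 2 * Real.pi)
      (T := 2 * Real.pi) (by rw [hnx]; exact hx.2) (by exact_mod_cast hx0.ne')
      (by rw [abs_of_pos (by positivity)])
      (fun s hs => hφ x (by rw [hnx]; exact hx.1) (by rw [hnx]; exact hx.2.le) s hs)
    have := h.exp_sign_mul_two_pi R 1
    rw [Nat.cast_one, mul_one] at this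
    rw [this] at hR
    rw [hR, norm_mul, hnx, Complex.norm_real, Real.norm_of_nonneg (Real.exp_pos R).le]
    push_cast; rfl
  -- a fixed point of the return map would be periodic
  have hne : ∀ x ∈ Ioo r₀ 1, ‖φ (2 * Real.pi) x‖ - x ≠ 0 := by
    intro x hx heq
    have hx0 : 0 < x := hr₀0.trans hx.1
    have hnx : ‖(x : ℂ)‖ = x := by rw [Complex.norm_real, Real.norm_of_nonneg hx0.le]
    refine h.not_periodic x (by rw [hnx]; exact hx.2) (by exact_mod_cast hx0.ne') (2 * Real.pi)
      (by positivity) ?_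
    rw [hreal x hx, sub_eq_zero.1 heq]
  have hcont : ContinuousOn (fun x : ℝ => ‖φ (2 * Real.pi) x‖ - x) (Ioo r₀ 1) :=
    ((φ.continuous continuous_const Complex.continuous_ofReal).norm.sub
      continuous_id).continuousOn
  have hsign : (∀ x ∈ Ioo r₀ 1, 0 < ‖φ (2 * Real.pi) x‖ - x) ∨
      ∀ x ∈ Ioo r₀ 1, ‖φ (2 * Real.pi) x‖ - x < 0 := by
    by_contra! hc
    obtain ⟨⟨a, ha, ha'⟩, b, hb, hb'⟩ := hc
    obtain ⟨c, hc, hc'⟩ := isPreconnected_Ioo.intermediate_value ha hb hcont ⟨ha', hb'⟩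
    exact hne c hc hc'
  rcases hsign with hs | hs
  · left
    refine ⟨r, (r₀ + 1) / 2, hcol, by linarith, by linarith, fun x hx hx1 => ?_,
      fun x hx hx1 => sub_pos.1 (hs x ⟨by linarith, hx1⟩)⟩
    have hnx : ‖(x : ℂ)‖ = x := by rw [Complex.norm_real, Real.norm_of_nonneg (by linarith)]
    exact hφ x (by rw [hnx]; linarith) (by rw [hnx]; exact hx1.le)
  · right
    -- for the reversed flow the inverse of the return map has to be compared with the identity
    obtain ⟨r₂, hr₂, hrr₂, hr₂0, hφ₂⟩ := h.exists_lt_norm_apply hr₀ (2 * Real.pi)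
    have hnorm : ∀ x : ℝ, (r₂ + 1) / 2 ≤ x → ‖(x : ℂ)‖ = x := fun x hx => by
      rw [Complex.norm_real, Real.norm_of_nonneg (by linarith)]
    have hpos : |(-(2 * Real.pi))| ≤ 2 * Real.pi := by
      rw [abs_neg, abs_of_pos (by positivity)]
    have hnear : ∀ x : ℝ, (r₂ + 1) / 2 ≤ x → x < 1 → ∀ s, |s| ≤ 2 * Real.pi → r < ‖φ s x‖ :=
      fun x hx hx1 => hφ x (by rw [hnorm x hx]; linarith) (by rw [hnorm x hx]; exact hx1.le)
    refine ⟨r, (r₂ + 1) / 2, fun z h1 h2 => by simp [neg_div, hcol z h1 h2], by linarith,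
      by linarith, fun x hx hx1 s hs => hnear x hx hx1 (-s) (by rwa [abs_neg]),
      fun x hx hx1 => ?_⟩
    have hx0 : 0 < x := by linarith
    rw [Flow.reverse_apply]
    obtain ⟨R, hR⟩ := h.reverse.apply_eq_of_mem_collar' (r := r) (z := x) (t := 2 * Real.pi)
      (T := 2 * Real.pi) (fun z h1 h2 => by simp [neg_div, hcol z h1 h2])
      (by rw [hnorm x hx]; exact hx1) (by exact_mod_cast hx0.ne')
      (by rw [abs_of_pos (by positivity)])
      (fun s hs => hnear x hx hx1 (-s) (by rwa [abs_neg]))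
    have := h.reverse.exp_sign_mul_two_pi R 1
    rw [Nat.cast_one, mul_one] at this
    rw [this, Flow.reverse_apply, ← Complex.ofReal_mul] at hR
    have hy0 : 0 < x * Real.exp R := mul_pos hx0 (Real.exp_pos R)
    have hny : ‖φ (-(2 * Real.pi)) x‖ = x * Real.exp R := by
      rw [hR, Complex.norm_real, Real.norm_of_nonneg hy0.le]
    have h1 : r₀ < x * Real.exp R := by
      rw [← hny]
      exact hφ₂ x (by rw [hnorm x hx]; linarith) (by rw [hnorm x hx]; exact hx1.le) _ hpos
    have h2 : x * Real.exp R < 1 := by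
      rw [← hny]
      exact h.norm_apply_lt_one (by rw [hnorm x hx]; exact hx1) _
    have h3 := hs _ ⟨h1, h2⟩
    rw [← hR, ← φ.map_add] at h3
    simp only [add_neg_cancel, φ.map_zero_apply, hnorm x hx] at h3
    rw [hny]; linarith

end IsSpiralFlow

namespace IsReturnSegment

variable {ε r x₀ : ℝ} {X : ℂ → ℂ} {φ : Flow ℝ ℂ}

theorem norm_ofReal (d : IsReturnSegment X φ ε r x₀) {x : ℝ} (hx : x₀ ≤ x) : ‖(x : ℂ)‖ = x := by
  rw [Complex.norm_real, Real.norm_of_nonneg (d.pos.le.trans hx)]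

theorem norm_apply_lt_one (d : IsReturnSegment X φ ε r x₀) (h : IsSpiralFlow ε X φ) {x : ℝ}
    (hx : x₀ ≤ x) (hx1 : x < 1) (t : ℝ) : ‖φ t x‖ < 1 :=
  h.norm_apply_lt_one (by rw [d.norm_ofReal hx]; exact hx1) t

theorem ne_zero (d : IsReturnSegment X φ ε r x₀) {x : ℝ} (hx : x₀ ≤ x) : (x : ℂ) ≠ 0 := by
  exact_mod_cast (d.pos.trans_le hx).ne'

theorem apply_two_pi (d : IsReturnSegment X φ ε r x₀) (h : IsSpiralFlow ε X φ) {x : ℝ}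
    (hx : x₀ ≤ x) (hx1 : x < 1) : φ (2 * Real.pi) x = (‖φ (2 * Real.pi) x‖ : ℝ) := by
  have hpi := Real.pi_pos
  obtain ⟨R, hR⟩ := h.apply_eq_of_mem_collar' d.collar (z := x) (t := 2 * Real.pi)
    (T := 2 * Real.pi) (by rw [d.norm_ofReal hx]; exact hx1) (d.ne_zero hx)
    (by rw [abs_of_pos (by positivity)]) (d.near x hx hx1)
  have := h.exp_sign_mul_two_pi R 1
  rw [Nat.cast_one, mul_one] at this
  rw [this] at hR
  rw [hR, norm_mul, d.norm_ofReal hx, Complex.norm_real, Real.norm_of_nonneg (Real.exp_pos R).le]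
  push_cast; rfl

theorem apply_two_pi_mul (d : IsReturnSegment X φ ε r x₀) (h : IsSpiralFlow ε X φ) {x : ℝ}
    (hx : x₀ ≤ x) (hx1 : x < 1) (n : ℕ) :
    x ≤ ‖φ (2 * Real.pi * n) x‖ ∧ φ (2 * Real.pi * n) x = (‖φ (2 * Real.pi * n) x‖ : ℝ) := by
  induction n with
  | zero => simp [abs_of_pos (d.pos.trans_le hx)]
  | succ n ih =>
    have h1 := d.norm_apply_lt_one h hx hx1 (2 * Real.pi * n)
    have e : φ (2 * Real.pi * (n + 1 : ℕ)) x = φ (2 * Real.pi) (‖φ (2 * Real.pi * n) x‖ : ℝ) := by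
      rw [← ih.2, ← φ.map_add]; congr 1; push_cast; ring
    rw [e]
    exact ⟨ih.1.trans (d.lt_norm _ (hx.trans ih.1) h1).le,
      d.apply_two_pi h (hx.trans ih.1) h1⟩

theorem apply_succ (d : IsReturnSegment X φ ε r x₀) (h : IsSpiralFlow ε X φ) {x : ℝ}
    (hx : x₀ ≤ x) (hx1 : x < 1) (n : ℕ) :
    φ (2 * Real.pi * (n + 1 : ℕ)) x = φ (2 * Real.pi) (‖φ (2 * Real.pi * n) x‖ : ℝ) := by
  rw [← (d.apply_two_pi_mul h hx hx1 n).2, ← φ.map_add]; congr 1; push_cast; ring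

/-- The forward orbits of the points of the segment stay in the collar. -/
theorem lt_norm_apply (d : IsReturnSegment X φ ε r x₀) (h : IsSpiralFlow ε X φ) {x : ℝ}
    (hx : x₀ ≤ x) (hx1 : x < 1) {t : ℝ} (ht : 0 ≤ t) : r < ‖φ t x‖ := by
  have hpi : 0 < 2 * Real.pi := by positivity
  set n := ⌊t / (2 * Real.pi)⌋₊ with hn
  have h1 : n ≤ t / (2 * Real.pi) := Nat.floor_le (by positivity)
  have h2 : t / (2 * Real.pi) < n + 1 := Nat.lt_floor_add_one _
  rw [le_div_iff₀ hpi] at h1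
  rw [div_lt_iff₀ hpi] at h2
  obtain ⟨h3, h4⟩ := d.apply_two_pi_mul h hx hx1 n
  have e : φ t x = φ (t - 2 * Real.pi * n) (‖φ (2 * Real.pi * n) x‖ : ℝ) := by
    rw [← h4, ← φ.map_add]; congr 1; ring
  rw [e]
  refine d.near _ (hx.trans h3) (d.norm_apply_lt_one h hx hx1 _) _ ?_
  rw [abs_of_nonneg (by linarith)]
  linarith

/-- The forward orbits of the points of the segment return to the positive real axis only at the
multiples of `2π`. -/
theorem exists_eq_two_pi_mul (d : IsReturnSegment X φ ε r x₀) (h : IsSpiralFlow ε X φ) {x : ℝ}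
    (hx : x₀ ≤ x) (hx1 : x < 1) {t : ℝ} (ht : 0 ≤ t) {y : ℝ} (hy : 0 < y) (hxy : φ t x = y) :
    ∃ n : ℕ, t = 2 * Real.pi * n := by
  have hpi : 0 < 2 * Real.pi := by positivity
  obtain ⟨R, hR⟩ := h.apply_eq_of_mem_collar d.collar (by rw [d.norm_ofReal hx]; exact hx1.le)
    (d.ne_zero hx) ht fun s hs => d.lt_norm_apply h hx hx1 hs.1
  rw [hxy, Complex.exp_add, ← mul_assoc, ← Complex.ofReal_exp, ← Complex.ofReal_mul] at hR
  have hx0 : 0 < x * Real.exp R := mul_pos (d.pos.trans_le hx) (Real.exp_pos R)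
  have hn := congrArg norm hR
  rw [norm_mul, Complex.norm_real, Complex.norm_real, ← Complex.ofReal_mul,
    Complex.norm_exp_ofReal_mul_I, Real.norm_of_nonneg hy.le, Real.norm_of_nonneg hx0.le,
    mul_one] at hn
  rw [hn] at hR
  have hE : Complex.exp (ε * t * Complex.I) = 1 :=
    (mul_left_cancel₀ (Complex.ofReal_ne_zero.2 hx0.ne') (by rw [mul_one]; exact hR)).symm
  obtain ⟨k, hk⟩ := Complex.exp_eq_one_iff.1 hE
  have hk' : ε * t = k * (2 * Real.pi) := by
    have := congrArg Complex.im hk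
    simpa using this
  have : ∃ k : ℤ, t = k * (2 * Real.pi) := by
    rcases h.sign with he | he
    · exact ⟨k, by rw [← hk', he, one_mul]⟩
    · exact ⟨-k, by push_cast; rw [neg_mul, ← hk', he]; ring⟩
  obtain ⟨k, hk⟩ := this
  have hk0 : 0 ≤ k := by
    by_contra! hneg
    have : (k : ℝ) < 0 := by exact_mod_cast hneg
    nlinarith
  lift k to ℕ using hk0
  exact ⟨k, by rw [hk]; push_cast; ring⟩

theorem norm_apply_two_pi_lt (d : IsReturnSegment X φ ε r x₀) (h : IsSpiralFlow ε X φ) {x y : ℝ}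
    (hx : x₀ ≤ x) (hxy : x < y) (hy1 : y < 1) :
    ‖φ (2 * Real.pi) x‖ < ‖φ (2 * Real.pi) y‖ := by
  by_contra! hc
  have hPx := d.norm_apply_lt_one h hx (hxy.trans hy1) (2 * Real.pi)
  obtain ⟨z, hz, hz1⟩ := exists_between (max_lt hy1 hPx)
  rw [max_lt_iff] at hz
  have hcont : Continuous fun x : ℝ => ‖φ (2 * Real.pi) x‖ :=
    (φ.continuous continuous_const Complex.continuous_ofReal).norm
  obtain ⟨w, hw, hw'⟩ := intermediate_value_Icc hz.1.le hcont.continuousOn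
    ⟨hc, hz.2.le.trans (d.lt_norm z (by linarith) hz1).le⟩
  have e : φ (2 * Real.pi) w = φ (2 * Real.pi) x := by
    rw [d.apply_two_pi h (by linarith [hw.1]) (hw.2.trans_lt hz1),
      d.apply_two_pi h hx (hxy.trans hy1)]
    exact congrArg _ hw'
  have e2 := congrArg (φ (-(2 * Real.pi))) e
  rw [Flow.neg_apply_apply, Flow.neg_apply_apply] at e2
  have : w = x := by exact_mod_cast e2
  linarith [hw.1]

theorem norm_apply_le (d : IsReturnSegment X φ ε r x₀) (h : IsSpiralFlow ε X φ) {x y : ℝ}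
    (hx : x₀ ≤ x) (hxy : x ≤ y) (hy1 : y < 1) (n : ℕ) :
    ‖φ (2 * Real.pi * n) x‖ ≤ ‖φ (2 * Real.pi * n) y‖ := by
  have hx1 := hxy.trans_lt hy1
  induction n with
  | zero =>
    simpa [abs_of_pos (d.pos.trans_le hx), abs_of_pos (d.pos.trans_le (hx.trans hxy))] using hxy
  | succ n ih =>
    rw [d.apply_succ h hx hx1, d.apply_succ h (hx.trans hxy) hy1]
    rcases ih.lt_or_eq with hlt | heq
    · exact (d.norm_apply_two_pi_lt h (hx.trans (d.apply_two_pi_mul h hx hx1 n).1) hlt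
        (d.norm_apply_lt_one h (hx.trans hxy) hy1 _)).le
    · rw [heq]

/-- Iterating the return map moves every point of the segment to `1`. -/
theorem tendsto_norm_apply (d : IsReturnSegment X φ ε r x₀) (h : IsSpiralFlow ε X φ) {x : ℝ}
    (hx : x₀ ≤ x) (hx1 : x < 1) :
    Tendsto (fun n : ℕ => ‖φ (2 * Real.pi * n) x‖) atTop (𝓝 1) := by
  set a : ℕ → ℝ := fun n => ‖φ (2 * Real.pi * n) x‖ with ha
  have hax : ∀ n, x ≤ a n := fun n => (d.apply_two_pi_mul h hx hx1 n).1
  have ha1 : ∀ n, a n < 1 := fun n => d.norm_apply_lt_one h hx hx1 _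
  have hsucc : ∀ n, a (n + 1) = ‖φ (2 * Real.pi) (a n : ℝ)‖ := fun n => by
    simp only [ha]; rw [d.apply_succ h hx hx1]
  have hmono : Monotone a := monotone_nat_of_le_succ fun n => by
    rw [hsucc]; exact (d.lt_norm _ (hx.trans (hax n)) (ha1 n)).le
  have hbdd : BddAbove (range a) := ⟨1, by rintro _ ⟨n, rfl⟩; exact (ha1 n).le⟩
  have hlim := tendsto_atTop_ciSup hmono hbdd
  set l := ⨆ n, a n
  have hl1 : l ≤ 1 := ciSup_le fun n => (ha1 n).le
  have hxl : x ≤ l := (hax 0).trans (le_ciSup hbdd 0)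
  rcases hl1.lt_or_eq with hlt | heq
  · exfalso
    have hcont : Continuous fun x : ℝ => ‖φ (2 * Real.pi) x‖ :=
      (φ.continuous continuous_const Complex.continuous_ofReal).norm
    have h1 := (hcont.tendsto l).comp hlim
    have h2 := hlim.comp (tendsto_add_atTop_nat 1)
    have h3 : l = ‖φ (2 * Real.pi) (l : ℝ)‖ :=
      tendsto_nhds_unique h2 (h1.congr fun n => (hsucc n).symm)
    exact (d.lt_norm l (hx.trans hxl) hlt).ne h3
  · rwa [heq] at hlim

end IsReturnSegment

theorem Circle.exists_mem_Ico_exp_eq (c : Circle) :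
    ∃ u ∈ Ico 0 (2 * Real.pi), Circle.exp u = c := by
  rcases lt_or_ge (Complex.arg c) 0 with h | h
  · exact ⟨Complex.arg c + 2 * Real.pi, ⟨by linarith [Complex.neg_pi_lt_arg (c : ℂ), Real.pi_pos],
      by linarith⟩, by rw [Circle.exp_add_two_pi, Circle.exp_arg]⟩
  · exact ⟨Complex.arg c, ⟨h, by linarith [Complex.arg_le_pi (c : ℂ), Real.pi_pos]⟩,
      Circle.exp_arg c⟩

/-- A closed path on `[0, 2π]` is a continuous function on the circle. -/
theorem exists_continuous_circle {Y : Type*} [TopologicalSpace Y] {g : ℝ → Y}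
    (hg : ContinuousOn g (Icc 0 (2 * Real.pi))) (h : g 0 = g (2 * Real.pi)) :
    ∃ C : Circle → Y, Continuous C ∧ ∀ u ∈ Ico 0 (2 * Real.pi), C (Circle.exp u) = g u := by
  have : Fact (0 < 2 * Real.pi) := ⟨Real.two_pi_pos⟩
  refine ⟨AddCircle.liftIco (2 * Real.pi) 0 g ∘ AddCircle.homeomorphCircle'.symm,
    (AddCircle.liftIco_continuous (by simpa using h) (by simpa using hg)).comp
      AddCircle.homeomorphCircle'.symm.continuous, fun u hu => ?_⟩
  have : AddCircle.homeomorphCircle'.symm (Circle.exp u) = (u : AddCircle (2 * Real.pi)) := by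
    rw [Homeomorph.symm_apply_eq]
    rfl
  rw [Function.comp_apply, this, AddCircle.liftIco_coe_apply (by simpa using hu)]

namespace IsReturnSegment

variable {ε r x₀ : ℝ} {X : ℂ → ℂ} {φ : Flow ℝ ℂ}

/-- A closed curve that meets every orbit in the punctured open disc exactly once: it follows an
orbit for one turn and closes up along the return segment. -/
theorem exists_section (d : IsReturnSegment X φ ε r x₀) (h : IsSpiralFlow ε X φ) :
    ∃ C : Circle → ℂ, Continuous C ∧ (∀ c, ‖C c‖ < 1 ∧ C c ≠ 0) ∧
      (∀ z, ‖z‖ < 1 → z ≠ 0 → ∃ c t, φ t (C c) = z) ∧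
      (∀ c c' t t', φ t (C c) = φ t' (C c') → c = c' ∧ t = t') ∧
      (∀ ρ < 1, ∃ T, ∀ c, ∀ t ≥ T, ρ < ‖φ t (C c)‖) ∧
      ∃ ρ < 1, ∀ c, ∀ t ≤ 0, ‖φ t (C c)‖ ≤ ρ := by
  have hpi : 0 < 2 * Real.pi := by positivity
  set x₁ : ℝ := ‖φ (2 * Real.pi) x₀‖ with hx₁
  have h01 : x₀ < x₁ := d.lt_norm x₀ le_rfl d.lt_one
  have hx₁1 : x₁ < 1 := d.norm_apply_lt_one h le_rfl d.lt_one _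
  set x₂ : ℝ := ‖φ (2 * Real.pi) x₁‖ with hx₂
  have h12 : x₁ < x₂ := d.lt_norm x₁ h01.le hx₁1
  have hx₂1 : x₂ < 1 := d.norm_apply_lt_one h h01.le hx₁1 _
  -- The segment `(x₀, x₁]` is a fundamental domain of the return map. The curve starts at `x₁` and
  -- goes to `φ (2π) x₀ = x₁`: at the angle `u` it is at `φ u (s u)`.
  let s : ℝ → ℝ := fun u => x₁ - u / (2 * Real.pi) * (x₁ - x₀)
  have hs : ∀ u ∈ Ico 0 (2 * Real.pi), s u ∈ Ioc x₀ x₁ := by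
    intro u hu
    have h1 : 0 ≤ u / (2 * Real.pi) := div_nonneg hu.1 hpi.le
    have h2 : u / (2 * Real.pi) < 1 := (div_lt_one hpi).2 hu.2
    constructor
    · simp only [s]; nlinarith
    · simp only [s]; nlinarith
  have hs' : ∀ u v, s u = s v → u = v := by
    intro u v huv
    simp only [s] at huv
    have h1 : u / (2 * Real.pi) = v / (2 * Real.pi) :=
      mul_right_cancel₀ (sub_pos.2 h01).ne' (by linarith)
    exact (div_left_inj' hpi.ne').1 h1
  have hs1 : ∀ u ∈ Ico 0 (2 * Real.pi), s u < 1 := fun u hu => (hs u hu).2.trans_lt hx₁1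
  obtain ⟨C, hCc, hC⟩ := exists_continuous_circle (g := fun u => φ u (s u))
    (φ.continuous continuous_id (Complex.continuous_ofReal.comp (by fun_prop))).continuousOn
    (by
      have e0 : s 0 = x₁ := by simp [s]
      have e1 : s (2 * Real.pi) = x₀ := by simp [s]
      rw [e0, e1, φ.map_zero_apply, hx₁]
      exact (d.apply_two_pi h le_rfl d.lt_one).symm)
  -- two points of the fundamental segment on one orbit agree
  have hinj : ∀ x ∈ Ioc x₀ x₁, ∀ y ∈ Ioc x₀ x₁, ∀ t, 0 ≤ t → φ t x = y → t = 0 := by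
    intro x hx y hy t ht hxy
    have hx1 := hx.2.trans_lt hx₁1
    obtain ⟨n, rfl⟩ := d.exists_eq_two_pi_mul h hx.1.le hx1 ht (d.pos.trans hy.1) hxy
    cases n with
    | zero => simp
    | succ n =>
      exfalso
      have h1 := d.apply_two_pi_mul h hx.1.le hx1 n
      have h2 := d.norm_apply_two_pi_lt h le_rfl (hx.1.trans_le h1.1)
        (d.norm_apply_lt_one h hx.1.le hx1 _)
      rw [← d.apply_succ h hx.1.le hx1, hxy, d.norm_ofReal hy.1.le] at h2
      exact (hy.2.trans_lt h2).false
  -- every point of the return segment is an iterate of a point of the fundamental segment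
  have hsurj : ∀ x : ℝ, x₀ < x → x < 1 → ∃ y ∈ Ioc x₀ x₁, ∃ t, φ t y = x := by
    intro x hx hx1
    have hlim := d.tendsto_norm_apply h le_rfl d.lt_one
    obtain ⟨n, hn, hmin⟩ : ∃ n : ℕ, x ≤ ‖φ (2 * Real.pi * n) x₀‖ ∧
        ∀ m < n, ‖φ (2 * Real.pi * m) x₀‖ < x := by
      classical
      have hex : ∃ n : ℕ, x ≤ ‖φ (2 * Real.pi * n) x₀‖ :=
        ((hlim.eventually (lt_mem_nhds hx1)).mono fun n hn => hn.le).exists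
      exact ⟨Nat.find hex, Nat.find_spec hex, fun m hm => not_le.1 (Nat.find_min hex hm)⟩
    cases n with
    | zero =>
      simp only [Nat.cast_zero, mul_zero, φ.map_zero_apply] at hn
      rw [d.norm_ofReal le_rfl] at hn
      exact absurd hn (not_le.2 hx)
    | succ n =>
      have hlo := hmin n n.lt_succ_self
      have hhi : ‖φ (2 * Real.pi * n) (x₁ : ℝ)‖ = ‖φ (2 * Real.pi * (n + 1 : ℕ)) x₀‖ := by
        rw [hx₁, ← d.apply_two_pi h le_rfl d.lt_one, ← φ.map_add]
        congr 2; push_cast; ring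
      have hcont : Continuous fun x : ℝ => ‖φ (2 * Real.pi * n) x‖ :=
        (φ.continuous continuous_const Complex.continuous_ofReal).norm
      obtain ⟨y, hy, hyx⟩ := intermediate_value_Icc h01.le hcont.continuousOn
        ⟨hlo.le, by rw [hhi]; exact hn⟩
      refine ⟨y, ⟨lt_of_le_of_ne hy.1 ?_, hy.2⟩, 2 * Real.pi * n, ?_⟩
      · rintro rfl
        exact hlo.ne hyx
      · rw [(d.apply_two_pi_mul h hy.1 (hy.2.trans_lt hx₁1) n).2]
        exact congrArg _ hyx
  have hCn : ∀ c, ∃ u ∈ Ico 0 (2 * Real.pi), c = Circle.exp u ∧ C c = φ u (s u) := by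
    intro c
    obtain ⟨u, hu, rfl⟩ := c.exists_mem_Ico_exp_eq
    exact ⟨u, hu, rfl, hC u hu⟩
  refine ⟨C, hCc, fun c => ?_, fun z hz hz0 => ?_, fun c c' t t' htt => ?_, fun ρ hρ => ?_, ?_⟩
  · obtain ⟨u, hu, -, e⟩ := hCn c
    rw [e]
    exact ⟨d.norm_apply_lt_one h (hs u hu).1.le (hs1 u hu) u,
      fun h0 => d.ne_zero (hs u hu).1.le (h.apply_eq_zero.1 h0)⟩
  · obtain ⟨t, x, hx, -, hx1, htx⟩ := h.exists_apply_eq_ofReal' hz hz0 d.lt_one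
    obtain ⟨y, hy, t', hyt⟩ := hsurj x hx hx1
    obtain ⟨u, hu, hsu⟩ : ∃ u ∈ Ico 0 (2 * Real.pi), s u = y := by
      have h1 : 0 < x₁ - x₀ := sub_pos.2 h01
      have h2 : (x₁ - y) / (x₁ - x₀) < 1 := (div_lt_one h1).2 (by linarith [hy.1])
      have h3 : 0 ≤ (x₁ - y) / (x₁ - x₀) := div_nonneg (by linarith [hy.2]) h1.le
      refine ⟨(x₁ - y) / (x₁ - x₀) * (2 * Real.pi), ⟨by positivity, by nlinarith⟩, ?_⟩
      have h4 := h1.ne'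
      simp only [s]; field_simp; ring
    refine ⟨Circle.exp u, -t + (t' - u), ?_⟩
    rw [hC _ hu, hsu, ← φ.map_add, add_assoc, sub_add_cancel, φ.map_add, hyt, ← htx,
      Flow.neg_apply_apply]
  · obtain ⟨u, hu, e, e1⟩ := hCn c
    obtain ⟨u', hu', e', e1'⟩ := hCn c'
    rw [e1, e1', ← φ.map_add, ← φ.map_add] at htt
    have key : t + u = t' + u' := by
      rcases le_total (t + u) (t' + u') with hle | hle
      · have h1 := congrArg (φ (-(t + u))) htt
        rw [Flow.neg_apply_apply, ← φ.map_add] at h1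
        linarith [hinj _ (hs u' hu') _ (hs u hu) (-(t + u) + (t' + u')) (by linarith) h1.symm]
      · have h1 := congrArg (φ (-(t' + u'))) htt
        rw [Flow.neg_apply_apply, ← φ.map_add] at h1
        linarith [hinj _ (hs u hu) _ (hs u' hu') (-(t' + u') + (t + u)) (by linarith) h1]
    rw [key] at htt
    have h1 := congrArg (φ (-(t' + u'))) htt
    rw [Flow.neg_apply_apply, Flow.neg_apply_apply] at h1
    have huu : u = u' := hs' u u' (by exact_mod_cast h1)
    exact ⟨by rw [e, e', huu], by linarith⟩
  · obtain ⟨r', hr', -, -, hr'φ⟩ := h.exists_lt_norm_apply hρ (2 * Real.pi)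
    have hlim := d.tendsto_norm_apply h le_rfl d.lt_one
    obtain ⟨n₀, hn₀⟩ := eventually_atTop.1 (hlim.eventually (lt_mem_nhds hr'))
    refine ⟨2 * Real.pi * n₀, fun c t ht => ?_⟩
    obtain ⟨u, hu, -, e⟩ := hCn c
    -- `n` is the number of complete turns made by the time `t + u`
    set n := ⌊(t + u) / (2 * Real.pi)⌋₊ with hn
    have hn1 : n ≤ (t + u) / (2 * Real.pi) :=
      Nat.floor_le (div_nonneg (add_nonneg (le_trans (by positivity) ht) hu.1) hpi.le)
    have hn2 : (t + u) / (2 * Real.pi) < n + 1 := Nat.lt_floor_add_one _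
    have hn3 : n₀ ≤ n := Nat.le_floor (by rw [le_div_iff₀ hpi]; linarith [hu.1])
    rw [le_div_iff₀ hpi] at hn1
    rw [div_lt_iff₀ hpi] at hn2
    have e2 : φ t (C c) = φ (t + u - 2 * Real.pi * n) (φ (2 * Real.pi * n) (s u)) := by
      rw [e, ← φ.map_add, ← φ.map_add]; congr 1; ring
    rw [e2]
    refine hr'φ _ ?_ (d.norm_apply_lt_one h (hs u hu).1.le (hs1 u hu) _).le _ ?_
    · exact (hn₀ n hn3).trans_le (d.norm_apply_le h le_rfl (hs u hu).1.le (hs1 u hu) n)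
    · rw [abs_of_nonneg (by linarith)]; linarith
  -- if a backward orbit comes too close to the circle, it reaches the positive real axis beyond
  -- `x₂`; but it takes `(x₀, x₁]` at least two turns to get there, and only forward in time
  · obtain ⟨ρ, hρ, hρφ⟩ := h.exists_apply_eq_ofReal hx₂1
    refine ⟨ρ, hρ, fun c t ht => ?_⟩
    by_contra! hlt
    obtain ⟨u, hu, -, e⟩ := hCn c
    have hsu := hs u hu
    obtain ⟨t', ht', x, hx, hx0, hx1, hxt⟩ := hρφ _ hlt
      (by rw [e, ← φ.map_add]; exact d.norm_apply_lt_one h hsu.1.le (hs1 u hu) _)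
    rw [e, ← φ.map_add, ← φ.map_add] at hxt
    rcases le_total 0 (t' + t + u) with h0 | h0
    · obtain ⟨n, hn⟩ := d.exists_eq_two_pi_mul h hsu.1.le (hs1 u hu) h0 hx0 hxt
      have hn2 : n < 2 := by
        by_contra! hge
        have : (2 : ℝ) ≤ n := by exact_mod_cast hge
        have h3 := (abs_le.1 ht').2
        nlinarith [hu.2, Real.pi_pos]
      have hle := d.norm_apply_le h hsu.1.le hsu.2 hx₁1 n
      rw [show φ (2 * Real.pi * n) (s u : ℝ) = x by rw [← hn, hxt], d.norm_ofReal (by linarith)] at hle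
      interval_cases n
      · simp only [Nat.cast_zero, mul_zero, φ.map_zero_apply] at hle
        rw [d.norm_ofReal h01.le] at hle
        linarith
      · rw [Nat.cast_one, mul_one, ← hx₂] at hle
        linarith
    · have h1 : φ (-(t' + t + u)) x = (s u : ℝ) := by
        rw [← hxt, Flow.neg_apply_apply]
      obtain ⟨n, hn⟩ := d.exists_eq_two_pi_mul h (by linarith) hx1 (by linarith)
        (d.pos.trans hsu.1) h1
      have hle := (d.apply_two_pi_mul h (x := x) (by linarith) hx1 n).1
      rw [← hn, h1, d.norm_ofReal hsu.1.le] at hle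
      linarith [hsu.2]

end IsReturnSegment

/-- Backward orbits that stay away from the unit circle converge to `0`, uniformly on compact sets
of initial points: by Poincaré–Bendixson they enter every repelling region of `0`, and then they
stay there. -/
theorem IsSpiralFlow.exists_norm_lt {ε : ℝ} {X : ℂ → ℂ} {φ : Flow ℝ ℂ} (h : IsSpiralFlow ε X φ)
    {C : Circle → ℂ}
    (hC : Continuous C) (hC0 : ∀ c, C c ≠ 0) {ρ : ℝ} (hρ : ρ < 1)
    (hCρ : ∀ c, ∀ t ≤ 0, ‖φ t (C c)‖ ≤ ρ) {η : ℝ} (hη : 0 < η) :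
    ∃ T, ∀ c, ∀ t ≤ T, ‖φ t (C c)‖ < η := by
  -- with negative divergence at `0`, backward orbits would approach the circle
  have htr : 0 < (fderiv ℝ X 0 1).re + (fderiv ℝ X 0 Complex.I).im := by
    by_contra! hc
    obtain ⟨t, ht, hlt⟩ := h.reverse.exists_lt_norm_of_trace_pos
      (by
        rw [fderiv_neg]
        have := lt_of_le_of_ne hc h.trace
        simp only [neg_apply, Complex.neg_re, Complex.neg_im]
        linarith) (hC0 1) hρ
    exact (hCρ 1 (-t) (by linarith)).not_gt hlt
  obtain ⟨N, hN, hNη, hrep⟩ := h.exists_isRepellingRegion htr hη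
  have hopen : ∀ T : ℝ, IsOpen {c | φ (-T) (C c) ∈ interior N} := fun T =>
    isOpen_interior.preimage (φ.continuous continuous_const hC)
  -- by Poincaré–Bendixson, a backward orbit cannot avoid the repelling region `N`
  have hcov : (univ : Set Circle) ⊆ ⋃ T : ℝ, {c | φ (-T) (C c) ∈ interior N} := by
    intro c _
    by_contra hc
    simp only [mem_iUnion, mem_ofPred_eq, not_exists] at hc
    refine h.reverse.not_eventually_mem (K := Metric.closedBall 0 ρ \ interior N)
      ((isCompact_closedBall _ _).diff isOpen_interior) ?_ (C c) ?_
    · rintro y ⟨hy1, hy2⟩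
      refine ⟨mem_ball_zero_iff.2 ((mem_closedBall_zero_iff.1 hy1).trans_lt hρ), ?_⟩
      rintro rfl
      exact hy2 (mem_interior_iff_mem_nhds.2 hN)
    · filter_upwards [eventually_ge_atTop 0] with t ht
      exact ⟨mem_closedBall_zero_iff.2 (hCρ c (-t) (by linarith)), hc t⟩
  obtain ⟨S, hS⟩ := isCompact_univ.elim_finite_subcover _ hopen hcov
  obtain ⟨B, hB⟩ := S.exists_le
  refine ⟨-B, fun c t ht => ?_⟩
  obtain ⟨T, hT, hc⟩ := mem_iUnion₂.1 (hS (mem_univ c))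
  have := hrep.backward_invariant h.integrates (interior_subset hc) (t := -t - T)
    (by linarith [hB T hT])
  rw [← φ.map_add, show -(-t - T) + -T = t by ring] at this
  exact mem_ball_zero_iff.1 (hNη this)

namespace IsReturnSegment

variable {ε r x₀ : ℝ} {X : ℂ → ℂ} {φ : Flow ℝ ℂ}

/-- The flow identifies the punctured open disc with the product of a circle of orbits and `ℝ`. -/
theorem exists_homeomorph (d : IsReturnSegment X φ ε r x₀) (h : IsSpiralFlow ε X φ) :
    ∃ (C : Circle → ℂ) (Ψ : Circle × ℝ ≃ₜ (Metric.ball 0 1 \ {0} : Set ℂ)),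
      (∀ c t, (Ψ (c, t) : ℂ) = φ t (C c)) ∧
      (∀ c, Tendsto (fun t => φ t (C c)) atBot (𝓝 0)) ∧
      ∀ c, Tendsto (fun t => ‖φ t (C c)‖) atTop (𝓝 1) := by
  obtain ⟨C, hC, hC1, hsurj, hinj, hfwd, ρ, hρ, hbwd⟩ := d.exists_section h
  have hback : ∀ {η : ℝ}, 0 < η → ∃ T, ∀ c, ∀ t ≤ T, ‖φ t (C c)‖ < η := fun hη =>
    h.exists_norm_lt hC (fun c => (hC1 c).2) hρ hbwd hη
  let f : Circle × ℝ → (Metric.ball 0 1 \ {0} : Set ℂ) := fun p =>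
    ⟨φ p.2 (C p.1), mem_ball_zero_iff.2 (h.norm_apply_lt_one (hC1 p.1).1 _),
      fun h0 => (hC1 p.1).2 (h.apply_eq_zero.1 h0)⟩
  have hf : Continuous f := (φ.continuous continuous_snd (hC.comp continuous_fst)).subtype_mk _
  have hbij : Function.Bijective f := by
    constructor
    · rintro ⟨c, t⟩ ⟨c', t'⟩ hpq
      obtain ⟨h1, h2⟩ := hinj c c' t t' (congrArg Subtype.val hpq)
      rw [h1, h2]
    · rintro ⟨z, hz, hz0⟩
      obtain ⟨c, t, hct⟩ := hsurj z (mem_ball_zero_iff.1 hz) hz0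
      exact ⟨(c, t), Subtype.ext hct⟩
  have : LocallyCompactSpace (Metric.ball 0 1 \ {0} : Set ℂ) :=
    (Metric.isOpen_ball.sdiff isClosed_singleton).locallyCompactSpace
  -- the flow parametrization is proper: the uniform limits confine the time on compact sets
  have hproper : IsProperMap f := by
    refine isProperMap_iff_isCompact_preimage.2 ⟨hf, fun K hK => ?_⟩
    rcases K.eq_empty_or_nonempty with rfl | hne
    · simp
    obtain ⟨a, -, ha⟩ := hK.exists_isMaxOn hne (continuous_subtype_val.norm.continuousOn)
    obtain ⟨b, -, hb⟩ := hK.exists_isMinOn hne (continuous_subtype_val.norm.continuousOn)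
    obtain ⟨T, hT⟩ := hfwd ‖(a : ℂ)‖ (mem_ball_zero_iff.1 a.2.1)
    obtain ⟨T', hT'⟩ := hback (norm_pos_iff.2 b.2.2)
    refine (isCompact_univ.prod (isCompact_Icc (a := T') (b := T))).of_isClosed_subset
      (hK.isClosed.preimage hf) ?_
    rintro ⟨c, t⟩ hct
    refine ⟨mem_univ _, ?_, ?_⟩
    · by_contra! hlt
      exact (hT' c t hlt.le).not_ge (hb hct)
    · by_contra! hlt
      exact (hT c t hlt.le).not_ge (ha hct)
  refine ⟨C, (Equiv.ofBijective f hbij).toHomeomorphOfContinuousClosed hf hproper.isClosedMap,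
    fun c t => rfl, fun c => ?_, fun c => ?_⟩
  · rw [Metric.tendsto_nhds]
    intro η hη
    obtain ⟨T, hT⟩ := hback hη
    filter_upwards [eventually_le_atBot T] with t ht
    rw [dist_zero_right]
    exact hT c t ht
  · refine tendsto_order.2 ⟨fun η hη => ?_, fun η hη => ?_⟩
    · obtain ⟨T, hT⟩ := hfwd η hη
      filter_upwards [eventually_ge_atTop T] with t ht using hT c t ht
    · exact Eventually.of_forall fun t => (h.norm_apply_lt_one (hC1 c).1 t).trans hη

end IsReturnSegment

/-- The orbit space of a spiralling flow on the punctured open disc: up to reversing time, every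
orbit goes from `0` to the unit circle, and the orbits form a circle. -/
theorem IsSpiralFlow.exists_homeomorph {ε : ℝ} {X : ℂ → ℂ} {φ : Flow ℝ ℂ}
    (h : IsSpiralFlow ε X φ) : ∃ ψ : Flow ℝ ℂ, (ψ = φ ∨ ψ = φ.reverse) ∧
    ∃ (C : Circle → ℂ) (Ψ : Circle × ℝ ≃ₜ (Metric.ball 0 1 \ {0} : Set ℂ)),
      (∀ c t, (Ψ (c, t) : ℂ) = ψ t (C c)) ∧
      (∀ c, Tendsto (fun t => ψ t (C c)) atBot (𝓝 0)) ∧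
      ∀ c, Tendsto (fun t => ‖ψ t (C c)‖) atTop (𝓝 1) := by
  rcases h.exists_isReturnSegment with ⟨r, x₀, d⟩ | ⟨r, x₀, d⟩
  · exact ⟨φ, Or.inl rfl, d.exists_homeomorph h⟩
  · exact ⟨φ.reverse, Or.inr rfl, d.exists_homeomorph h.reverse⟩

/-! ### Cutoff functions -/

theorem exists_contDiff_eq_one_nhdsSet {E : Type*} [NormedAddCommGroup E] [NormedSpace ℝ E]
    [FiniteDimensional ℝ E] {K W : Set E} (hK : IsCompact K) (hW : IsOpen W) (hKW : K ⊆ W) :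
    ∃ χ : E → ℝ, ContDiff ℝ ∞ χ ∧ HasCompactSupport χ ∧ tsupport χ ⊆ W ∧
      (∀ᶠ x in 𝓝ˢ K, χ x = 1) ∧ ∀ x, χ x ∈ Icc (0 : ℝ) 1 := by
  have := FiniteDimensional.proper_real E
  obtain ⟨L, hL, hKL, hLW⟩ := exists_compact_between hK hW hKW
  obtain ⟨f, hf1, hf0, hf⟩ := exists_contMDiffMap_one_nhds_of_subset_interior 𝓘(ℝ, E) (n := ⊤)
    hK.isClosed hKL
  have hsub : tsupport f ⊆ L := closure_minimal (fun x hx => by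
    by_contra hxL
    exact hx (hf0 x hxL)) hL.isClosed
  exact ⟨f, f.contMDiff.contDiff, hL.of_isClosed_subset (isClosed_tsupport _) hsub,
    hsub.trans hLW, hf1, hf⟩

theorem contDiff_smul_of_tsupport_subset {E F : Type*} [NormedAddCommGroup E] [NormedSpace ℝ E]
    [NormedAddCommGroup F] [NormedSpace ℝ F] {χ : E → ℝ} {g : E → F} {W : Set E} (hW : IsOpen W)
    {n : WithTop ℕ∞} (hχ : ContDiff ℝ n χ) (hs : tsupport χ ⊆ W) (hg : ContDiffOn ℝ n g W) :
    ContDiff ℝ n fun x => χ x • g x := by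
  rw [← contMDiff_iff_contDiff]
  refine contMDiff_of_tsupport fun x hx => ?_
  have hxW := hs (tsupport_smul_subset_left χ g hx)
  exact (hχ.contDiffAt.smul (hg.contDiffAt (hW.mem_nhds hxW))).contMDiffAt

/-! ### The characteristic foliation of a planar form -/

section PlanarForm

/-- The vector spanning the kernel of a nonzero linear form on the plane: the form rotated by a
quarter turn. -/
noncomputable def kerVector : (ℂ →L[ℝ] ℝ) →L[ℝ] ℂ :=
  (ContinuousLinearMap.apply ℝ ℝ (1 : ℂ)).smulRight Complex.I -
    (ContinuousLinearMap.apply ℝ ℝ Complex.I).smulRight (1 : ℂ)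

theorem kerVector_re (b : ℂ →L[ℝ] ℝ) : (kerVector b).re = -b Complex.I := by
  simp [kerVector]

theorem kerVector_im (b : ℂ →L[ℝ] ℝ) : (kerVector b).im = b 1 := by
  simp [kerVector]

theorem realForm_apply (b : ℂ →L[ℝ] ℝ) (v : ℂ) : b v = v.re * b 1 + v.im * b Complex.I := by
  have : v = v.re • (1 : ℂ) + v.im • Complex.I := by
    simp [Complex.re_add_im]
  conv_lhs => rw [this, map_add, map_smul, map_smul]
  rfl

theorem apply_kerVector (b : ℂ →L[ℝ] ℝ) : b (kerVector b) = 0 := by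
  rw [realForm_apply, kerVector_re, kerVector_im]; ring

theorem kerVector_eq_zero {b : ℂ →L[ℝ] ℝ} : kerVector b = 0 ↔ b = 0 := by
  refine ⟨fun h => ?_, fun h => by rw [h, map_zero]⟩
  ext v
  have h1 := kerVector_re b
  have h2 := kerVector_im b
  rw [h] at h1 h2
  rw [realForm_apply, ← h2, neg_eq_iff_eq_neg.1 h1.symm]
  simp

/-- The kernel of a nonzero linear form on the plane is spanned by any of its nonzero vectors. -/
theorem eq_smul_of_mem_ker {b : ℂ →L[ℝ] ℝ} (hb : b ≠ 0) {u v : ℂ} (hu0 : u ≠ 0) (hu : b u = 0)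
    (hv : b v = 0) : v = ((u.re * v.re + u.im * v.im) / (u.re ^ 2 + u.im ^ 2)) • u := by
  rw [realForm_apply] at hu hv
  have hn : u.re ^ 2 + u.im ^ 2 ≠ 0 := by
    intro h
    apply hu0
    apply Complex.ext
    · simp only [Complex.zero_re]; nlinarith [sq_nonneg u.re, sq_nonneg u.im]
    · simp only [Complex.zero_im]; nlinarith [sq_nonneg u.re, sq_nonneg u.im]
  have hdet : v.re * u.im - v.im * u.re = 0 := by
    by_contra hc
    apply hb
    have h1 : b 1 = 0 := by
      refine (mul_eq_zero.1 (?_ : (v.re * u.im - v.im * u.re) * b 1 = 0)).resolve_left hc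
      linear_combination u.im * hv - v.im * hu
    have h2 : b Complex.I = 0 := by
      refine (mul_eq_zero.1 (?_ : (v.re * u.im - v.im * u.re) * b Complex.I = 0)).resolve_left hc
      linear_combination v.re * hu - u.re * hv
    ext v
    rw [realForm_apply, h1, h2]; simp
  apply Complex.ext
  · rw [Complex.smul_re, smul_eq_mul]
    field_simp
    linear_combination u.im * hdet
  · rw [Complex.smul_im, smul_eq_mul]
    field_simp
    linear_combination -u.re * hdet

variable {β : ℂ → ℂ →L[ℝ] ℝ} {X : ℂ → ℂ} {φ : Flow ℝ ℂ} {D : Set ℂ}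

/-- Orbit segments of a field in the kernel of the form are tangent paths. -/
theorem tangentJoined_of_flow (h : φ.Integrates X) (hX : ContDiff ℝ ∞ X)
    (hker : ∀ z ∈ regularSet (J := 𝓘(ℝ, ℂ)) β D, β z (X z) = 0) {x : ℂ} {T : ℝ}
    (hD : ∀ s ∈ Icc (0 : ℝ) 1, φ (T * s) x ∈ regularSet (J := 𝓘(ℝ, ℂ)) β D) :
    TangentJoined (J := 𝓘(ℝ, ℂ)) β D x (φ T x) := by
  have hsm : ContDiff ℝ ∞ fun s : ℝ => φ (T * s) x :=
    (h.contDiff_orbit hX x).comp (contDiff_const.mul contDiff_id)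
  refine ⟨fun s => φ (T * s) x, ?_, by simp, by simp, fun t ht => ⟨hD t ht, ?_⟩⟩
  · exact (hsm.of_le (by exact_mod_cast le_top)).contMDiff.contMDiffOn
  · have hd : HasDerivAt (fun s : ℝ => φ (T * s) x) (T • X (φ (T * t) x)) t :=
      (h x (T * t)).scomp t (by simpa using (hasDerivAt_id t).const_mul T)
    rw [mfderivWithin_eq_fderivWithin,
      hd.hasFDerivAt.hasFDerivWithinAt.fderivWithin (uniqueDiffOn_Icc one_pos t ht)]
    have e : (ContinuousLinearMap.toSpanSingleton ℝ (T • X (φ (T * t) x))) (1 : ℝ) =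
        T • X (φ (T * t) x) := by simp
    have h2 := hker _ (hD t ht)
    refine (congrArg (β (φ (T * t) x)) e).trans ?_
    refine (map_smul (β (φ (T * t) x)) T (X (φ (T * t) x))).trans ?_
    exact (congrArg (T • ·) h2).trans (smul_zero T)

/-- Conversely, a tangent path stays in one orbit: its velocity is a multiple of the field. -/
theorem exists_apply_eq_of_tangentJoined (h : φ.Integrates X) {K : NNReal} (hK : LipschitzWith K X)
    (hker : ∀ z ∈ regularSet (J := 𝓘(ℝ, ℂ)) β D, β z (X z) = 0)
    (hX0 : ∀ z ∈ regularSet (J := 𝓘(ℝ, ℂ)) β D, X z ≠ 0) {x y : ℂ}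
    (hxy : TangentJoined (J := 𝓘(ℝ, ℂ)) β D x y) : ∃ T, φ T x = y := by
  obtain ⟨γ, hγ, rfl, rfl, hγt⟩ := hxy
  have hγ' : ContDiffOn ℝ 1 γ (Icc 0 1) := hγ.contDiffOn
  have hXc : ContinuousOn (fun t => X (γ t)) (Icc 0 1) :=
    hK.continuous.comp_continuousOn hγ'.continuousOn
  have hdc : ContinuousOn (derivWithin γ (Icc 0 1)) (Icc 0 1) :=
    hγ'.continuousOn_derivWithin (uniqueDiffOn_Icc one_pos) le_rfl
  refine h.exists_eq_of_hasDerivWithinAt_smul hK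
    (c := fun t => ((X (γ t)).re * (derivWithin γ (Icc 0 1) t).re +
      (X (γ t)).im * (derivWithin γ (Icc 0 1) t).im) / ((X (γ t)).re ^ 2 + (X (γ t)).im ^ 2))
    ?_ fun t ht => ?_
  · refine ContinuousOn.div ?_ ?_ fun t ht h0 => hX0 _ (hγt t ht).1 ?_
    · exact ((Complex.continuous_re.comp_continuousOn hXc).mul
        (Complex.continuous_re.comp_continuousOn hdc)).add
        ((Complex.continuous_im.comp_continuousOn hXc).mul
        (Complex.continuous_im.comp_continuousOn hdc))
    · exact ((Complex.continuous_re.comp_continuousOn hXc).pow 2).add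
        ((Complex.continuous_im.comp_continuousOn hXc).pow 2)
    · apply Complex.ext
      · simp only [Complex.zero_re]; nlinarith [sq_nonneg (X (γ t)).re, sq_nonneg (X (γ t)).im]
      · simp only [Complex.zero_im]; nlinarith [sq_nonneg (X (γ t)).re, sq_nonneg (X (γ t)).im]
  · have hd := (hγ'.differentiableOn one_ne_zero t ht).hasDerivWithinAt
    obtain ⟨hreg, htan⟩ := hγt t ht
    rw [mfderivWithin_eq_fderivWithin] at htan
    rw [← eq_smul_of_mem_ker (b := β (γ t)) hreg.2 (hX0 _ hreg) (hker _ hreg)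
      (v := derivWithin γ (Icc 0 1) t) htan]
    exact hd

/-- The leaves of a planar form are the orbits of a vector field spanning its kernel. -/
theorem isLeaf_iff_exists_range_flow (h : φ.Integrates X) (hX : ContDiff ℝ ∞ X) {K : NNReal}
    (hK : LipschitzWith K X) (hker : ∀ z ∈ regularSet (J := 𝓘(ℝ, ℂ)) β D, β z (X z) = 0)
    (hX0 : ∀ z ∈ regularSet (J := 𝓘(ℝ, ℂ)) β D, X z ≠ 0)
    (hinv : ∀ z ∈ regularSet (J := 𝓘(ℝ, ℂ)) β D, ∀ t, φ t z ∈ regularSet (J := 𝓘(ℝ, ℂ)) β D)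
    (L : Set ℂ) :
    IsLeaf (J := 𝓘(ℝ, ℂ)) β D L ↔ ∃ x ∈ regularSet (J := 𝓘(ℝ, ℂ)) β D,
      L = range fun t => φ t x := by
  have key : ∀ x ∈ regularSet (J := 𝓘(ℝ, ℂ)) β D,
      {y | Relation.EqvGen (TangentJoined (J := 𝓘(ℝ, ℂ)) β D) x y} = range fun t => φ t x := by
    intro x hx
    ext y
    constructor
    · intro hy
      have : ∀ x y, Relation.EqvGen (TangentJoined (J := 𝓘(ℝ, ℂ)) β D) x y → ∃ T, φ T x = y := by
        intro x y hxy
        induction hxy with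
        | rel x y hxy => exact exists_apply_eq_of_tangentJoined h hK hker hX0 hxy
        | refl x => exact ⟨0, φ.map_zero_apply x⟩
        | symm x y _ ih =>
          obtain ⟨T, rfl⟩ := ih
          exact ⟨-T, φ.neg_apply_apply T x⟩
        | trans x y z _ _ ih1 ih2 =>
          obtain ⟨T, rfl⟩ := ih1
          obtain ⟨S, rfl⟩ := ih2
          exact ⟨S + T, φ.map_add S T x⟩
      exact this x y hy
    · rintro ⟨T, rfl⟩
      exact Relation.EqvGen.rel _ _ (tangentJoined_of_flow h hX hker fun s _ => hinv x hx _)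
  constructor
  · rintro ⟨x, hx, rfl⟩
    exact ⟨x, hx, key x hx⟩
  · rintro ⟨x, hx, rfl⟩
    exact ⟨x, hx, (key x hx).symm⟩

end PlanarForm

section OvertwistedForm

variable {β : ℂ → ℂ →L[ℝ] ℝ} {U : Set ℂ}

theorem HasCompactSupport.exists_flow_integrates {X : ℂ → ℂ} (hX : ContDiff ℝ ∞ X)
    (hs : HasCompactSupport X) : (∃ K, LipschitzWith K X) ∧ ∃ φ : Flow ℝ ℂ, φ.Integrates X := by
  obtain ⟨K, hK⟩ := hX.lipschitzWith_of_hasCompactSupport hs (by simp)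
  obtain ⟨C, hC⟩ := hX.continuous.bounded_above_of_compact_support hs
  refine ⟨⟨K, hK⟩, _root_.exists_flow_integrates (L := C.toNNReal) hK fun x => ?_⟩
  rw [Real.coe_toNNReal']
  exact (hC x).trans (le_max_left _ _)

/-- If the unit circle is a leaf then it is tangent to the kernel of the form: otherwise, the orbit
of some point of the circle would enter the open disc. -/
theorem re_kerVector_mul_conj_eq_zero (hU : IsOpen U) (hDU : Metric.closedBall 0 1 ⊆ U)
    (hβ : ContDiffOn ℝ ∞ β U)
    (hsing : ∀ z ∈ Metric.closedBall (0 : ℂ) 1, β z = 0 ↔ z = 0)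
    (hleaf : IsLeaf (J := 𝓘(ℝ, ℂ)) β (Metric.closedBall 0 1) (Metric.sphere 0 1)) {p : ℂ}
    (hp : ‖p‖ = 1) :
    (kerVector (β p) * (starRingEnd ℂ) p).re = 0 := by
  by_contra hne
  obtain ⟨χ, hχ, hχc, hχU, hχ1, -⟩ :=
    exists_contDiff_eq_one_nhdsSet (isCompact_closedBall (0 : ℂ) 1) hU hDU
  have hX := contDiff_smul_of_tsupport_subset hU hχ hχU (kerVector.contDiff.comp_contDiffOn hβ)
  set X : ℂ → ℂ := fun z => χ z • kerVector (β z) with hXdef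
  obtain ⟨⟨K, hK⟩, φ, hφ⟩ := HasCompactSupport.exists_flow_integrates hX hχc.smul_right
  have hker : ∀ z : ℂ, β z (X z) = 0 := fun z =>
    (map_smul (β z) (χ z) (kerVector (β z))).trans
      ((congrArg (χ z • ·) (apply_kerVector (β z))).trans (smul_zero _))
  have h0 : (0 : ℂ) ∈ Metric.closedBall 0 1 := by simp
  have hX0 : X 0 = 0 := by
    show χ 0 • kerVector (β 0) = 0
    rw [kerVector_eq_zero.2 ((hsing 0 h0).2 rfl), smul_zero]
  have hφ0 : ∀ t, φ t p ≠ 0 := by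
    intro t ht
    have h1 := φ.neg_apply_apply t p
    rw [ht, hφ.fixed_of_zero hK hX0] at h1
    rw [← h1, norm_zero] at hp
    exact zero_ne_one hp
  have hXp : X p = kerVector (β p) := by
    have : χ p = 1 := hχ1.self_of_nhdsSet p (mem_closedBall_zero_iff.2 hp.le)
    simp [hXdef, this]
  -- follow the flow in the direction `σ` in which the norm decreases
  obtain ⟨σ, hσ⟩ : ∃ σ : ℝ, σ * (kerVector (β p) * (starRingEnd ℂ) p).re < 0 :=
    ⟨-(kerVector (β p) * (starRingEnd ℂ) p).re, by nlinarith [mul_self_pos.2 hne]⟩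
  have hd : HasDerivAt (fun s : ℝ => φ (σ * s) p) (σ • X (φ (σ * 0) p)) 0 :=
    (hφ p (σ * 0)).scomp 0 (by simpa using (hasDerivAt_id (0 : ℝ)).const_mul σ)
  have hn := hd.norm_sq
  have hneg : 2 * inner ℝ (φ (σ * 0) p) (σ • X (φ (σ * 0) p)) < 0 := by
    rw [mul_zero, φ.map_zero_apply, hXp, inner_smul_right, Complex.inner]
    linarith
  have hev : ∀ᶠ s in 𝓝[>] (0 : ℝ), ‖φ (σ * s) p‖ ^ 2 < 1 := by
    have h2 := (hasDerivAt_iff_tendsto_slope.1 hn).eventually (gt_mem_nhds hneg)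
    have h3 := h2.filter_mono (nhdsWithin_mono 0 fun s (hs : 0 < s) => hs.ne')
    filter_upwards [h3, self_mem_nhdsWithin] with s hs hs0
    rw [slope_def_field, div_neg_iff] at hs
    have hs0' : 0 < s := hs0
    simp only [mul_zero, φ.map_zero_apply, hp, sub_zero] at hs
    rcases hs with hs | hs
    · linarith [hs.2]
    · linarith [hs.1]
  obtain ⟨η, hη, hηs⟩ := mem_nhdsGT_iff_exists_Ioc_subset.1 hev
  have hη0 : 0 < η := hη
  have hlt : ∀ s ∈ Ioc 0 η, ‖φ (σ * s) p‖ < 1 := fun s hs => by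
    have h2 : ‖φ (σ * s) p‖ ^ 2 < 1 := hηs hs
    nlinarith [norm_nonneg (φ (σ * s) p)]
  have hjoin : TangentJoined (J := 𝓘(ℝ, ℂ)) β (Metric.closedBall 0 1) p (φ (σ * η) p) := by
    refine tangentJoined_of_flow hφ hX (fun z _ => hker z) fun s hs => ?_
    have hmem : φ (σ * η * s) p ∈ Metric.closedBall (0 : ℂ) 1 := by
      rw [mem_closedBall_zero_iff]
      rcases hs.1.eq_or_lt with rfl | hs0
      · simp [hp]
      · rw [mul_assoc]
        exact (hlt _ ⟨by positivity, by nlinarith [hs.2]⟩).le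
    exact ⟨hmem, fun h => hφ0 _ ((hsing _ hmem).1 h)⟩
  obtain ⟨x, -, hx⟩ := hleaf
  have hpm : p ∈ Metric.sphere (0 : ℂ) 1 := mem_sphere_zero_iff_norm.2 hp
  have hq : φ (σ * η) p ∈ Metric.sphere (0 : ℂ) 1 := by
    rw [hx] at hpm ⊢
    exact hpm.trans _ _ _ (Relation.EqvGen.rel _ _ hjoin)
  rw [mem_sphere_zero_iff_norm] at hq
  exact (hlt η ⟨hη0, le_rfl⟩).ne hq

/-- The characteristic foliation of an overtwisted disc is spanned, after rescaling, by the vector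
field of a spiralling flow. -/
theorem exists_isSpiralFlow (hU : IsOpen U) (hDU : Metric.closedBall 0 1 ⊆ U)
    (hβ : ContDiffOn ℝ ∞ β U)
    (hsing : ∀ z ∈ Metric.closedBall (0 : ℂ) 1, β z = 0 ↔ z = 0)
    (hd : fderiv ℝ β 0 1 Complex.I -
      fderiv ℝ β 0 Complex.I 1 ≠ 0)
    (hleaf : ∀ L, IsClosedLeaf (J := 𝓘(ℝ, ℂ)) β (Metric.closedBall 0 1) L ↔ L = Metric.sphere 0 1) :
    ∃ ε X φ, IsSpiralFlow ε X φ ∧ ∀ z : ℂ, β z (X z) = 0 := by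
  have hsph : Metric.sphere (0 : ℂ) 1 ⊆ Metric.closedBall 0 1 := Metric.sphere_subset_closedBall
  have htan : ∀ p : ℂ, ‖p‖ = 1 → (kerVector (β p) * (starRingEnd ℂ) p).re = 0 := fun p hp =>
    re_kerVector_mul_conj_eq_zero hU hDU hβ hsing ((hleaf _).2 rfl).1 hp
  have hk : ContDiffOn ℝ ∞ (fun z => kerVector (β z)) U := kerVector.contDiff.comp_contDiffOn hβ
  -- `q z` is `‖z‖ ^ 2` times the angular speed of the kernel vector; it has a constant sign on the
  -- circle, where the kernel is tangent
  let q : ℂ → ℝ := fun z => (kerVector (β z) * (starRingEnd ℂ) z).im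
  have hq : ContDiffOn ℝ ∞ q U :=
    Complex.imCLM.contDiff.comp_contDiffOn (hk.mul Complex.conjCLE.contDiff.contDiffOn)
  have hq0 : ∀ p : ℂ, ‖p‖ = 1 → q p ≠ 0 := by
    intro p hp h0
    have h1 : kerVector (β p) * (starRingEnd ℂ) p = 0 := Complex.ext (htan p hp) h0
    have hp0 : p ≠ 0 := norm_ne_zero_iff.1 (by rw [hp]; exact one_ne_zero)
    have h2 := (mul_eq_zero.1 h1).resolve_right (by simpa using hp0)
    exact hp0 ((hsing p (mem_closedBall_zero_iff.2 hp.le)).1 (kerVector_eq_zero.1 h2))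
  obtain ⟨ε, hε, hεq⟩ : ∃ ε : ℝ, (ε = 1 ∨ ε = -1) ∧ ∀ p : ℂ, ‖p‖ = 1 → 0 < ε * q p := by
    have hpre : IsPreconnected (Metric.sphere (0 : ℂ) 1) :=
      isPreconnected_sphere (by rw [Complex.rank_real_complex]; norm_num) 0 1
    have hqc : ContinuousOn q (Metric.sphere 0 1) := hq.continuousOn.mono (hsph.trans hDU)
    by_cases h1 : 0 < q 1
    · refine ⟨1, Or.inl rfl, fun p hp => ?_⟩
      rw [one_mul]
      by_contra! hc
      obtain ⟨w, hw, hw0⟩ := hpre.intermediate_value (mem_sphere_zero_iff_norm.2 hp)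
        (by simp : (1 : ℂ) ∈ Metric.sphere (0 : ℂ) 1) hqc ⟨hc, h1.le⟩
      exact hq0 w (mem_sphere_zero_iff_norm.1 hw) hw0
    · refine ⟨-1, Or.inr rfl, fun p hp => ?_⟩
      rw [neg_one_mul, neg_pos]
      by_contra! hc
      obtain ⟨w, hw, hw0⟩ := hpre.intermediate_value
        (by simp : (1 : ℂ) ∈ Metric.sphere (0 : ℂ) 1) (mem_sphere_zero_iff_norm.2 hp) hqc
        ⟨not_lt.1 h1, hc⟩
      exact hq0 w (mem_sphere_zero_iff_norm.1 hw) hw0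
  have hεε : ε * ε = 1 := by rcases hε with h | h <;> rw [h] <;> norm_num
  -- rescale so that the angular speed is `ε` near the circle
  let W : Set ℂ := U ∩ (fun z => ε * q z) ⁻¹' Ioi 0
  have hW : IsOpen W := (continuousOn_const.mul hq.continuousOn).isOpen_inter_preimage hU isOpen_Ioi
  have hsW : Metric.sphere (0 : ℂ) 1 ⊆ W := fun p hp =>
    ⟨hDU (hsph hp), hεq p (mem_sphere_zero_iff_norm.1 hp)⟩
  obtain ⟨χ, hχ, -, hχW, hχ1, hχI⟩ :=
    exists_contDiff_eq_one_nhdsSet (isCompact_sphere (0 : ℂ) 1) hW hsW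
  obtain ⟨χ', hχ', hχ'c, hχ'U, hχ'1, -⟩ :=
    exists_contDiff_eq_one_nhdsSet (isCompact_closedBall (0 : ℂ) 1) hU hDU
  -- the positive factor that normalizes the angular speed near the circle, and is `1` elsewhere
  let m : ℂ → ℝ := fun z => χ z • (Complex.normSq z / (ε * q z)) + (1 - χ z)
  have hm : ContDiff ℝ ∞ m := by
    refine (contDiff_smul_of_tsupport_subset hW hχ hχW ?_).add (contDiff_const.sub hχ)
    refine ContDiffOn.div ?_ (contDiffOn_const.mul (hq.mono inter_subset_left)) fun z hz => hz.2.ne'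
    have : ContDiff ℝ ∞ fun z : ℂ => z.re * z.re + z.im * z.im :=
      (Complex.reCLM.contDiff.mul Complex.reCLM.contDiff).add
        (Complex.imCLM.contDiff.mul Complex.imCLM.contDiff)
    exact this.contDiffOn
  have hm0 : ∀ z, 0 < m z := by
    intro z
    have h1 := hχI z
    rcases h1.1.eq_or_lt with h0 | h0
    · simp [m, ← h0]
    · have hz : z ∈ W := hχW (subset_tsupport _ h0.ne')
      have hz2 : 0 < ε * q z := hz.2
      have hz0 : z ≠ 0 := by
        rintro rfl
        simp [q] at hz2
      have h3 : 0 < χ z • (Complex.normSq z / (ε * q z)) :=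
        mul_pos h0 (div_pos (Complex.normSq_pos.2 hz0) hz2)
      simp only [m]
      linarith [h1.2]
  have hX := contDiff_smul_of_tsupport_subset hU hχ' hχ'U (hm.contDiffOn.smul hk)
  -- the second cutoff makes the field complete without changing it on the disc
  let X : ℂ → ℂ := fun z => χ' z • (m z • kerVector (β z))
  have hXD : ∀ z, ‖z‖ ≤ 1 → X z = m z • kerVector (β z) := by
    intro z hz
    have : χ' z = 1 := hχ'1.self_of_nhdsSet z (mem_closedBall_zero_iff.2 hz)
    simp only [X, this, one_smul]
  obtain ⟨hK, φ, hφ⟩ := HasCompactSupport.exists_flow_integrates (X := X) hX hχ'c.smul_right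
  have hker : ∀ z : ℂ, β z (X z) = 0 := fun z => by
    have e : X z = (χ' z * m z) • kerVector (β z) := by simp only [X, smul_smul]
    refine (congrArg (β z) e).trans ?_
    exact (map_smul (β z) (χ' z * m z) (kerVector (β z))).trans
      ((congrArg ((χ' z * m z) • ·) (apply_kerVector (β z))).trans (smul_zero _))
  have hX0 : X 0 = 0 := by
    rw [hXD 0 (by simp), kerVector_eq_zero.2 ((hsing 0 (by simp)).2 rfl), smul_zero]
  have hXne : ∀ z, ‖z‖ ≤ 1 → z ≠ 0 → X z ≠ 0 := by
    intro z hz hz0 h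
    rw [hXD z hz, smul_eq_zero] at h
    exact hz0 ((hsing z (mem_closedBall_zero_iff.2 hz)).1
      (kerVector_eq_zero.1 (h.resolve_left (hm0 z).ne')))
  have hdiv : ∀ z, z ≠ 0 → X z / z = ((Complex.normSq z)⁻¹ : ℝ) * (X z * (starRingEnd ℂ) z) := by
    intro z hz
    rw [div_eq_mul_inv, Complex.inv_def]; push_cast; ring
  have hcol : ∃ r < 1, ∀ z, r < ‖z‖ → ‖z‖ ≤ 1 → (X z / z).im = ε := by
    obtain ⟨V, hV, hsV, hV1⟩ := mem_nhdsSet_iff_exists.1 hχ1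
    obtain ⟨r, hr, hr0, hrV⟩ := exists_collar_of_sphere_subset hV hsV
    refine ⟨r, hr, fun z hz hz1 => ?_⟩
    have hz0 : z ≠ 0 := norm_pos_iff.1 (hr0.trans hz)
    have hχz : χ z = 1 := hV1 (hrV z hz hz1)
    have hzW : z ∈ W := hχW (subset_tsupport _ (by simp [Function.mem_support, hχz]))
    have hz2 : ε * q z ≠ 0 := (show 0 < ε * q z from hzW.2).ne'
    have hns : Complex.normSq z ≠ 0 := (Complex.normSq_pos.2 hz0).ne'
    have hmz : m z = Complex.normSq z / (ε * q z) := by simp [m, hχz]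
    rw [hdiv z hz0, Complex.im_ofReal_mul, hXD z hz1, smul_mul_assoc, Complex.smul_im, hmz]
    show (Complex.normSq z)⁻¹ * ((Complex.normSq z / (ε * q z)) • q z) = ε
    have hε0 : ε ≠ 0 := left_ne_zero_of_mul hz2
    have hqz : q z ≠ 0 := right_ne_zero_of_mul hz2
    rw [smul_eq_mul]
    field_simp
    rw [pow_two, hεε]
  have hcirc : ∀ z, ‖z‖ = 1 → X z = ε * Complex.I * z := by
    intro z hz
    have hz0 : z ≠ 0 := norm_ne_zero_iff.1 (by rw [hz]; exact one_ne_zero)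
    obtain ⟨r, hr, hcol⟩ := hcol
    have him := hcol z (by rw [hz]; exact hr) hz.le
    have hre : (X z / z).re = 0 := by
      rw [hdiv z hz0, Complex.re_ofReal_mul, hXD z hz.le, smul_mul_assoc, Complex.smul_re,
        htan z hz, smul_zero, mul_zero]
    rw [← div_eq_iff hz0]
    apply Complex.ext
    · simp [hre]
    · simp [him]
  -- the divergence at `0` is a nonzero multiple of the exterior derivative of `β`
  have htr : (fderiv ℝ X 0 1).re + (fderiv ℝ X 0 Complex.I).im ≠ 0 := by
    have hβ0 : HasFDerivAt β
        (fderiv ℝ β 0) 0 :=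
      ((hβ.contDiffAt (hU.mem_nhds (hDU (by simp)))).differentiableAt (by simp)).hasFDerivAt
    have hk0 := kerVector.hasFDerivAt.comp (0 : ℂ) hβ0
    have hm0' := (hm.differentiable (by simp) 0).hasFDerivAt
    have h1 := hm0'.smul hk0
    have hev : X =ᶠ[𝓝 0] fun z => m z • kerVector (β z) := by
      have h2 : ∀ᶠ z in 𝓝 (0 : ℂ), χ' z = 1 :=
        hχ'1.filter_mono (nhds_le_nhdsSet (by simp))
      filter_upwards [h2] with z hz
      simp only [X, hz, one_smul]
    have h2 := (h1.congr_of_eventuallyEq hev).fderiv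
    have hk00 : kerVector (β 0) = 0 := kerVector_eq_zero.2 ((hsing 0 (by simp)).2 rfl)
    rw [h2]
    simp only [add_apply, smul_apply, ContinuousLinearMap.smulRight_apply,
      ContinuousLinearMap.comp_apply, Function.comp_apply, hk00, smul_zero, add_zero,
      Complex.smul_re, Complex.smul_im, kerVector_re, kerVector_im, smul_eq_mul]
    intro h3
    apply hd
    have h4 : m 0 * (fderiv ℝ β 0 1 Complex.I -
      fderiv ℝ β 0 Complex.I 1) = 0 := by linarith
    exact (mul_eq_zero.1 h4).resolve_left (hm0 0).ne'
  have hdisc : IsDiscFlow ε X φ := ⟨hε, hX, hK, hφ, hX0, hXne, htr, hcol, hcirc⟩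
  refine ⟨ε, X, φ, ⟨hdisc, fun z hz hz0 T hT hper => ?_⟩, hker⟩
  -- a periodic orbit would be a second closed leaf
  obtain ⟨K, hK⟩ := hK
  have hreg : ∀ z, z ∈ regularSet (J := 𝓘(ℝ, ℂ)) β (Metric.closedBall 0 1) ↔ ‖z‖ ≤ 1 ∧ z ≠ 0 := by
    intro z
    constructor
    · rintro ⟨h1, h2⟩
      exact ⟨mem_closedBall_zero_iff.1 h1, fun h => h2 ((hsing z h1).2 h)⟩
    · rintro ⟨h1, h2⟩
      have h1' := mem_closedBall_zero_iff.2 h1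
      exact ⟨h1', fun h => h2 ((hsing z h1').1 h)⟩
  have hcl : IsClosedLeaf (J := 𝓘(ℝ, ℂ)) β (Metric.closedBall 0 1) (range fun t => φ t z) := by
    refine ⟨(isLeaf_iff_exists_range_flow hφ hX hK (fun z _ => hker z) (fun z hz' => ?_)
      (fun z hz' t => ?_) _).2 ⟨z, (hreg z).2 ⟨hz.le, hz0⟩, rfl⟩, ?_⟩
    · exact hXne z ((hreg z).1 hz').1 ((hreg z).1 hz').2
    · rw [hreg] at hz' ⊢
      refine ⟨?_, fun h => hz'.2 (hdisc.apply_eq_zero.1 h)⟩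
      rcases hz'.1.lt_or_eq with h | h
      · exact (hdisc.norm_apply_lt_one h t).le
      · exact (hdisc.norm_apply_of_norm_eq_one h t).le
    · have hp : Function.Periodic (fun t => φ t z) T := fun t => by
        show φ (t + T) z = φ t z
        rw [φ.map_add, hper]
      rw [← hp.image_Icc hT 0]
      exact isCompact_Icc.image (hφ.continuous_orbit z)
  have hz1 : z ∈ Metric.sphere (0 : ℂ) 1 := by
    rw [← (hleaf _).1 hcl]
    exact ⟨0, φ.map_zero_apply z⟩
  exact hz.ne (mem_sphere_zero_iff_norm.1 hz1)

end OvertwistedForm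

/-! ### Pullbacks of forms -/

section Pullback

variable {E : Type*} [NormedAddCommGroup E] [NormedSpace ℝ E]
  {K : Type*} [TopologicalSpace K] {I : ModelWithCorners ℝ E K}
  {M : Type*} [TopologicalSpace M] [ChartedSpace K M]
  {F : Type*} [NormedAddCommGroup F] [NormedSpace ℝ F]
  {G : Type*} [TopologicalSpace G] {J : ModelWithCorners ℝ F G}
  {N : Type*} [TopologicalSpace N] [ChartedSpace G N]
  {V : Type*} [NormedAddCommGroup V] [NormedSpace ℝ V]
  {α : ∀ x : M, TangentSpace I x →L[ℝ] ℝ}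

theorem pullbackForm_congr {f g : N → M} {x : N} (h : f =ᶠ[𝓝 x] g) :
    pullbackForm (J := J) α f x = pullbackForm (J := J) α g x := by
  let A : M → (F →L[ℝ] E) → (F →L[ℝ] ℝ) := fun y L => (α y).comp L
  exact congrArg₂ A h.self_of_nhds (h.mfderiv_eq (I := J) (I' := I))

theorem pullbackForm_comp {f : N → M} {g : V → N} {x : V} (hf : MDifferentiableAt J I f (g x))
    (hg : MDifferentiableAt 𝓘(ℝ, V) J g x) :
    pullbackForm (J := 𝓘(ℝ, V)) α (f ∘ g) x =
      (pullbackForm (J := J) α f (g x)).comp (mfderiv 𝓘(ℝ, V) J g x) := by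
  unfold pullbackForm
  rw [mfderiv_comp x hf hg]
  rfl

/-- The pullback of a form to a vector space, as a family of linear forms on that space. -/
noncomputable def linearPullback (α : ∀ x : M, TangentSpace I x →L[ℝ] ℝ) (f : V → M) :
    V → V →L[ℝ] ℝ :=
  fun z => pullbackForm (J := 𝓘(ℝ, V)) α f z

/-- The pullback of a smooth form by a smooth map from a vector space is smooth. -/
theorem contDiffOn_pullbackForm [IsManifold I ∞ M] [FiniteDimensional ℝ V] (hα : IsSmoothForm α)
    {f : V → M} {U : Set V} (hU : IsOpen U) (hf : ContMDiffOn 𝓘(ℝ, V) I ∞ f U) :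
    ContDiffOn ℝ ∞ (linearPullback α f) U := by
  rw [contDiffOn_clm_apply]
  intro e
  have h1 : ContMDiffOn 𝓘(ℝ, V) (𝓘(ℝ, V).prod 𝓘(ℝ, V)) ∞
      (fun z => (Bundle.TotalSpace.mk' V z e : TangentBundle 𝓘(ℝ, V) V)) U :=
    contMDiffOn_vectorSpace_iff_contDiffOn.2 contDiffOn_const
  have h2 := (hf.contMDiffOn_tangentMapWithin (m := ∞) (by simp) hU.uniqueMDiffOn).comp h1
    (fun z hz => hz)
  have h3 : ContMDiffOn 𝓘(ℝ, V) (I.prod 𝓘(ℝ, E)) ∞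
      (fun z => (Bundle.TotalSpace.mk' E (f z) (mfderiv 𝓘(ℝ, V) I f z e) :
        TangentBundle I M)) U := by
    refine h2.congr fun z hz => ?_
    simp only [Function.comp_apply, tangentMapWithin, mfderivWithin_of_isOpen hU hz]
  have h4 := ContMDiffOn.clm_bundle_apply (b := f) (E₂ := Bundle.Trivial M ℝ) (F₂ := ℝ)
    (ϕ := fun z => α (f z)) (hα.comp_contMDiffOn hf) h3
  rw [← contMDiffOn_iff_contDiffOn]
  intro z hz
  exact (Bundle.contMDiffWithinAt_totalSpace.1 (h4 z hz)).2

theorem mfderiv_eq_fderiv_extChartAt {f : V → M} {x : V} (hf : MDifferentiableAt 𝓘(ℝ, V) I f x) :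
    (mfderiv 𝓘(ℝ, V) I f x : V →L[ℝ] E) = fderiv ℝ (extChartAt I (f x) ∘ f) x := by
  simp only [mfderiv, hf, writtenInExtChartAt]
  simp [fderivWithin_univ, Function.comp_def]
  rfl

end Pullback

section ExteriorDerivative

variable {E : Type*} [NormedAddCommGroup E] [NormedSpace ℝ E]
  {K : Type*} [TopologicalSpace K] {I : ModelWithCorners ℝ E K} [I.Boundaryless]
  {M : Type*} [TopologicalSpace M] [ChartedSpace K M] [IsManifold I ∞ M]
  {V : Type*} [NormedAddCommGroup V] [NormedSpace ℝ V]
  {α : ∀ x : M, TangentSpace I x →L[ℝ] ℝ}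

theorem contDiffOn_formInChart [FiniteDimensional ℝ E] (hα : IsSmoothForm α) (x : M) :
    ContDiffOn ℝ ∞ (formInChart α x : E → E →L[ℝ] ℝ) (extChartAt I x).target :=
  contDiffOn_pullbackForm hα (isOpen_extChartAt_target x) (contMDiffOn_extChartAt_symm x)

/-- In the preferred chart at `f x`, the pullback of a form by `f` is the usual pullback. -/
theorem eventually_linearPullback_eq {f : V → M} {x : V} {U : Set V} (hU : IsOpen U)
    (hxU : x ∈ U) (hf : ContMDiffOn 𝓘(ℝ, V) I ∞ f U) :
    ∀ᶠ z in 𝓝 x, linearPullback α f z =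
      (formInChart α (f x) (extChartAt I (f x) (f z)) : E →L[ℝ] ℝ).comp
        (fderiv ℝ (extChartAt I (f x) ∘ f) z) := by
  have hs : U ∩ f ⁻¹' (extChartAt I (f x)).source ∈ 𝓝 x :=
    (hf.continuousOn.isOpen_inter_preimage hU (isOpen_extChartAt_source (f x))).mem_nhds
      ⟨hxU, mem_extChartAt_source (f x)⟩
  have hopen := hf.continuousOn.isOpen_inter_preimage hU (isOpen_extChartAt_source (I := I) (f x))
  filter_upwards [hs] with z hz
  have hfz : ContMDiffAt 𝓘(ℝ, V) I ∞ f z := hf.contMDiffAt (hU.mem_nhds hz.1)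
  have hg : ContMDiffAt 𝓘(ℝ, V) 𝓘(ℝ, E) ∞ (extChartAt I (f x) ∘ f) z :=
    (contMDiffAt_extChartAt' (by simpa using hz.2)).comp z hfz
  have hsymm : MDifferentiableAt 𝓘(ℝ, E) I (extChartAt I (f x)).symm
      ((extChartAt I (f x) ∘ f) z) :=
    ((contMDiffOn_extChartAt_symm (I := I) (n := ∞) (f x)).contMDiffAt
      ((isOpen_extChartAt_target (f x)).mem_nhds
        ((extChartAt I (f x)).map_source hz.2))).mdifferentiableAt (by simp)
  have hev : f =ᶠ[𝓝 z] (extChartAt I (f x)).symm ∘ (extChartAt I (f x) ∘ f) := by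
    filter_upwards [hopen.mem_nhds hz] with w hw
    exact ((extChartAt I (f x)).left_inv hw.2).symm
  have h1 := (pullbackForm_congr (J := 𝓘(ℝ, V)) (α := α) hev).trans
    (pullbackForm_comp (α := α) hsymm (hg.mdifferentiableAt (by simp)))
  rw [mfderiv_eq_fderiv] at h1
  exact h1

/-- The exterior derivative is natural. -/
theorem fderiv_linearPullback_sub [FiniteDimensional ℝ E] (hα : IsSmoothForm α) {f : V → M} {x : V}
    {U : Set V} (hU : IsOpen U) (hxU : x ∈ U) (hf : ContMDiffOn 𝓘(ℝ, V) I ∞ f U) (u v : V) :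
    fderiv ℝ (linearPullback α f) x u v - fderiv ℝ (linearPullback α f) x v u =
      extD α (f x) (mfderiv 𝓘(ℝ, V) I f x u) (mfderiv 𝓘(ℝ, V) I f x v) := by
  have hfx : ContMDiffAt 𝓘(ℝ, V) I ∞ f x := hf.contMDiffAt (hU.mem_nhds hxU)
  set g : V → E := extChartAt I (f x) ∘ f with hg
  have hgx : ContDiffAt ℝ ∞ g x := by
    rw [← contMDiffAt_iff_contDiffAt]
    exact (contMDiffAt_extChartAt (I := I) (x := f x)).comp x hfx
  let A : E → E →L[ℝ] ℝ := formInChart α (f x)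
  have hA : HasFDerivAt A (fderiv ℝ A (g x)) (g x) :=
    (((contDiffOn_formInChart hα (f x)).contDiffAt ((isOpen_extChartAt_target (f x)).mem_nhds
      (mem_extChartAt_target (f x)))).differentiableAt (by simp)).hasFDerivAt
  have hg1 : HasFDerivAt g (fderiv ℝ g x) x := (hgx.differentiableAt (by simp)).hasFDerivAt
  have hg2 : HasFDerivAt (fderiv ℝ g) (fderiv ℝ (fderiv ℝ g) x) x :=
    ((hgx.fderiv_right (m := 1) (by norm_cast)).differentiableAt one_ne_zero).hasFDerivAt
  have hmain := (((hA.comp x hg1).clm_comp hg2).congr_of_eventuallyEq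
    (eventually_linearPullback_eq (α := α) hU hxU hf)).fderiv
  have hsymm : fderiv ℝ (fderiv ℝ g) x u v = fderiv ℝ (fderiv ℝ g) x v u :=
    (hgx.isSymmSndFDerivAt (by simp; exact WithTop.coe_le_coe.2 (le_top : (2 : ℕ∞) ≤ ⊤))).eq u v
  have hmf : (mfderiv 𝓘(ℝ, V) I f x : V →L[ℝ] E) = fderiv ℝ g x :=
    mfderiv_eq_fderiv_extChartAt (hfx.mdifferentiableAt (by simp))
  have e1 : extD α (f x) (mfderiv 𝓘(ℝ, V) I f x u) (mfderiv 𝓘(ℝ, V) I f x v) =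
      fderiv ℝ A (g x) (fderiv ℝ g x u) (fderiv ℝ g x v) -
        fderiv ℝ A (g x) (fderiv ℝ g x v) (fderiv ℝ g x u) := by
    rw [← hmf]; rfl
  rw [e1, hmain]
  simp [hsymm]

/-- On a surface in a contact 3-manifold, the exterior derivative of the restricted contact form
does not vanish at the points where the surface is tangent to the contact planes. -/
theorem fderiv_linearPullback_sub_ne_zero (hE : Module.finrank ℝ E = 3) (hα : IsContactForm α)
    {f : ℂ → M} {x : ℂ} {U : Set ℂ} (hU : IsOpen U) (hxU : x ∈ U)
    (hf : ContMDiffOn 𝓘(ℝ, ℂ) I ∞ f U) (himm : Function.Injective (mfderiv 𝓘(ℝ, ℂ) I f x))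
    (h0 : pullbackForm (J := 𝓘(ℝ, ℂ)) α f x = 0) :
    fderiv ℝ (linearPullback α f) x 1 Complex.I -
      fderiv ℝ (linearPullback α f) x Complex.I 1 ≠ 0 := by
  have : FiniteDimensional ℝ E := FiniteDimensional.of_finrank_pos (by rw [hE]; norm_num)
  let a' : E →L[ℝ] ℝ := α (f x)
  let L' : ℂ →L[ℝ] E := mfderiv 𝓘(ℝ, ℂ) I f x
  let a : E →ₗ[ℝ] ℝ := a'
  let L : ℂ →ₗ[ℝ] E := L'
  have haL : ∀ z, L z ∈ LinearMap.ker a := fun z => by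
    have := congrArg (fun b : ℂ →L[ℝ] ℝ => b z) h0
    exact this
  have ha : a ≠ 0 := by
    intro h
    apply hα.ne_zero (f x)
    ext v
    exact congrArg (fun b : E →ₗ[ℝ] ℝ => b v) (show a = 0 from h)
  have hker : Module.finrank ℝ (LinearMap.ker a) = 2 := by
    have h1 := a.finrank_range_add_finrank_ker
    rw [LinearMap.range_eq_top.2 (LinearMap.surjective ha), finrank_top, hE,
      Module.finrank_self] at h1
    omega
  -- at a tangency the surface spans the contact plane, on which `dα` is nondegenerate
  have hsurj : Function.Surjective (L.codRestrict _ haL) := by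
    refine (LinearMap.injective_iff_surjective_of_finrank_eq_finrank ?_).1 ?_
    · rw [hker, Complex.finrank_real_complex]
    · intro z w hzw
      exact himm (congrArg Subtype.val hzw)
  obtain ⟨v, hv, hne⟩ := hα.nondegenerate (f x) (L 1) (haL 1) (fun h => by
    have h1 : L 1 = L 0 := by rw [map_zero]; exact h
    exact (one_ne_zero : (1 : ℂ) ≠ 0) (himm h1))
  obtain ⟨w, hw⟩ := hsurj ⟨v, hv⟩
  have hw' : L w = v := congrArg Subtype.val hw
  have key := fderiv_linearPullback_sub hα.smooth hU hxU hf 1 w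
  intro hzero
  apply hne
  rw [← hw']
  refine key.symm.trans ?_
  have h1 := realForm_apply (fderiv ℝ (linearPullback α f) x 1) w
  have h2 : fderiv ℝ (linearPullback α f) x w 1 =
      w.re * fderiv ℝ (linearPullback α f) x 1 1 +
        w.im * fderiv ℝ (linearPullback α f) x Complex.I 1 := by
    have : w = w.re • (1 : ℂ) + w.im • Complex.I := by simp [Complex.re_add_im]
    conv_lhs => rw [this, map_add, map_smul, map_smul]
    rfl
  rw [h1, h2]
  linear_combination w.im * hzero

end ExteriorDerivative

/-! ### Moving the singular point to the centre -/

section LeafTransport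

variable {F : Type*} [NormedAddCommGroup F] [NormedSpace ℝ F]
  {G : Type*} [TopologicalSpace G] {J : ModelWithCorners ℝ F G}
  {N : Type*} [TopologicalSpace N] [ChartedSpace G N]
  {β β' : ∀ x : N, TangentSpace J x →L[ℝ] ℝ} {D L : Set N}

theorem ContactTopology.TangentJoined.mem {x y : N} (h : TangentJoined β D x y) :
    x ∈ D ∧ y ∈ D := by
  obtain ⟨γ, -, rfl, rfl, hγ⟩ := h
  exact ⟨(hγ 0 ⟨le_rfl, zero_le_one⟩).1.1, (hγ 1 ⟨zero_le_one, le_rfl⟩).1.1⟩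

theorem mem_of_eqvGen_tangentJoined {x y : N}
    (h : Relation.EqvGen (TangentJoined β D) x y) : x ∈ D ↔ y ∈ D := by
  induction h with
  | rel x y h => exact ⟨fun _ => (TangentJoined.mem h).2, fun _ => (TangentJoined.mem h).1⟩
  | refl x => rfl
  | symm x y _ ih => exact ih.symm
  | trans x y z _ _ ih1 ih2 => exact ih1.trans ih2

theorem ContactTopology.IsLeaf.subset (h : IsLeaf β D L) : L ⊆ D := by
  obtain ⟨x, hx, rfl⟩ := h
  exact fun y hy => (mem_of_eqvGen_tangentJoined hy).1 hx.1

/-- Mutually inverse maps that preserve tangent paths and regular points map leaves to leaves. -/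
theorem ContactTopology.IsLeaf.image {m n : N → N}
    (hm : ∀ x y, TangentJoined β' D x y → TangentJoined β D (m x) (m y))
    (hn : ∀ x y, TangentJoined β D x y → TangentJoined β' D (n x) (n y))
    (hreg : ∀ x ∈ regularSet β' D, m x ∈ regularSet β D)
    (hnm : ∀ x ∈ D, n (m x) = x) (hmn : ∀ x ∈ D, m (n x) = x) (h : IsLeaf β' D L) :
    IsLeaf β D (m '' L) := by
  have hlift : ∀ {β₁ β₂ : ∀ x : N, TangentSpace J x →L[ℝ] ℝ} {k : N → N},
      (∀ x y, TangentJoined β₁ D x y → TangentJoined β₂ D (k x) (k y)) → ∀ x y,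
      Relation.EqvGen (TangentJoined β₁ D) x y →
        Relation.EqvGen (TangentJoined β₂ D) (k x) (k y) := by
    intro β₁ β₂ k hk x y h
    induction h with
    | rel x y h => exact .rel _ _ (hk x y h)
    | refl x => exact .refl _
    | symm x y _ ih => exact ih.symm
    | trans x y z _ _ ih1 ih2 => exact ih1.trans _ _ _ ih2
  obtain ⟨x, hx, rfl⟩ := h
  refine ⟨m x, hreg x hx, Subset.antisymm ?_ fun y hy => ?_⟩
  · rintro _ ⟨y, hy, rfl⟩
    exact hlift hm x y hy
  · have hyD : y ∈ D := (mem_of_eqvGen_tangentJoined hy).1 (hreg x hx).1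
    refine ⟨n y, ?_, hmn y hyD⟩
    have := hlift hn _ _ hy
    rwa [hnm x hx.1] at this

end LeafTransport

/-- A smooth self-map of a planar region that pulls `β` back to `β'` maps leaves into leaves. -/
theorem tangentJoined_map_of_comp_fderiv {β β' : ℂ → ℂ →L[ℝ] ℝ} {D W : Set ℂ} {m : ℂ → ℂ}
    (hW : IsOpen W) (hDW : D ⊆ W) (hm : ContDiffOn ℝ 1 m W) (hmD : MapsTo m D D)
    (h : ∀ z ∈ D, β' z = (β (m z)).comp (fderiv ℝ m z)) {x y : ℂ}
    (hxy : TangentJoined (J := 𝓘(ℝ, ℂ)) β' D x y) :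
    TangentJoined (J := 𝓘(ℝ, ℂ)) β D (m x) (m y) := by
  obtain ⟨γ, hγ, rfl, rfl, hγt⟩ := hxy
  have hγ' : ContDiffOn ℝ 1 γ (Icc 0 1) := hγ.contDiffOn
  refine ⟨m ∘ γ, ?_, rfl, rfl, fun t ht => ⟨⟨hmD (hγt t ht).1.1, ?_⟩, ?_⟩⟩
  · exact (hm.comp hγ' fun t ht => hDW (hγt t ht).1.1).contMDiffOn
  · intro h0
    apply (hγt t ht).1.2
    have h1 := h _ (hγt t ht).1.1
    rw [show β (m (γ t)) = 0 from h0, ContinuousLinearMap.zero_comp] at h1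
    exact h1
  · have hu : UniqueDiffWithinAt ℝ (Icc (0 : ℝ) 1) t := uniqueDiffOn_Icc one_pos t ht
    have hmt : DifferentiableAt ℝ m (γ t) :=
      (hm.contDiffAt (hW.mem_nhds (hDW (hγt t ht).1.1))).differentiableAt one_ne_zero
    have hd := fderiv_comp_fderivWithin t hmt (hγ'.differentiableOn one_ne_zero t ht) hu
    have h2 := (hγt t ht).2
    rw [mfderivWithin_eq_fderivWithin] at h2 ⊢
    have h3 : β' (γ t) (fderivWithin ℝ γ (Icc 0 1) t 1) = 0 := h2
    rw [h _ (hγt t ht).1.1] at h3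
    rw [hd]
    exact h3

/-- The automorphism of the unit disc that maps `0` to `a`. -/
noncomputable def discMobius (a z : ℂ) : ℂ := (z + a) / (1 + (starRingEnd ℂ) a * z)

namespace discMobius

variable {a z : ℂ}

theorem denom_ne_zero (ha : ‖a‖ < 1) (hz : ‖z‖ ≤ 1) : 1 + (starRingEnd ℂ) a * z ≠ 0 := by
  intro h
  have h1 : (starRingEnd ℂ) a * z = -1 := by linear_combination h
  have h2 := congrArg norm h1
  rw [norm_mul, RCLike.norm_conj, norm_neg, norm_one] at h2
  nlinarith [norm_nonneg a, norm_nonneg z]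

theorem isOpen_denom_ne_zero (a : ℂ) : IsOpen {z : ℂ | 1 + (starRingEnd ℂ) a * z ≠ 0} :=
  isOpen_ne_fun (by fun_prop) continuous_const

theorem one_sub_sq_norm_mul (h : 1 + (starRingEnd ℂ) a * z ≠ 0) :
    (1 - ‖discMobius a z‖ ^ 2) * ‖1 + (starRingEnd ℂ) a * z‖ ^ 2 =
      (1 - ‖a‖ ^ 2) * (1 - ‖z‖ ^ 2) := by
  have hn : ‖1 + (starRingEnd ℂ) a * z‖ ≠ 0 := norm_ne_zero_iff.2 h
  have e : (1 - ‖discMobius a z‖ ^ 2) * ‖1 + (starRingEnd ℂ) a * z‖ ^ 2 =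
      ‖1 + (starRingEnd ℂ) a * z‖ ^ 2 - ‖z + a‖ ^ 2 := by
    rw [discMobius, norm_div, div_pow, sub_mul, one_mul, div_mul_cancel₀ _ (pow_ne_zero 2 hn)]
  rw [e]
  simp only [← Complex.normSq_eq_norm_sq, Complex.normSq_apply]
  simp
  ring

theorem norm_le_one (ha : ‖a‖ < 1) (hz : ‖z‖ ≤ 1) : ‖discMobius a z‖ ≤ 1 := by
  have h := denom_ne_zero ha hz
  have h1 := one_sub_sq_norm_mul h
  have h2 : 0 < ‖1 + (starRingEnd ℂ) a * z‖ ^ 2 := by positivity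
  have h3 : 0 ≤ (1 - ‖a‖ ^ 2) * (1 - ‖z‖ ^ 2) :=
    mul_nonneg (by nlinarith [norm_nonneg a]) (by nlinarith [norm_nonneg z])
  rw [← h1] at h3
  have h4 := nonneg_of_mul_nonneg_left h3 h2
  nlinarith [norm_nonneg (discMobius a z)]

theorem norm_eq_one (ha : ‖a‖ < 1) (hz : ‖z‖ = 1) : ‖discMobius a z‖ = 1 := by
  have h := denom_ne_zero ha hz.le
  have h1 := one_sub_sq_norm_mul h
  have h2 : 0 < ‖1 + (starRingEnd ℂ) a * z‖ ^ 2 := by positivity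
  rw [hz, one_pow, sub_self, mul_zero, mul_eq_zero] at h1
  have h4 := h1.resolve_right h2.ne'
  have h5 : ‖discMobius a z‖ ^ 2 = 1 := by linarith
  exact (pow_eq_one_iff_of_nonneg (norm_nonneg _) two_ne_zero).1 h5

theorem neg_apply_apply (ha : ‖a‖ < 1) (hz : 1 + (starRingEnd ℂ) a * z ≠ 0) :
    discMobius (-a) (discMobius a z) = z := by
  have h1 : (1 : ℂ) - (starRingEnd ℂ) a * a ≠ 0 := by
    rw [mul_comm, Complex.mul_conj, Complex.normSq_eq_norm_sq]
    norm_cast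
    nlinarith [norm_nonneg a]
  have e : 1 + (starRingEnd ℂ) (-a) * discMobius a z =
      (1 - (starRingEnd ℂ) a * a) / (1 + (starRingEnd ℂ) a * z) := by
    rw [discMobius, map_neg]; field_simp; ring
  have e' : discMobius a z + -a =
      z * (1 - (starRingEnd ℂ) a * a) / (1 + (starRingEnd ℂ) a * z) := by
    rw [discMobius, eq_div_iff hz, add_mul, div_mul_cancel₀ _ hz]; ring
  rw [discMobius, e, e', div_div_div_cancel_right₀ hz, mul_div_cancel_right₀ _ h1]

theorem hasDerivAt (hz : 1 + (starRingEnd ℂ) a * z ≠ 0) :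
    HasDerivAt (discMobius a)
      ((1 - (starRingEnd ℂ) a * a) / (1 + (starRingEnd ℂ) a * z) ^ 2) z := by
  have h1 : HasDerivAt (fun z : ℂ => z + a) 1 z := (hasDerivAt_id z).add_const a
  have h2 : HasDerivAt (fun z : ℂ => 1 + (starRingEnd ℂ) a * z) ((starRingEnd ℂ) a) z := by
    simpa using ((hasDerivAt_id z).const_mul ((starRingEnd ℂ) a)).const_add 1
  refine (h1.div h2 hz).congr_deriv ?_
  congr 1
  ring

theorem contDiffOn (a : ℂ) : ContDiffOn ℝ ∞ (discMobius a)
    {z : ℂ | 1 + (starRingEnd ℂ) a * z ≠ 0} := by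
  exact ((contDiffOn_id.add contDiffOn_const).mul
    ((contDiffOn_const.add (contDiffOn_const.mul contDiffOn_id)).inv fun _ hz => hz)).congr
      fun z _ => div_eq_mul_inv (z + a) (1 + (starRingEnd ℂ) a * z)

theorem bijective_fderiv (ha : ‖a‖ < 1) (hz : ‖z‖ ≤ 1) :
    Function.Bijective (fderiv ℝ (discMobius a) z) := by
  have hd := denom_ne_zero ha hz
  have h1 : (1 : ℂ) - (starRingEnd ℂ) a * a ≠ 0 := by
    rw [mul_comm, Complex.mul_conj, Complex.normSq_eq_norm_sq]
    norm_cast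
    nlinarith [norm_nonneg a]
  have h2 := (hasDerivAt hd).complexToReal_fderiv.fderiv
  rw [h2]
  have h3 := div_ne_zero h1 (pow_ne_zero 2 hd)
  refine ⟨fun v w hvw => ?_, fun w => ⟨((1 - (starRingEnd ℂ) a * a) /
    (1 + (starRingEnd ℂ) a * z) ^ 2)⁻¹ * w, ?_⟩⟩
  · simp only [smul_apply, smul_eq_mul] at hvw
    exact mul_left_cancel₀ h3 hvw
  · exact mul_inv_cancel_left₀ h3 w

end discMobius

section Recentre

variable {E : Type*} [NormedAddCommGroup E] [NormedSpace ℝ E]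
  {K : Type*} [TopologicalSpace K] {I : ModelWithCorners ℝ E K}
  {M : Type*} [TopologicalSpace M] [ChartedSpace K M]
  {α : ∀ x : M, TangentSpace I x →L[ℝ] ℝ}

/-- An overtwisted disc can be reparametrised so that its singular point is the centre. -/
theorem ContactTopology.IsOvertwistedDisc.exists_singular_zero {f : ℂ → M}
    (h : IsOvertwistedDisc α f) : ∃ g : ℂ → M, IsOvertwistedDisc α g ∧
      ∀ z ∈ Metric.closedBall (0 : ℂ) 1, pullbackForm (J := 𝓘(ℝ, ℂ)) α g z = 0 ↔ z = 0 := by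
  obtain ⟨U, hU, hDU, hfU⟩ := h.smooth
  obtain ⟨a, ha, hsing⟩ := h.singular
  rw [mem_ball_zero_iff] at ha
  have ha' : ‖-a‖ < 1 := by rwa [norm_neg]
  let W : Set ℂ := {z | 1 + (starRingEnd ℂ) a * z ≠ 0}
  let W' : Set ℂ := {z | 1 + (starRingEnd ℂ) (-a) * z ≠ 0}
  have hW : IsOpen W := discMobius.isOpen_denom_ne_zero a
  have hW' : IsOpen W' := discMobius.isOpen_denom_ne_zero (-a)
  have hDW : Metric.closedBall 0 1 ⊆ W := fun z hz =>
    discMobius.denom_ne_zero ha (mem_closedBall_zero_iff.1 hz)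
  have hDW' : Metric.closedBall 0 1 ⊆ W' := fun z hz =>
    discMobius.denom_ne_zero ha' (mem_closedBall_zero_iff.1 hz)
  have hmD : ∀ z ∈ Metric.closedBall (0 : ℂ) 1, discMobius a z ∈ Metric.closedBall (0 : ℂ) 1 :=
    fun z hz => mem_closedBall_zero_iff.2
      (discMobius.norm_le_one ha (mem_closedBall_zero_iff.1 hz))
  have hnD : ∀ z ∈ Metric.closedBall (0 : ℂ) 1, discMobius (-a) z ∈ Metric.closedBall (0 : ℂ) 1 :=
    fun z hz => mem_closedBall_zero_iff.2
      (discMobius.norm_le_one ha' (mem_closedBall_zero_iff.1 hz))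
  have hnm : ∀ z ∈ Metric.closedBall (0 : ℂ) 1, discMobius (-a) (discMobius a z) = z :=
    fun z hz => discMobius.neg_apply_apply ha (hDW hz)
  have hmn' : ∀ z ∈ W', discMobius a (discMobius (-a) z) = z := fun z hz => by
    have := discMobius.neg_apply_apply ha' hz
    rwa [neg_neg] at this
  have hmn := fun z hz => hmn' z (hDW' hz)
  have hms : discMobius a '' Metric.sphere 0 1 = Metric.sphere 0 1 := by
    refine Subset.antisymm ?_ fun z hz => ?_
    · rintro _ ⟨z, hz, rfl⟩
      exact mem_sphere_zero_iff_norm.2 (discMobius.norm_eq_one ha (mem_sphere_zero_iff_norm.1 hz))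
    · exact ⟨_, mem_sphere_zero_iff_norm.2
        (discMobius.norm_eq_one ha' (mem_sphere_zero_iff_norm.1 hz)),
        hmn z (Metric.sphere_subset_closedBall hz)⟩
  have hns : discMobius (-a) '' Metric.sphere 0 1 = Metric.sphere 0 1 := by
    conv_lhs => rw [← hms]
    rw [image_image]
    exact (image_congr fun z hz => hnm z (Metric.sphere_subset_closedBall hz)).trans (image_id' _)
  -- the pullback form of the new disc
  let β := linearPullback α f
  let β' := linearPullback α (f ∘ discMobius a)
  have hmdiff : ∀ z ∈ W, DifferentiableAt ℝ (discMobius a) z := fun z hz =>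
    ((discMobius.contDiffOn a).contDiffAt (hW.mem_nhds hz)).differentiableAt (by simp)
  have hndiff : ∀ z ∈ W', DifferentiableAt ℝ (discMobius (-a)) z := fun z hz =>
    ((discMobius.contDiffOn (-a)).contDiffAt (hW'.mem_nhds hz)).differentiableAt (by simp)
  have hfdiff : ∀ z ∈ U, MDifferentiableAt 𝓘(ℝ, ℂ) I f z := fun z hz =>
    (hfU.contMDiffAt (hU.mem_nhds hz)).mdifferentiableAt (by simp)
  have hβ' : ∀ z ∈ Metric.closedBall (0 : ℂ) 1,
      β' z = (β (discMobius a z)).comp (fderiv ℝ (discMobius a) z) := by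
    intro z hz
    have := pullbackForm_comp (α := α) (J := 𝓘(ℝ, ℂ)) (x := z) (f := f) (g := discMobius a)
      (hfdiff _ (hDU (hmD z hz))) (hmdiff z (hDW hz)).mdifferentiableAt
    rw [mfderiv_eq_fderiv] at this
    exact this
  have hβ : ∀ z ∈ Metric.closedBall (0 : ℂ) 1,
      β z = (β' (discMobius (-a) z)).comp (fderiv ℝ (discMobius (-a)) z) := by
    intro z hz
    have hcomp := fderiv_comp z (hmdiff _ (hDW (hnD z hz))) (hndiff z (hDW' hz))
    have hid : discMobius a ∘ discMobius (-a) =ᶠ[𝓝 z] id := by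
      filter_upwards [hW'.mem_nhds (hDW' hz)] with w hw using hmn' w hw
    rw [hid.fderiv_eq, fderiv_id] at hcomp
    rw [hβ' _ (hnD z hz), ContinuousLinearMap.comp_assoc, ← hcomp, hmn z hz,
      ContinuousLinearMap.comp_id]
  -- the automorphism and its inverse carry leaves to leaves
  have hmj : ∀ x y, TangentJoined (J := 𝓘(ℝ, ℂ)) β' (Metric.closedBall 0 1) x y →
      TangentJoined (J := 𝓘(ℝ, ℂ)) β (Metric.closedBall 0 1) (discMobius a x) (discMobius a y) :=
    fun x y hxy => tangentJoined_map_of_comp_fderiv hW hDW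
      ((discMobius.contDiffOn a).of_le (by exact_mod_cast le_top)) hmD hβ' hxy
  have hnj : ∀ x y, TangentJoined (J := 𝓘(ℝ, ℂ)) β (Metric.closedBall 0 1) x y →
      TangentJoined (J := 𝓘(ℝ, ℂ)) β' (Metric.closedBall 0 1) (discMobius (-a) x)
        (discMobius (-a) y) :=
    fun x y hxy => tangentJoined_map_of_comp_fderiv hW' hDW'
      ((discMobius.contDiffOn (-a)).of_le (by exact_mod_cast le_top)) hnD hβ hxy
  have hmreg : ∀ x ∈ regularSet (J := 𝓘(ℝ, ℂ)) β' (Metric.closedBall 0 1),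
      discMobius a x ∈ regularSet (J := 𝓘(ℝ, ℂ)) β (Metric.closedBall 0 1) := by
    rintro x ⟨hx, hx0⟩
    refine ⟨hmD x hx, fun h0 => hx0 ?_⟩
    have h1 := hβ' x hx
    rw [show β (discMobius a x) = 0 from h0, ContinuousLinearMap.zero_comp] at h1
    exact h1
  have hnreg : ∀ x ∈ regularSet (J := 𝓘(ℝ, ℂ)) β (Metric.closedBall 0 1),
      discMobius (-a) x ∈ regularSet (J := 𝓘(ℝ, ℂ)) β' (Metric.closedBall 0 1) := by
    rintro x ⟨hx, hx0⟩
    refine ⟨hnD x hx, fun h0 => hx0 ?_⟩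
    have h1 := hβ x hx
    rw [show β' (discMobius (-a) x) = 0 from h0, ContinuousLinearMap.zero_comp] at h1
    exact h1
  have hsing' : ∀ z ∈ Metric.closedBall (0 : ℂ) 1,
      pullbackForm (J := 𝓘(ℝ, ℂ)) α (f ∘ discMobius a) z = 0 ↔ z = 0 := by
    intro z hz
    have h1 : β' z = 0 ↔ β (discMobius a z) = 0 := by
      rw [hβ' z hz]
      refine ⟨fun h0 => ?_, fun h0 => by rw [h0, ContinuousLinearMap.zero_comp]⟩
      ext v
      obtain ⟨w, rfl⟩ := (discMobius.bijective_fderiv ha (mem_closedBall_zero_iff.1 hz)).2 v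
      exact congrArg (fun b : ℂ →L[ℝ] ℝ => b w) h0
    refine h1.trans ((hsing _ (hmD z hz)).trans ?_)
    refine ⟨fun h2 => ?_, fun h2 => by rw [h2]; simp [discMobius]⟩
    rw [← hnm z hz, h2]
    simp [discMobius]
  refine ⟨f ∘ discMobius a, ⟨?_, ?_, ?_, ⟨0, by simp, hsing'⟩, fun L => ?_⟩, hsing'⟩
  · refine ⟨W ∩ discMobius a ⁻¹' U,
      (discMobius.contDiffOn a).continuousOn.isOpen_inter_preimage hW hU,
      fun z hz => ⟨hDW hz, hDU (hmD z hz)⟩, ?_⟩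
    exact hfU.comp ((discMobius.contDiffOn a).contMDiffOn.mono inter_subset_left)
      fun z hz => hz.2
  · intro z hz w hw hzw
    rw [← hnm z hz, ← hnm w hw, h.injOn (hmD z hz) (hmD w hw) hzw]
  · intro z hz
    rw [mfderiv_comp z (hfdiff _ (hDU (hmD z hz))) (hmdiff z (hDW hz)).mdifferentiableAt,
      mfderiv_eq_fderiv]
    exact (h.immersion _ (hmD z hz)).comp
      (discMobius.bijective_fderiv ha (mem_closedBall_zero_iff.1 hz)).1
  · constructor
    · rintro ⟨hL, hLc⟩
      have h1 : IsClosedLeaf (J := 𝓘(ℝ, ℂ)) β (Metric.closedBall 0 1) (discMobius a '' L) :=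
        ⟨IsLeaf.image hmj hnj hmreg hnm hmn hL, hLc.image_of_continuousOn
          ((discMobius.contDiffOn a).continuousOn.mono ((IsLeaf.subset hL).trans hDW))⟩
      have h2 := (h.closedLeaf _).1 h1
      rw [← hns, ← h2, image_image]
      exact ((image_congr fun z hz => hnm z ((IsLeaf.subset hL) hz)).trans (image_id' _)).symm
    · rintro rfl
      have h1 : IsLeaf (J := 𝓘(ℝ, ℂ)) β (Metric.closedBall 0 1) (Metric.sphere 0 1) :=
        ((h.closedLeaf _).2 rfl).1
      have h2 := IsLeaf.image hnj hmj hnreg hmn hnm h1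
      rw [hns] at h2
      exact ⟨h2, isCompact_sphere _ _⟩

end Recentre

/-! ### Sweeping a disc around by a positive loop -/

section LoopMap

variable {E : Type*} [NormedAddCommGroup E] [NormedSpace ℝ E]
  {K : Type*} [TopologicalSpace K] {I : ModelWithCorners ℝ E K}
  {M : Type*} [TopologicalSpace M] [ChartedSpace K M]
  {α : ∀ x : M, TangentSpace I x →L[ℝ] ℝ} {φ : ℝ → M ≃ₘ⟮I, I⟯ M} {H : ℝ → M → ℝ} {f : ℂ → M}
  {U : Set ℂ}

/-- The disc `f` at time `θ` of the loop `φ`, displaced in the plane to the point with argument `-θ`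
at which `r ^ 2` is the value of the Hamiltonian. The sign of the angle is such that `r ^ 2 dθ`
cancels the value of `α` on the velocity of the loop. -/
noncomputable def loopMap (φ : ℝ → M ≃ₘ⟮I, I⟯ M) (H : ℝ → M → ℝ) (f : ℂ → M) (q : ℂ × ℝ) : M × ℂ :=
  (φ q.2 (f q.1), (√(H q.2 (φ q.2 (f q.1))) : ℂ) * Complex.exp (-q.2 * Complex.I))

theorem hamiltonian_pos (hφ : IsPositiveLoop α φ) (hH : IsGeneratedBy α H φ) (θ : ℝ) (p : M) :
    0 < H θ (φ θ p) := by
  rw [← (hH.flow θ p).1]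
  exact hφ.pos θ p

theorem contMDiffOn_loop (hφ : IsPositiveLoop α φ) (hf : ContMDiffOn 𝓘(ℝ, ℂ) I ∞ f U) :
    ContMDiffOn (𝓘(ℝ, ℂ).prod 𝓘(ℝ, ℝ)) I ∞ (fun q : ℂ × ℝ => φ q.2 (f q.1)) (U ×ˢ univ) :=
  hφ.smooth.comp_contMDiffOn
    (contMDiff_snd.contMDiffOn.prodMk (hf.comp contMDiff_fst.contMDiffOn fun _ hq => hq.1))

theorem contMDiffOn_hamiltonian (hφ : IsPositiveLoop α φ) (hH : IsGeneratedBy α H φ)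
    (hf : ContMDiffOn 𝓘(ℝ, ℂ) I ∞ f U) :
    ContMDiffOn (𝓘(ℝ, ℂ).prod 𝓘(ℝ, ℝ)) 𝓘(ℝ, ℝ) ∞
      (fun q : ℂ × ℝ => √(H q.2 (φ q.2 (f q.1)))) (U ×ˢ univ) := by
  have h1 : ContMDiffOn (𝓘(ℝ, ℂ).prod 𝓘(ℝ, ℝ)) 𝓘(ℝ, ℝ) ∞
      (fun q : ℂ × ℝ => H q.2 (φ q.2 (f q.1))) (U ×ˢ univ) :=
    hH.smooth.comp_contMDiffOn (contMDiff_snd.contMDiffOn.prodMk (contMDiffOn_loop hφ hf))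
  intro q hq
  exact (Real.contDiffAt_sqrt (hamiltonian_pos hφ hH q.2
    (f q.1)).ne').contMDiffAt.comp_contMDiffWithinAt
    q (h1 q hq)

theorem contMDiffOn_loopMap (hφ : IsPositiveLoop α φ) (hH : IsGeneratedBy α H φ)
    (hf : ContMDiffOn 𝓘(ℝ, ℂ) I ∞ f U) :
    ContMDiffOn (𝓘(ℝ, ℂ).prod 𝓘(ℝ, ℝ)) (I.prod 𝓘(ℝ, ℂ)) ∞ (loopMap φ H f) (U ×ˢ univ) := by
  refine (contMDiffOn_loop hφ hf).prodMk ?_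
  have h2 : ContDiff ℝ ∞ fun q : ℝ × ℝ => (q.1 : ℂ) * Complex.exp (-q.2 * Complex.I) :=
    (Complex.ofRealCLM.contDiff.comp contDiff_fst).mul
      (((Complex.ofRealCLM.contDiff.comp contDiff_snd).neg.mul contDiff_const).cexp)
  have h3 := h2.contMDiff.comp_contMDiffOn ((contMDiffOn_hamiltonian hφ hH hf).prodMk_space
    contMDiff_snd.contMDiffOn)
  exact h3

theorem loopMap_periodic (hφ : IsPositiveLoop α φ) (hH : IsGeneratedBy α H φ) (z : ℂ) :
    Function.Periodic (fun θ => loopMap φ H f (z, θ)) (2 * Real.pi) := by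
  intro θ
  simp only [loopMap, hφ.periodic, hH.periodic]
  congr 2
  rw [Complex.exp_eq_exp_iff_exists_int]
  exact ⟨-1, by push_cast; ring⟩

theorem stabilizedForm_apply (q : M × ℂ) (X : E) (u : ℂ) :
    stabilizedForm α q ((X, u) : E × ℂ) =
      (α q.1 : E →L[ℝ] ℝ) X + (q.2.re * u.im - q.2.im * u.re) := by
  have h1 : (mfderiv (I.prod 𝓘(ℝ, ℂ)) I Prod.fst q : E × ℂ →L[ℝ] E) (X, u) = X := by
    rw [mfderiv_fst]; rfl
  have h2 : (mfderiv (I.prod 𝓘(ℝ, ℂ)) 𝓘(ℝ, ℂ) Prod.snd q : E × ℂ →L[ℝ] ℂ) (X, u) = u := by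
    rw [mfderiv_snd]; rfl
  refine congrArg₂ (· + ·) (congrArg (α q.1 : E →L[ℝ] ℝ) h1) ?_
  refine (congrArg (rSqDTheta q.2 : ℂ →L[ℝ] ℝ) h2).trans ?_
  rfl

/-- The derivative of `loopMap`: its component in `M` is the obvious one, and its planar component
`u` only matters through its angular part. -/
theorem exists_mfderiv_loopMap (hφ : IsPositiveLoop α φ) (hH : IsGeneratedBy α H φ) (hU : IsOpen U)
    (hf : ContMDiffOn 𝓘(ℝ, ℂ) I ∞ f U) {z : ℂ} (hz : z ∈ U) (θ : ℝ) (v : ℂ) (τ : ℝ) :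
    ∃ u : ℂ, (mfderiv (𝓘(ℝ, ℂ).prod 𝓘(ℝ, ℝ)) (I.prod 𝓘(ℝ, ℂ)) (loopMap φ H f) (z, θ) :
        ℂ × ℝ →L[ℝ] E × ℂ) (v, τ) =
      ((mfderiv I I (φ θ) (f z) : E →L[ℝ] E) ((mfderiv 𝓘(ℝ, ℂ) I f z : ℂ →L[ℝ] E) v) +
        τ • (velocity φ θ (f z) : E), u) ∧
      (loopMap φ H f (z, θ)).2.re * u.im - (loopMap φ H f (z, θ)).2.im * u.re =
        -(τ * H θ (φ θ (f z))) := by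
  have hopen : IsOpen (U ×ˢ (univ : Set ℝ)) := hU.prod isOpen_univ
  have hmem : U ×ˢ (univ : Set ℝ) ∈ 𝓝 (z, θ) := hopen.mem_nhds ⟨hz, mem_univ _⟩
  have h1 : MDifferentiableAt (𝓘(ℝ, ℂ).prod 𝓘(ℝ, ℝ)) I (fun q : ℂ × ℝ => φ q.2 (f q.1)) (z, θ) :=
    ((contMDiffOn_loop hφ hf).contMDiffAt hmem).mdifferentiableAt (by simp)
  have h2 := ((contMDiffOn_loopMap hφ hH hf).contMDiffAt hmem).mdifferentiableAt
    (show (∞ : WithTop ℕ∞) ≠ 0 by simp)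
  have h3 : MDifferentiableAt (𝓘(ℝ, ℂ).prod 𝓘(ℝ, ℝ)) 𝓘(ℝ, ℂ)
      (fun q : ℂ × ℝ => (loopMap φ H f q).2) (z, θ) :=
    mdifferentiableAt_snd.comp (z, θ) h2
  have hR := ((contMDiffOn_hamiltonian hφ hH hf).contMDiffAt hmem).mdifferentiableAt
    (show (∞ : WithTop ℕ∞) ≠ 0 by simp)
  have hfz : MDifferentiableAt 𝓘(ℝ, ℂ) I f z :=
    (hf.contMDiffAt (hU.mem_nhds hz)).mdifferentiableAt (by simp)
  have hφz : MDifferentiableAt I I (φ θ) (f z) := (φ θ).mdifferentiable (by simp) (f z)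
  -- the component in `M`
  have e1 : (mfderiv (𝓘(ℝ, ℂ).prod 𝓘(ℝ, ℝ)) I (fun q : ℂ × ℝ => φ q.2 (f q.1)) (z, θ) :
      ℂ × ℝ →L[ℝ] E) (v, τ) =
      (mfderiv I I (φ θ) (f z) : E →L[ℝ] E) ((mfderiv 𝓘(ℝ, ℂ) I f z : ℂ →L[ℝ] E) v) +
        τ • (velocity φ θ (f z) : E) := by
    have e2 : (mfderiv 𝓘(ℝ, ℂ) I (fun z => φ θ (f z)) z : ℂ →L[ℝ] E) v =
        (mfderiv I I (φ θ) (f z) : E →L[ℝ] E) ((mfderiv 𝓘(ℝ, ℂ) I f z : ℂ →L[ℝ] E) v) := by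
      have := mfderiv_comp z hφz hfz
      exact congrArg (fun L : ℂ →L[ℝ] E => L v) this
    have e3 : (mfderiv 𝓘(ℝ, ℝ) I (fun s => φ s (f z)) θ : ℝ →L[ℝ] E) τ =
        τ • (velocity φ θ (f z) : E) := by
      have : τ = τ • (1 : ℝ) := by simp
      conv_lhs => rw [this]
      exact map_smul (mfderiv 𝓘(ℝ, ℝ) I (fun s => φ s (f z)) θ : ℝ →L[ℝ] E) τ 1
    refine (mfderiv_prod_eq_add_apply (v := (v, τ)) h1).trans ?_
    exact congrArg₂ (· + ·) e2 e3
  refine ⟨(mfderiv (𝓘(ℝ, ℂ).prod 𝓘(ℝ, ℝ)) 𝓘(ℝ, ℂ) (fun q : ℂ × ℝ => (loopMap φ H f q).2) (z, θ) :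
      ℂ × ℝ →L[ℝ] ℂ) (v, τ), ?_, ?_⟩
  · have := mfderiv_prodMk h1 h3
    refine (congrArg (fun L : ℂ × ℝ →L[ℝ] E × ℂ => L (v, τ)) this).trans ?_
    exact Prod.ext e1 rfl
  · -- the planar component
    set ρ : ℂ × ℝ → ℝ := fun q => √(H q.2 (φ q.2 (f q.1))) with hρ
    have hρz : HasFDerivAt (fun z => ρ (z, θ)) (fderiv ℝ (fun z => ρ (z, θ)) z) z := by
      have : MDifferentiableAt 𝓘(ℝ, ℂ) 𝓘(ℝ, ℝ) (ρ ∘ fun z => (z, θ)) z :=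
        MDifferentiableAt.comp z hR (mdifferentiableAt_id.prodMk mdifferentiableAt_const)
      exact this.differentiableAt.hasFDerivAt
    have hρθ : HasDerivAt (fun θ => ρ (z, θ)) (deriv (fun θ => ρ (z, θ)) θ) θ := by
      have : MDifferentiableAt 𝓘(ℝ, ℝ) 𝓘(ℝ, ℝ) (ρ ∘ fun θ => (z, θ)) θ :=
        MDifferentiableAt.comp θ hR (mdifferentiableAt_const.prodMk mdifferentiableAt_id)
      exact this.differentiableAt.hasDerivAt
    have hexp : HasDerivAt (fun θ : ℝ => Complex.exp (-θ * Complex.I))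
        (Complex.exp (-θ * Complex.I) * (-1 * Complex.I)) θ :=
      ((Complex.ofRealCLM.hasDerivAt (x := θ)).neg.mul_const Complex.I).cexp
    -- the derivative in `z` is radial; that in `θ` has the angular part `-r`, with `r = ρ`
    have e4 : (mfderiv 𝓘(ℝ, ℂ) 𝓘(ℝ, ℂ) (fun z => (loopMap φ H f (z, θ)).2) z : ℂ →L[ℝ] ℂ) v =
        ((fderiv ℝ (fun z => ρ (z, θ)) z v : ℝ) : ℂ) * Complex.exp (-θ * Complex.I) := by
      rw [mfderiv_eq_fderiv]
      have := ((Complex.ofRealCLM.hasFDerivAt.comp z hρz).mul_const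
        (Complex.exp (-θ * Complex.I))).fderiv
      refine (congrArg (fun L : ℂ →L[ℝ] ℂ => L v) this).trans ?_
      simp [mul_comm]
    have e5 : (mfderiv 𝓘(ℝ, ℝ) 𝓘(ℝ, ℂ) (fun θ => (loopMap φ H f (z, θ)).2) θ : ℝ →L[ℝ] ℂ) τ =
        (τ : ℂ) * (((deriv (fun θ => ρ (z, θ)) θ : ℝ) : ℂ) * Complex.exp (-θ * Complex.I) +
          (ρ (z, θ) : ℂ) * (Complex.exp (-θ * Complex.I) * (-1 * Complex.I))) := by
      rw [mfderiv_eq_fderiv]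
      have := (hρθ.ofReal_comp.mul hexp).hasFDerivAt.fderiv
      refine (congrArg (fun L : ℝ →L[ℝ] ℂ => L τ) this).trans ?_
      rw [ContinuousLinearMap.toSpanSingleton_apply, Complex.real_smul]
    have e6 : (mfderiv (𝓘(ℝ, ℂ).prod 𝓘(ℝ, ℝ)) 𝓘(ℝ, ℂ)
          (fun q : ℂ × ℝ => (loopMap φ H f q).2) (z, θ) : ℂ × ℝ →L[ℝ] ℂ) (v, τ) =
        ((fderiv ℝ (fun z => ρ (z, θ)) z v : ℝ) : ℂ) * Complex.exp (-θ * Complex.I) +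
        (τ : ℂ) * (((deriv (fun θ => ρ (z, θ)) θ : ℝ) : ℂ) * Complex.exp (-θ * Complex.I) +
          (ρ (z, θ) : ℂ) * (Complex.exp (-θ * Complex.I) * (-1 * Complex.I))) := by
      refine (mfderiv_prod_eq_add_apply (v := (v, τ)) h3).trans ?_
      exact congrArg₂ (· + ·) e4 e5
    have e7 : (loopMap φ H f (z, θ)).2 = ρ (z, θ) * Complex.exp (-θ * Complex.I) := rfl
    have e8 : Complex.exp (-θ * Complex.I) = ⟨Real.cos θ, -Real.sin θ⟩ := by
      rw [← Complex.ofReal_neg]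
      apply Complex.ext
      · rw [Complex.exp_ofReal_mul_I_re, Real.cos_neg]
      · rw [Complex.exp_ofReal_mul_I_im, Real.sin_neg]
    have e9 : ρ (z, θ) ^ 2 = H θ (φ θ (f z)) := Real.sq_sqrt (hamiltonian_pos hφ hH θ (f z)).le
    rw [e6, e7, e8, ← e9]
    simp
    linear_combination (-τ * ρ (z, θ) ^ 2) * Real.cos_sq_add_sin_sq θ

end LoopMap

/-- A continuous choice of the angle near the point `s₀` of the circle. -/
noncomputable def circleAngle (s₀ s : Circle) : ℝ := Complex.arg s₀ + Complex.arg (s / s₀)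

theorem circleExp_circleAngle (s₀ s : Circle) : Circle.exp (circleAngle s₀ s) = s := by
  rw [circleAngle, Circle.exp_add, Circle.exp_arg, ← Circle.coe_div, Circle.exp_arg]
  exact mul_div_cancel s₀ s

theorem contMDiffAt_circleAngle (s₀ : Circle) :
    ContMDiffAt (𝓡 1) 𝓘(ℝ, ℝ) ∞ (circleAngle s₀) s₀ := by
  have : Fact (Module.finrank ℝ ℂ = 1 + 1) := ⟨by rw [Complex.finrank_real_complex]⟩
  have h1 : ContMDiffAt (𝓡 1) 𝓘(ℝ, ℂ) ∞ (fun s : Circle => (s : ℂ)) s₀ :=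
    contMDiff_coe_sphere s₀
  have h2 : ContDiffAt ℝ ∞ (fun z : ℂ => Complex.arg s₀ + Complex.arg (z / s₀)) (s₀ : ℂ) := by
    have h3 : ((s₀ : ℂ) / s₀) ∈ Complex.slitPlane := by
      rw [div_self s₀.coe_ne_zero]; exact Complex.one_mem_slitPlane
    have h4 : ContDiffAt ℝ ∞ (fun z : ℂ => (Complex.log (z / s₀)).im) (s₀ : ℂ) := by
      have h5 : ContDiffAt ℝ ∞ (fun z : ℂ => z / s₀) (s₀ : ℂ) := by
        simp only [div_eq_mul_inv]
        exact contDiffAt_id.mul contDiffAt_const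
      have h6 : ContDiffAt ℝ ∞ Complex.log ((s₀ : ℂ) / s₀) :=
        (Complex.contDiffAt_log h3).restrict_scalars ℝ
      exact Complex.imCLM.contDiff.contDiffAt.comp (s₀ : ℂ)
        (ContDiffAt.comp (f := fun z : ℂ => z / s₀) (s₀ : ℂ) h6 h5)
    exact contDiffAt_const.add (h4.congr_of_eventuallyEq (by simp [Complex.log_im]))
  exact h2.contMDiffAt.comp s₀ h1

/-- The differential of the angle at the point `s` of the circle. -/
noncomputable def angleForm (s : Circle) : EuclideanSpace ℝ (Fin 1) →L[ℝ] ℝ :=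
  mfderiv (𝓡 1) 𝓘(ℝ, ℝ) (circleAngle s) s

theorem angleForm_injective (s₀ : Circle) :
    Function.Injective (angleForm s₀) := by
  have h1 : MDifferentiableAt (𝓡 1) 𝓘(ℝ, ℝ) (circleAngle s₀) s₀ :=
    (contMDiffAt_circleAngle s₀).mdifferentiableAt (by simp)
  have h2 : MDifferentiableAt 𝓘(ℝ, ℝ) (𝓡 1) Circle.exp (circleAngle s₀ s₀) :=
    contMDiff_circleExp.mdifferentiableAt (by simp : (∞ : WithTop ℕ∞) ≠ 0)
  have h3 : Circle.exp ∘ circleAngle s₀ = id := funext (circleExp_circleAngle s₀)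
  have h4 := mfderiv_comp s₀ h2 h1
  rw [h3, mfderiv_id] at h4
  intro v w hvw
  have e : ∀ v, v = mfderiv 𝓘(ℝ, ℝ) (𝓡 1) Circle.exp (circleAngle s₀ s₀)
      (angleForm s₀ v) := fun v =>
    congrArg (fun L : EuclideanSpace ℝ (Fin 1) →L[ℝ] EuclideanSpace ℝ (Fin 1) => L v) h4
  rw [e v, e w, hvw]

section TorusMap

variable {E : Type*} [NormedAddCommGroup E] [NormedSpace ℝ E]
  {K : Type*} [TopologicalSpace K] {I : ModelWithCorners ℝ E K}
  {M : Type*} [TopologicalSpace M] [ChartedSpace K M]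
  {α : ∀ x : M, TangentSpace I x →L[ℝ] ℝ} {φ : ℝ → M ≃ₘ⟮I, I⟯ M} {H : ℝ → M → ℝ} {f : ℂ → M}
  {U : Set ℂ}

/-- The solid torus swept out by the disc `f` under the loop `φ`: the map `loopMap` on `ℂ × ℝ /
2πℤ`, with the principal argument as the representative of the angle. -/
noncomputable def sweepTorus (φ : ℝ → M ≃ₘ⟮I, I⟯ M) (H : ℝ → M → ℝ) (f : ℂ → M) (q : ℂ × Circle) :
    M × ℂ :=
  loopMap φ H f (q.1, Complex.arg q.2)

theorem sweepTorus_eq_loopMap (hφ : IsPositiveLoop α φ) (hH : IsGeneratedBy α H φ) (z : ℂ)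
    {s : Circle} {θ : ℝ} (h : Circle.exp θ = s) :
    sweepTorus φ H f (z, s) = loopMap φ H f (z, θ) := by
  have h1 : Circle.exp (Complex.arg s) = Circle.exp θ := by rw [Circle.exp_arg, h]
  obtain ⟨m, hm⟩ := Circle.exp_eq_exp.1 h1
  show loopMap φ H f (z, Complex.arg s) = _
  rw [hm]
  exact (loopMap_periodic (f := f) hφ hH z).int_mul m θ

theorem sweepTorus_eq_comp (hφ : IsPositiveLoop α φ) (hH : IsGeneratedBy α H φ) (s₀ : Circle) :
    sweepTorus φ H f = loopMap φ H f ∘ Prod.map id (circleAngle s₀) :=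
  funext fun q => sweepTorus_eq_loopMap hφ hH q.1 (circleExp_circleAngle s₀ q.2)

theorem contMDiffOn_sweepTorus (hφ : IsPositiveLoop α φ) (hH : IsGeneratedBy α H φ) (hU : IsOpen U)
    (hf : ContMDiffOn 𝓘(ℝ, ℂ) I ∞ f U) :
    ContMDiffOn (𝓘(ℝ, ℂ).prod (𝓡 1)) (I.prod 𝓘(ℝ, ℂ)) ∞ (sweepTorus φ H f) (U ×ˢ univ) := by
  rintro ⟨z, s⟩ hq
  rw [sweepTorus_eq_comp hφ hH s]
  have h1 := (contMDiffOn_loopMap hφ hH hf).contMDiffAt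
    ((hU.prod isOpen_univ).mem_nhds (show (z, circleAngle s s) ∈ U ×ˢ univ from ⟨hq.1, trivial⟩))
  exact (h1.comp (z, s) (contMDiffAt_id.prodMap (contMDiffAt_circleAngle s))).contMDiffWithinAt

/-- The derivative of `sweepTorus`, in the form of `exists_mfderiv_loopMap`. -/
theorem exists_mfderiv_sweepTorus (hφ : IsPositiveLoop α φ) (hH : IsGeneratedBy α H φ)
    (hU : IsOpen U)
    (hf : ContMDiffOn 𝓘(ℝ, ℂ) I ∞ f U) {z : ℂ} (hz : z ∈ U) (s : Circle) (v : ℂ)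
    (w : EuclideanSpace ℝ (Fin 1)) :
    ∃ u : ℂ, (mfderiv (𝓘(ℝ, ℂ).prod (𝓡 1)) (I.prod 𝓘(ℝ, ℂ)) (sweepTorus φ H f) (z, s) :
        ℂ × EuclideanSpace ℝ (Fin 1) →L[ℝ] E × ℂ) (v, w) =
      ((mfderiv I I (φ (circleAngle s s)) (f z) : E →L[ℝ] E)
        ((mfderiv 𝓘(ℝ, ℂ) I f z : ℂ →L[ℝ] E) v) +
        angleForm s w •
          (velocity φ (circleAngle s s) (f z) : E), u) ∧
      (loopMap φ H f (z, circleAngle s s)).2.re * u.im -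
        (loopMap φ H f (z, circleAngle s s)).2.im * u.re =
        -(angleForm s w *
          H (circleAngle s s) (φ (circleAngle s s) (f z))) := by
  obtain ⟨u, hu1, hu2⟩ := exists_mfderiv_loopMap hφ hH hU hf hz (circleAngle s s) v
    (angleForm s w)
  refine ⟨u, ?_, hu2⟩
  rw [← hu1]
  have h1 : MDifferentiableAt (𝓘(ℝ, ℂ).prod 𝓘(ℝ, ℝ)) (I.prod 𝓘(ℝ, ℂ)) (loopMap φ H f)
      (z, circleAngle s s) :=
    ((contMDiffOn_loopMap hφ hH hf).contMDiffAt ((hU.prod isOpen_univ).mem_nhds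
      (show (z, circleAngle s s) ∈ U ×ˢ univ from ⟨hz, trivial⟩))).mdifferentiableAt (by simp)
  have h2 : MDifferentiableAt (𝓡 1) 𝓘(ℝ, ℝ) (circleAngle s) s :=
    (contMDiffAt_circleAngle s).mdifferentiableAt (by simp)
  have h3 : MDifferentiableAt 𝓘(ℝ, ℂ) 𝓘(ℝ, ℂ) (id : ℂ → ℂ) z := mdifferentiableAt_id
  have h4 := mfderiv_comp (f := Prod.map id (circleAngle s)) (z, s) h1
    (MDifferentiableAt.prodMap h3 h2)
  rw [← sweepTorus_eq_comp hφ hH s, mfderiv_prodMap (p := (z, s)) h3 h2, mfderiv_id] at h4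
  exact congrArg (fun L : ℂ × EuclideanSpace ℝ (Fin 1) →L[ℝ] E × ℂ => L (v, w)) h4

end TorusMap

section TorusForm

variable {E : Type*} [NormedAddCommGroup E] [NormedSpace ℝ E]
  {K : Type*} [TopologicalSpace K] {I : ModelWithCorners ℝ E K}
  {M : Type*} [TopologicalSpace M] [ChartedSpace K M]
  {α : ∀ x : M, TangentSpace I x →L[ℝ] ℝ} {φ : ℝ → M ≃ₘ⟮I, I⟯ M} {H : ℝ → M → ℝ} {f : ℂ → M}
  {U : Set ℂ}

/-- The form induced on the solid torus swept out by the disc `f` under the loop `φ`. -/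
noncomputable def torusForm (α : ∀ x : M, TangentSpace I x →L[ℝ] ℝ) (φ : ℝ → M ≃ₘ⟮I, I⟯ M)
    (H : ℝ → M → ℝ) (f : ℂ → M) (q : ℂ × Circle) :
    TangentSpace (𝓘(ℝ, ℂ).prod (𝓡 1)) q →L[ℝ] ℝ :=
  pullbackForm (J := 𝓘(ℝ, ℂ).prod (𝓡 1)) (stabilizedForm α) (sweepTorus φ H f) q

/-- The form induced on the solid torus does not see the direction of the circle: there, the value
`H` of `α` and the value `-r ^ 2` of `r ^ 2 dθ` cancel. -/
theorem torusForm_apply (hφ : IsPositiveLoop α φ) (hH : IsGeneratedBy α H φ) (hU : IsOpen U)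
    (hf : ContMDiffOn 𝓘(ℝ, ℂ) I ∞ f U) {z : ℂ} (hz : z ∈ U) (s : Circle) (v : ℂ)
    (w : EuclideanSpace ℝ (Fin 1)) :
    torusForm α φ H f (z, s) ((v, w) : ℂ × EuclideanSpace ℝ (Fin 1)) =
      (α (φ (circleAngle s s) (f z)) : E →L[ℝ] ℝ)
        ((mfderiv I I (φ (circleAngle s s)) (f z) : E →L[ℝ] E)
          ((mfderiv 𝓘(ℝ, ℂ) I f z : ℂ →L[ℝ] E) v)) := by
  obtain ⟨u, hu1, hu2⟩ := exists_mfderiv_sweepTorus hφ hH hU hf hz s v w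
  have h0 : sweepTorus φ H f (z, s) = loopMap φ H f (z, circleAngle s s) :=
    sweepTorus_eq_loopMap hφ hH z (circleExp_circleAngle s s)
  refine (congrArg (stabilizedForm α (sweepTorus φ H f (z, s)) : E × ℂ →L[ℝ] ℝ) hu1).trans ?_
  refine (stabilizedForm_apply _ _ _).trans ?_
  rw [h0, hu2]
  have h1 : (α (φ (circleAngle s s) (f z)) : E →L[ℝ] ℝ) (velocity φ (circleAngle s s) (f z)) =
    H (circleAngle s s) (φ (circleAngle s s) (f z)) := (hH.flow (circleAngle s s) (f z)).1
  have h2 : ∀ (A : E →L[ℝ] ℝ) (x y : E) (c h : ℝ), A y = h → A (x + c • y) + -(c * h) = A x := by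
    rintro A x y c _ rfl
    simp
  exact h2 _ _ _ _ _ h1

theorem torusForm_apply_eq_zero_iff (hφ : IsPositiveLoop α φ) (hH : IsGeneratedBy α H φ)
    (hU : IsOpen U) (hf : ContMDiffOn 𝓘(ℝ, ℂ) I ∞ f U) {z : ℂ} (hz : z ∈ U) (s : Circle) (v : ℂ)
    (w : EuclideanSpace ℝ (Fin 1)) :
    torusForm α φ H f (z, s) ((v, w) : ℂ × EuclideanSpace ℝ (Fin 1)) = 0 ↔
      linearPullback α f z v = 0 := by
  rw [torusForm_apply hφ hH hU hf hz]
  exact hφ.contacto (circleAngle s s) (f z) (mfderiv 𝓘(ℝ, ℂ) I f z v)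

theorem torusForm_eq_zero_iff (hφ : IsPositiveLoop α φ) (hH : IsGeneratedBy α H φ)
    (hU : IsOpen U) (hf : ContMDiffOn 𝓘(ℝ, ℂ) I ∞ f U) {z : ℂ} (hz : z ∈ U) (s : Circle) :
    torusForm α φ H f (z, s) = 0 ↔ linearPullback α f z = 0 := by
  constructor
  · intro h
    ext1 v
    exact (torusForm_apply_eq_zero_iff hφ hH hU hf hz s v 0).1 (by rw [h]; rfl)
  · intro h
    refine ContinuousLinearMap.ext fun (p : ℂ × EuclideanSpace ℝ (Fin 1)) => ?_
    exact (torusForm_apply_eq_zero_iff hφ hH hU hf hz s p.1 p.2).2 (by rw [h]; rfl)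

theorem mfderiv_loop_injective (φ : ℝ → M ≃ₘ⟮I, I⟯ M) (θ : ℝ) (p : M) :
    Function.Injective (mfderiv I I (φ θ) p) :=
  ((φ θ).mfderivToContinuousLinearEquiv (by simp : (∞ : WithTop ℕ∞) ≠ 0) p).injective

/-- The planar component is an immersion in the direction of the circle since `H` does not vanish.
-/
theorem mfderiv_sweepTorus_injective (hφ : IsPositiveLoop α φ) (hH : IsGeneratedBy α H φ)
    (hU : IsOpen U) (hf : ContMDiffOn 𝓘(ℝ, ℂ) I ∞ f U) {z : ℂ} (hz : z ∈ U)
    (himm : Function.Injective (mfderiv 𝓘(ℝ, ℂ) I f z)) (s : Circle) :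
    Function.Injective
      (mfderiv (𝓘(ℝ, ℂ).prod (𝓡 1)) (I.prod 𝓘(ℝ, ℂ)) (sweepTorus φ H f) (z, s)) := by
  refine (injective_iff_map_eq_zero (mfderiv (𝓘(ℝ, ℂ).prod (𝓡 1)) (I.prod 𝓘(ℝ, ℂ))
    (sweepTorus φ H f) (z, s) : ℂ × EuclideanSpace ℝ (Fin 1) →L[ℝ] E × ℂ)).2 ?_
  rintro ⟨v, w⟩ h
  obtain ⟨u, hu1, hu2⟩ := exists_mfderiv_sweepTorus hφ hH hU hf hz s v w
  have h1 := hu1.symm.trans h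
  obtain ⟨h2, h3⟩ := Prod.mk.inj h1
  have h4 : angleForm s w = 0 := by
    rw [h3] at hu2
    have h5 := hamiltonian_pos hφ hH (circleAngle s s) (f z)
    simp only [Complex.zero_re, Complex.zero_im, mul_zero, sub_zero, zero_eq_neg,
      mul_eq_zero, h5.ne', or_false] at hu2
    exact hu2
  have h5 : w = 0 := angleForm_injective s (h4.trans (map_zero _).symm)
  rw [h4, zero_smul, add_zero] at h2
  have h6 := mfderiv_loop_injective φ (circleAngle s s) (f z) (h2.trans (map_zero
    (mfderiv I I (φ (circleAngle s s)) (f z) : E →L[ℝ] E)).symm)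
  have h7 : v = 0 := himm (h6.trans (map_zero (mfderiv 𝓘(ℝ, ℂ) I f z : ℂ →L[ℝ] E)).symm)
  rw [h5, h7]
  rfl

/-- The planar component recovers the angle, and then the disc at this time is embedded. -/
theorem sweepTorus_injOn (hφ : IsPositiveLoop α φ) (hH : IsGeneratedBy α H φ) {D : Set ℂ}
    (hf : InjOn f D) : InjOn (sweepTorus φ H f) (D ×ˢ univ) := by
  rintro ⟨z, s⟩ ⟨hz, -⟩ ⟨z', s'⟩ ⟨hz', -⟩ h
  obtain ⟨h1, h2⟩ := Prod.mk.inj h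
  simp only at h1 h2 hz hz'
  have hexp : ∀ s : Circle, Complex.exp (-(Complex.arg s : ℝ) * Complex.I) = (s⁻¹ : Circle) := by
    intro s
    rw [Circle.coe_inv, neg_mul, Complex.exp_neg, ← Circle.coe_exp, Circle.exp_arg]
  rw [hexp, hexp] at h2
  have p1 := Real.sqrt_pos.2 (hamiltonian_pos hφ hH (Complex.arg s) (f z))
  have p2 := Real.sqrt_pos.2 (hamiltonian_pos hφ hH (Complex.arg s') (f z'))
  have h3 := congrArg norm h2
  rw [norm_mul, norm_mul, Circle.norm_coe, Circle.norm_coe, Complex.norm_of_nonneg p1.le,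
    Complex.norm_of_nonneg p2.le, mul_one, mul_one] at h3
  rw [h3] at h2
  have h4 := mul_left_cancel₀ (Complex.ofReal_ne_zero.2 p2.ne') h2
  have h5 : s = s' := inv_injective (Circle.ext h4)
  subst h5
  rw [hf hz hz' ((φ (Complex.arg s)).injective h1)]

theorem norm_sweepTorus_lt {δ : ℝ} (hδ : 0 < δ)
    (hH : ∀ t p, H t p < δ ^ 2) (q : ℂ × Circle) : ‖(sweepTorus φ H f q).2‖ < δ := by
  simp only [sweepTorus, loopMap, norm_mul]
  rw [← Complex.ofReal_neg, Complex.norm_exp_ofReal_mul_I, mul_one,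
    Complex.norm_of_nonneg (Real.sqrt_nonneg _)]
  exact (Real.sqrt_lt' hδ).2 (hH _ _)

end TorusForm

/-! ### Leaves of a form lifted from the disc to the solid torus -/

section TorusLeaves

variable {b : ℂ → ℂ →L[ℝ] ℝ}
  {B : ∀ q : ℂ × Circle, TangentSpace (𝓘(ℝ, ℂ).prod (𝓡 1)) q →L[ℝ] ℝ} {D : Set ℂ}

/-- The form `B` on `D × S¹` has the same kernel as the pullback of the form `b` on `D`. -/
structure IsLiftedForm (b : ℂ → ℂ →L[ℝ] ℝ)
    (B : ∀ q : ℂ × Circle, TangentSpace (𝓘(ℝ, ℂ).prod (𝓡 1)) q →L[ℝ] ℝ) (D : Set ℂ) : Prop where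
  eq_zero_iff : ∀ z ∈ D, ∀ s, B (z, s) = 0 ↔ b z = 0
  apply_eq_zero_iff : ∀ z ∈ D, ∀ s (v : ℂ) (w : EuclideanSpace ℝ (Fin 1)),
    B (z, s) ((v, w) : ℂ × EuclideanSpace ℝ (Fin 1)) = 0 ↔ b z v = 0

namespace IsLiftedForm

theorem mem_regularSet_iff (h : IsLiftedForm b B D) (z : ℂ) (s : Circle) :
    (z, s) ∈ regularSet B (D ×ˢ univ) ↔ z ∈ regularSet (J := 𝓘(ℝ, ℂ)) b D := by
  constructor
  · rintro ⟨⟨hz, -⟩, h0⟩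
    exact ⟨hz, fun h1 => h0 ((h.eq_zero_iff z hz s).2 h1)⟩
  · rintro ⟨hz, h0⟩
    exact ⟨⟨hz, trivial⟩, fun h1 => h0 ((h.eq_zero_iff z hz s).1 h1)⟩

/-- Tangent paths on the disc lift to the solid torus with any end points over theirs: the lifted
form does not constrain the component of the path in the circle. -/
theorem tangentJoined_iff (h : IsLiftedForm b B D) (x y : ℂ) (s s' : Circle) :
    TangentJoined B (D ×ˢ univ) (x, s) (y, s') ↔ TangentJoined (J := 𝓘(ℝ, ℂ)) b D x y := by
  -- a path in the solid torus is tangent to `ker B` when its projection is tangent to `ker b`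
  have key : ∀ (γ : ℝ → ℂ × Circle), ContMDiffOn 𝓘(ℝ, ℝ) (𝓘(ℝ, ℂ).prod (𝓡 1)) 1 γ (Icc 0 1) →
      ∀ t ∈ Icc (0 : ℝ) 1, (γ t).1 ∈ D →
      (B (γ t) (mfderivWithin 𝓘(ℝ, ℝ) (𝓘(ℝ, ℂ).prod (𝓡 1)) γ (Icc 0 1) t (1 : ℝ)) = 0 ↔
        b (γ t).1 (mfderivWithin 𝓘(ℝ, ℝ) 𝓘(ℝ, ℂ) (fun t => (γ t).1) (Icc 0 1) t (1 : ℝ)) = 0) := by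
    intro γ hγ t ht hD
    have hγt := (hγ t ht).mdifferentiableWithinAt one_ne_zero
    have hu : UniqueMDiffWithinAt 𝓘(ℝ, ℝ) (Icc (0 : ℝ) 1) t :=
      (uniqueDiffOn_Icc one_pos t ht).uniqueMDiffWithinAt
    have h1 : (mfderivWithin 𝓘(ℝ, ℝ) 𝓘(ℝ, ℂ) (fun t => (γ t).1) (Icc 0 1) t : ℝ →L[ℝ] ℂ) =
        (mfderiv (𝓘(ℝ, ℂ).prod (𝓡 1)) 𝓘(ℝ, ℂ) Prod.fst (γ t) :
          ℂ × EuclideanSpace ℝ (Fin 1) →L[ℝ] ℂ).comp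
          (mfderivWithin 𝓘(ℝ, ℝ) (𝓘(ℝ, ℂ).prod (𝓡 1)) γ (Icc 0 1) t) :=
      mfderiv_comp_mfderivWithin t mdifferentiableAt_fst hγt hu
    rw [mfderiv_fst] at h1
    have h2 := congrArg (fun L : ℝ →L[ℝ] ℂ => L 1) h1
    refine (h.apply_eq_zero_iff (γ t).1 hD (γ t).2 _ _).trans ?_
    exact Eq.congr_left (congrArg (b (γ t).1) h2.symm)
  constructor
  · rintro ⟨γ, hγ, h0, h1, hγt⟩
    refine ⟨fun t => (γ t).1, contMDiff_fst.comp_contMDiffOn hγ, congrArg Prod.fst h0,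
      congrArg Prod.fst h1,
      fun t ht => ⟨(h.mem_regularSet_iff _ (γ t).2).1 (hγt t ht).1,
        (key γ hγ t ht (hγt t ht).1.1.1).1 (hγt t ht).2⟩⟩
  · rintro ⟨γ, hγ, h0, h1, hγt⟩
    have hc : ContMDiff 𝓘(ℝ, ℝ) (𝓡 1) 1 fun t : ℝ =>
        Circle.exp (Complex.arg s + t * (Complex.arg s' - Complex.arg s)) :=
      (contMDiff_circleExp (m := 1)).comp
        (contDiff_const.add (contDiff_id.mul contDiff_const)).contMDiff
    refine ⟨fun t => (γ t, Circle.exp (Complex.arg s + t * (Complex.arg s' - Complex.arg s))),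
      hγ.prodMk hc.contMDiffOn, by simp [h0, Circle.exp_arg], by simp [h1, Circle.exp_arg],
      fun t ht => ⟨(h.mem_regularSet_iff _ _).2 (hγt t ht).1, ?_⟩⟩
    exact (key _ (hγ.prodMk hc.contMDiffOn) t ht (hγt t ht).1.1).2 (hγt t ht).2

theorem tangentJoined_refl {x : ℂ} (hx : x ∈ regularSet (J := 𝓘(ℝ, ℂ)) b D) :
    TangentJoined (J := 𝓘(ℝ, ℂ)) b D x x := by
  refine ⟨fun _ => x, contMDiffOn_const, rfl, rfl, fun t _ => ⟨hx, ?_⟩⟩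
  rw [mfderivWithin_const]
  exact map_zero (b x)

theorem eqvGen_tangentJoined_iff (h : IsLiftedForm b B D) {x : ℂ}
    (hx : x ∈ regularSet (J := 𝓘(ℝ, ℂ)) b D) (y : ℂ) (s s' : Circle) :
    Relation.EqvGen (TangentJoined B (D ×ˢ univ)) (x, s) (y, s') ↔
      Relation.EqvGen (TangentJoined (J := 𝓘(ℝ, ℂ)) b D) x y := by
  constructor
  · have : ∀ p q, Relation.EqvGen (TangentJoined B (D ×ˢ univ)) p q →
        Relation.EqvGen (TangentJoined (J := 𝓘(ℝ, ℂ)) b D) p.1 q.1 := by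
      intro p q hpq
      induction hpq with
      | rel p q hpq => exact .rel _ _ ((h.tangentJoined_iff p.1 q.1 p.2 q.2).1 hpq)
      | refl p => exact .refl _
      | symm p q _ ih => exact .symm _ _ ih
      | trans p q r _ _ ih1 ih2 => exact .trans _ _ _ ih1 ih2
    exact this (x, s) (y, s')
  · intro hxy
    have : ∀ x y, Relation.EqvGen (TangentJoined (J := 𝓘(ℝ, ℂ)) b D) x y →
        (x ∈ regularSet (J := 𝓘(ℝ, ℂ)) b D ↔ y ∈ regularSet (J := 𝓘(ℝ, ℂ)) b D) ∧
        (x ∈ regularSet (J := 𝓘(ℝ, ℂ)) b D → ∀ s s',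
          Relation.EqvGen (TangentJoined B (D ×ˢ univ)) (x, s) (y, s')) := by
      intro x y hxy
      induction hxy with
      | rel x y hxy =>
        refine ⟨?_, fun _ s s' => .rel _ _ ((h.tangentJoined_iff x y s s').2 hxy)⟩
        obtain ⟨γ, -, rfl, rfl, hγ⟩ := hxy
        exact iff_of_true (hγ 0 ⟨le_rfl, zero_le_one⟩).1 (hγ 1 ⟨zero_le_one, le_rfl⟩).1
      | refl x =>
        exact ⟨Iff.rfl, fun hx s s' =>
          .rel _ _ ((h.tangentJoined_iff x x s s').2 (tangentJoined_refl hx))⟩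
      | symm x y _ ih => exact ⟨ih.1.symm, fun hy s s' => .symm _ _ (ih.2 (ih.1.2 hy) s' s)⟩
      | trans x y z _ _ ih1 ih2 =>
        exact ⟨ih1.1.trans ih2.1, fun hx s s' =>
          .trans _ _ _ (ih1.2 hx s s) (ih2.2 (ih1.1.1 hx) s s')⟩
    exact (this x y hxy).2 hx s s'

/-- The leaves on the solid torus are the products of the leaves on the disc with the circle. -/
theorem isLeaf_iff (h : IsLiftedForm b B D) (L : Set (ℂ × Circle)) :
    IsLeaf B (D ×ˢ univ) L ↔ ∃ L₀, IsLeaf (J := 𝓘(ℝ, ℂ)) b D L₀ ∧ L = L₀ ×ˢ univ := by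
  have key : ∀ {x : ℂ} (s : Circle), x ∈ regularSet (J := 𝓘(ℝ, ℂ)) b D →
      {q | Relation.EqvGen (TangentJoined B (D ×ˢ univ)) (x, s) q} =
        {y | Relation.EqvGen (TangentJoined (J := 𝓘(ℝ, ℂ)) b D) x y} ×ˢ univ := by
    intro x s hx
    ext ⟨y, s'⟩
    exact (h.eqvGen_tangentJoined_iff hx y s s').trans (by simp)
  constructor
  · rintro ⟨⟨x, s⟩, hx, rfl⟩
    have hx' := (h.mem_regularSet_iff x s).1 hx
    exact ⟨_, ⟨x, hx', rfl⟩, key s hx'⟩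
  · rintro ⟨_, ⟨x, hx, rfl⟩, rfl⟩
    exact ⟨(x, 1), (h.mem_regularSet_iff x 1).2 hx, (key 1 hx).symm⟩

theorem isClosedLeaf_iff (h : IsLiftedForm b B D) (L : Set (ℂ × Circle)) :
    IsClosedLeaf B (D ×ˢ univ) L ↔
      ∃ L₀, IsClosedLeaf (J := 𝓘(ℝ, ℂ)) b D L₀ ∧ L = L₀ ×ˢ univ := by
  constructor
  · rintro ⟨hL, hc⟩
    obtain ⟨L₀, hL₀, rfl⟩ := (h.isLeaf_iff L).1 hL
    refine ⟨L₀, ⟨hL₀, ?_⟩, rfl⟩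
    rw [← fst_image_prod L₀ (univ_nonempty (α := Circle))]
    exact hc.image continuous_fst
  · rintro ⟨L₀, ⟨hL₀, hc⟩, rfl⟩
    exact ⟨(h.isLeaf_iff _).2 ⟨L₀, hL₀, rfl⟩, hc.prod isCompact_univ⟩

end IsLiftedForm

end TorusLeaves

/-! ### The foliation by stripes -/

/-- The function `t ↦ log (t / (1 - t))`, which identifies `(0, 1)` with the real line. -/
noncomputable def logit (t : ℝ) : ℝ := Real.log t - Real.log (1 - t)

theorem sigmoid_logit {t : ℝ} (ht : t ∈ Ioo (0 : ℝ) 1) : Real.sigmoid (logit t) = t := by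
  have h1 : 0 < 1 - t := sub_pos.2 ht.2
  rw [Real.sigmoid_def, logit, neg_sub, Real.exp_sub, Real.exp_log h1, Real.exp_log ht.1]
  have := ht.1.ne'
  field_simp
  ring

theorem logit_sigmoid (x : ℝ) : logit (Real.sigmoid x) = x :=
  Real.sigmoid_injective (sigmoid_logit ⟨Real.sigmoid_pos x, Real.sigmoid_lt_one x⟩)

theorem contDiffOn_logit : ContDiffOn ℝ ∞ logit (Ioo 0 1) :=
  (contDiffOn_id.log fun _ ht => ht.1.ne').sub
    ((contDiffOn_const.sub contDiffOn_id).log fun _ ht => (sub_pos.2 ht.2).ne')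

theorem exists_hasDerivAt_logit {t : ℝ} (ht : t ∈ Ioo (0 : ℝ) 1) :
    ∃ d, d ≠ 0 ∧ HasDerivAt logit d t := by
  have h1 : 0 < 1 - t := sub_pos.2 ht.2
  refine ⟨_, ?_, (Real.hasDerivAt_log ht.1.ne').sub
    (((hasDerivAt_id t).const_sub 1).log h1.ne')⟩
  have h2 : 0 < t⁻¹ := inv_pos.2 ht.1
  have h3 : -1 / (1 - id t) < 0 := div_neg_of_neg_of_pos (by norm_num) h1
  linarith

theorem tendsto_logit_zero : Tendsto logit (𝓝[>] 0) atBot := by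
  have h1 : Tendsto (fun t : ℝ => -Real.log (1 - t)) (𝓝[>] 0) (𝓝 0) := by
    have h2 : ContinuousAt (fun t : ℝ => -Real.log (1 - t)) 0 :=
      ((continuousAt_const.sub continuousAt_id).log (by simp)).neg
    simpa using h2.tendsto.mono_left nhdsWithin_le_nhds
  exact Real.tendsto_log_nhdsGT_zero.atBot_add h1

theorem tendsto_logit_one : Tendsto logit (𝓝[<] 1) atTop := by
  have h1 : Tendsto Real.log (𝓝[<] 1) (𝓝 0) := by
    simpa using (Real.continuousAt_log one_ne_zero).tendsto.mono_left nhdsWithin_le_nhds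
  have h2 : Tendsto (fun t : ℝ => 1 - t) (𝓝[<] 1) (𝓝[>] 0) := by
    refine tendsto_nhdsWithin_iff.2 ⟨?_, ?_⟩
    · have : Continuous fun t : ℝ => 1 - t := by fun_prop
      simpa using this.tendsto 1 |>.mono_left nhdsWithin_le_nhds
    · filter_upwards [self_mem_nhdsWithin] with t ht
      exact sub_pos.2 (mem_Iio.1 ht)
  have h3 := tendsto_neg_atBot_atTop.comp (Real.tendsto_log_nhdsGT_zero.comp h2)
  exact h1.add_atTop h3

/-- The function `logit` as a homeomorphism from `(0, 1)` to the real line. -/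
noncomputable def logitHomeomorph : OpenPartialHomeomorph ℝ ℝ where
  toFun := logit
  invFun := Real.sigmoid
  source := Ioo 0 1
  target := univ
  map_source' _ _ := trivial
  map_target' x _ := ⟨Real.sigmoid_pos x, Real.sigmoid_lt_one x⟩
  left_inv' _ ht := sigmoid_logit ht
  right_inv' x _ := logit_sigmoid x
  open_source := isOpen_Ioo
  open_target := isOpen_univ
  continuousOn_toFun := contDiffOn_logit.continuousOn
  continuousOn_invFun := continuous_sigmoid.continuousOn

theorem image_logit : logit '' Ioo 0 1 = univ := logitHomeomorph.image_source_eq_target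

/-- The stripes in the solid torus which are the products with the circle of the orbits `Ψ (c, ·)`
in the punctured disc, with time reparametrized by `(0, 1)`. -/
noncomputable def stripeChart (Ψ : Circle × ℝ ≃ₜ (Metric.ball 0 1 \ {0} : Set ℂ)) :
    OpenPartialHomeomorph (Circle × ℝ × Circle) (ℂ × Circle) :=
  ((Homeomorph.prodAssoc Circle ℝ Circle).symm.toOpenPartialHomeomorph.trans
    (((OpenPartialHomeomorph.refl Circle).prod logitHomeomorph).prod
      (OpenPartialHomeomorph.refl Circle))).trans
    ((((Metric.isOpen_ball.sdiff isClosed_singleton).isOpenEmbedding_subtypeVal.comp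
      Ψ.isOpenEmbedding).toOpenPartialHomeomorph _).prod (OpenPartialHomeomorph.refl Circle))

section Stripes

variable (Ψ : Circle × ℝ ≃ₜ (Metric.ball 0 1 \ {0} : Set ℂ))

theorem stripeChart_source : (stripeChart Ψ).source = univ ×ˢ Ioo (0 : ℝ) 1 ×ˢ univ := by
  ext ⟨c, t, s⟩
  simp [stripeChart, logitHomeomorph]
  rfl

theorem stripeChart_target : (stripeChart Ψ).target = (Metric.ball 0 1 \ {0}) ×ˢ univ := by
  ext ⟨z, s⟩
  simp [stripeChart, logitHomeomorph]

end Stripes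

/-- If the kernel of the form on the disc is spanned by a spiralling field, the products of its
orbits with the circle are stripes that foliate the interior of the solid torus without its core. -/
theorem IsSpiralFlow.exists_stripes {ε : ℝ} {X : ℂ → ℂ} {φ : Flow ℝ ℂ} (h : IsSpiralFlow ε X φ)
    {b : ℂ → ℂ →L[ℝ] ℝ} {B : ∀ q : ℂ × Circle, TangentSpace (𝓘(ℝ, ℂ).prod (𝓡 1)) q →L[ℝ] ℝ}
    (hB : IsLiftedForm b B (Metric.closedBall 0 1))
    (hb : ∀ z ∈ Metric.closedBall (0 : ℂ) 1, b z = 0 ↔ z = 0) (hker : ∀ z, b z (X z) = 0) :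
    ∃ Φ : OpenPartialHomeomorph (Circle × ℝ × Circle) (ℂ × Circle),
    Φ.source = univ ×ˢ Ioo (0 : ℝ) 1 ×ˢ univ ∧
    Φ.target = (Metric.ball 0 1 \ {0}) ×ˢ univ ∧
    ∀ c : Circle,
      ContMDiffOn (𝓘(ℝ, ℝ).prod (𝓡 1)) (𝓘(ℝ, ℂ).prod (𝓡 1)) ∞
        (fun q : ℝ × Circle => Φ (c, q)) (Ioo (0 : ℝ) 1 ×ˢ univ) ∧
      (∀ q ∈ Ioo (0 : ℝ) 1 ×ˢ (univ : Set Circle), Function.Injective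
        (mfderiv (𝓘(ℝ, ℝ).prod (𝓡 1)) (𝓘(ℝ, ℂ).prod (𝓡 1))
          (fun q : ℝ × Circle => Φ (c, q)) q)) ∧
      IsLeaf B solidTorus
        ((fun q : ℝ × Circle => Φ (c, q)) '' (Ioo (0 : ℝ) 1 ×ˢ univ)) ∧
      (∀ s : Circle, Tendsto (fun q : ℝ × Circle => Φ (c, q)) (𝓝[>] 0 ×ˢ 𝓝 s) (𝓝 (0, s))) ∧
      Tendsto (fun q : ℝ × Circle => ‖(Φ (c, q)).1‖) (𝓝[<] 1 ×ˢ ⊤) (𝓝 1) := by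
  obtain ⟨ψ, hψ, C, Ψ, hΨ, h0, h1⟩ := h.exists_homeomorph
  -- the reversed flow is generated by `-X`
  obtain ⟨ε', Y, hY, hkerY⟩ : ∃ ε' Y, IsSpiralFlow ε' Y ψ ∧ ∀ z, b z (Y z) = 0 := by
    rcases hψ with rfl | rfl
    · exact ⟨ε, X, h, hker⟩
    · exact ⟨-ε, -X, h.reverse, fun z => by simp [hker z]⟩
  have hC : ∀ c t, ‖ψ t (C c)‖ < 1 ∧ ψ t (C c) ≠ 0 := by
    intro c t
    have := (Ψ (c, t)).2
    rw [hΨ] at this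
    exact ⟨mem_ball_zero_iff.1 this.1, this.2⟩
  have hC0 : ∀ c, ‖C c‖ < 1 ∧ C c ≠ 0 := fun c => by simpa using hC c 0
  refine ⟨stripeChart Ψ, stripeChart_source Ψ, stripeChart_target Ψ, fun c => ?_⟩
  have hΦ : (fun q : ℝ × Circle => stripeChart Ψ (c, q)) =
      Prod.map (fun t => ψ (logit t) (C c)) id := by
    funext q
    exact Prod.ext (hΨ c (logit q.1)) rfl
  have hsm : ContDiffOn ℝ ∞ (fun t => ψ (logit t) (C c)) (Ioo 0 1) :=
    (hY.integrates.contDiff_orbit hY.smooth (C c)).comp_contDiffOn contDiffOn_logit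
  rw [hΦ]
  refine ⟨hsm.contMDiffOn.prodMap contMDiffOn_id, ?_, ?_, ?_, ?_⟩
  · rintro ⟨t, s⟩ ⟨ht, -⟩
    obtain ⟨d, hd, hdt⟩ := exists_hasDerivAt_logit ht
    have hdv : HasDerivAt (fun t => ψ (logit t) (C c)) (d • Y (ψ (logit t) (C c))) t :=
      (hY.integrates (C c) (logit t)).scomp t hdt
    have hne : d • Y (ψ (logit t) (C c)) ≠ 0 :=
      smul_ne_zero hd (hY.ne_zero _ (hC c _).1.le (hC c _).2)
    have hm : MDifferentiableAt 𝓘(ℝ, ℝ) 𝓘(ℝ, ℂ) (fun t => ψ (logit t) (C c)) t :=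
      hdv.differentiableAt.mdifferentiableAt
    have e := mfderiv_prodMap (p := (t, s)) hm (mdifferentiableAt_id (I := 𝓡 1))
    rw [mfderiv_eq_fderiv, hdv.hasFDerivAt.fderiv, mfderiv_id] at e
    rw [e]
    rintro ⟨v, w⟩ ⟨v', w'⟩ hvw
    obtain ⟨h2, h3⟩ := Prod.mk.inj hvw
    have h4 : v = v' := smul_left_injective ℝ hne h2
    exact Prod.ext h4 h3
  · refine (hB.isLeaf_iff _).2 ⟨range fun t => ψ t (C c), ?_, ?_⟩
    · obtain ⟨K, hK⟩ := hY.lipschitz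
      have hmem : ∀ z, z ∈ regularSet (J := 𝓘(ℝ, ℂ)) b (Metric.closedBall 0 1) ↔
          ‖z‖ ≤ 1 ∧ z ≠ 0 := by
        intro z
        rw [← mem_closedBall_zero_iff]
        exact and_congr_right fun hz => not_congr (hb z hz)
      refine (isLeaf_iff_exists_range_flow hY.integrates hY.smooth hK (fun z _ => hkerY z)
        (fun z hz => ?_) (fun z hz t => ?_) _).2 ⟨C c, (hmem _).2 ⟨(hC0 c).1.le, (hC0 c).2⟩, rfl⟩
      · exact hY.ne_zero z ((hmem z).1 hz).1 ((hmem z).1 hz).2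
      · obtain ⟨hz1, hz0⟩ := (hmem z).1 hz
        refine (hmem _).2 ⟨?_, fun h2 => hz0 (hY.apply_eq_zero.1 h2)⟩
        rcases hz1.lt_or_eq with hz1 | hz1
        · exact (hY.norm_apply_lt_one hz1 t).le
        · exact (hY.norm_apply_of_norm_eq_one hz1 t).le
    · rw [prodMap_image_prod, image_id, ← image_univ, ← image_logit, image_image]
  · intro s
    rw [nhds_prod_eq]
    exact ((h0 c).comp tendsto_logit_zero).prodMap tendsto_id
  · have h2 : (fun q : ℝ × Circle => ‖(stripeChart Ψ (c, q)).1‖) =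
        fun q : ℝ × Circle => ‖ψ (logit q.1) (C c)‖ :=
      funext fun q => congrArg (fun p => ‖p.1‖) (congrFun hΦ q)
    rw [h2]
    exact ((h1 c).comp tendsto_logit_one).comp tendsto_fst

/-! ### The plastikstufe -/

theorem proposition9 {M : Type*} [TopologicalSpace M] [T2Space M] [SecondCountableTopology M]
    [ChartedSpace (EuclideanSpace ℝ (Fin 3)) M] [IsManifold (𝓡 3) ∞ M]
    (α : ∀ x : M, TangentSpace (𝓡 3) x →L[ℝ] ℝ) (hα : IsContactForm α)
    (hot : IsOvertwisted α)
    (φ : ℝ → M ≃ₘ⟮𝓡 3, 𝓡 3⟯ M) (hφ : IsPositiveLoop α φ)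
    (H : ℝ → M → ℝ) (hH : IsGeneratedBy α H φ)
    (δ : ℝ) (hδ : 0 < δ) (hHδ : ∀ t p, H t p < δ ^ 2) :
    ∃ ι : ℂ × Circle → M × ℂ,
      IsPlastikstufe (stabilizedForm α) ι ∧
        MapsTo ι solidTorus (univ ×ˢ Metric.ball (0 : ℂ) δ) := by
  obtain ⟨f₀, hf₀⟩ := hot
  obtain ⟨f, hf, hsing⟩ := hf₀.exists_singular_zero
  obtain ⟨U, hU, hDU, hfU⟩ := hf.smooth
  have h0 : (0 : ℂ) ∈ Metric.closedBall (0 : ℂ) 1 := Metric.mem_closedBall_self zero_le_one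
  have hd := fderiv_linearPullback_sub_ne_zero (by simp) hα hU (hDU h0) hfU (hf.immersion 0 h0)
    ((hsing 0 h0).2 rfl)
  obtain ⟨ε, X, ψ, hψ, hker⟩ := exists_isSpiralFlow hU hDU
    (contDiffOn_pullbackForm hα.smooth hU hfU)
    hsing hd hf.closedLeaf
  have hB : IsLiftedForm (linearPullback α f) (torusForm α φ H f) (Metric.closedBall 0 1) :=
    ⟨fun z hz s => torusForm_eq_zero_iff hφ hH hU hfU (hDU hz) s,
      fun z hz s v w => torusForm_apply_eq_zero_iff hφ hH hU hfU (hDU hz) s v w⟩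
  refine ⟨sweepTorus φ H f, ?_, fun q _ => ⟨trivial, ?_⟩⟩
  · exact
    { smooth := ⟨U ×ˢ univ, hU.prod isOpen_univ, prod_mono hDU Subset.rfl,
        contMDiffOn_sweepTorus hφ hH hU hfU⟩
      injOn := sweepTorus_injOn hφ hH hf.injOn
      immersion := fun q hq =>
        mfderiv_sweepTorus_injective hφ hH hU hfU (hDU hq.1) (hf.immersion q.1 hq.1) q.2
      singular := fun q hq => (hB.eq_zero_iff q.1 hq.1 q.2).trans (hsing q.1 hq.1)
      closedLeaf := fun L => by
        refine (hB.isClosedLeaf_iff L).trans ⟨?_, fun h => ⟨_, (hf.closedLeaf _).2 rfl, h⟩⟩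
        rintro ⟨L₀, hL₀, rfl⟩
        rw [(hf.closedLeaf L₀).1 hL₀]
      stripes := hψ.exists_stripes hB hsing hker }
  · exact mem_ball_zero_iff.2 (norm_sweepTorus_lt hδ hHδ q)
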